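/- Let $G$ be a finite group with a split BN-pair $(B,N,S)$ of characteristic a prime $p$. That is: $T:=B\cap N$ is normal in $N$; $G$ is generated by $B$ and $N$; $W:=N/T$ is generated by the set $S$ of involutions; $sBw\subseteq BwB\cup BswB$ and $sBs\neq B$ for all $s\in S$, $w\in W$; $B=U\rtimes T$ with $U$ a $p$-group normal in $B$ and $T$ of order prime to $p$; $\bigcap_{n\in N}n^{-1}Bn=T$; and for every $I\subseteq S$ the group $U_I:=U\cap w_I^{-1}Uw_I$ is normal in $U$, where $w_I$ is the longest element of $W_I:=\langle I\rangle$. For $I\subseteq S$ let $P_I=BW_IB$ be the standard parabolic subgroup and $L_I=P_I\cap P_I^-$ its standard Levi subgroup, where $P_I^-=B^-W_IB^-$ and $B^-=w_S^{-1}Bw_S$ (so that $P_I=U_I\rtimes L_I$). The group $L_I$ is taken with the BN-pair $(B\cap L_I,\,N\cap L_I,\,I)$. Fix a total order on $S$. Let $\mathrm{St}(G)$ be the bounded cochain complex of $\mathbb{Z}G$-modules with $\mathrm{St}(G)^i=\bigoplus_{J\subseteq S,\ |J|=i}\mathbb{Z}[G/P_J]$ and differential $gP_J\mapsto\sum_{s\in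 S\setminus J}(-1)^{n(J,s)}\,gP_{J\cup\{s\}}$, where $n(J,s)$ is the number of elements of $J$ smaller than $s$. The complex $\mathrm{St}(L_I)$ of $\mathbb{Z}L_I$-modules is defined in the same way from the BN-pair of $L_I$ and the induced order on $I$. Then for every $I\subseteq S$ $$\mathrm{Res}^G_{P_I}\,\mathrm{St}(G)\;\cong\;\mathrm{Ind}^{P_I}_{L_I}\,\mathrm{St}(L_I)\quad\text{in } K^b(\mathbb{Z}P_I),$$ the homotopy category of bounded complexes of $\mathbb{Z}P_I$-modules. In particular (the case $I=\emptyset$; the Solomon–Tits theorem), the homology of $\mathrm{St}(G)$ is concentrated in degree $0$. -/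

import Mathlib

open CategoryTheory CategoryTheory.Limits

noncomputable section

/-! ### Cochain complex of a coefficient system on the subsets of a finite ordered set -/

section CoefficientSystem

universe v u w

set_option linter.unusedSectionVars false

variable {ι : Type w} [Fintype ι] [LinearOrder ι]
variable {C : Type u} [Category.{v} C] [Preadditive C] [HasFiniteBiproducts C]

/-- A coefficient system on `2^ι` with values in `C` is a functor on the poset of subsets of `ι`:
an object `M^I` for each `I ⊆ ι` and maps `φ_{JI} : M^I ⟶ M^J` for `I ⊆ J`. -/
abbrev CoeffSystem (ι : Type w) (C : Type u) [Category.{v} C] := Finset ι ⥤ C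

namespace CoeffSystem

/-- The subsets with `i` elements; empty for negative `i`. -/
abbrev Level (ι : Type w) (i : ℤ) : Type w := {I : Finset ι // (I.card : ℤ) = i}

/-- `n(I, s)`: the number of elements of `I` that are `< s`. -/
def below (I : Finset ι) (s : ι) : ℕ := (I.filter (· < s)).card

lemma card_insert_level {i : ℤ} (I : Level ι i) {s : ι} (hs : s ∉ I.1) :
    ((insert s I.1).card : ℤ) = i + 1 := by
  rw [Finset.card_insert_of_notMem hs]
  push_cast
  rw [I.2]

/-- The degree `i` term `⊕_{|I| = i} M^I`. -/
abbrev X (M : CoeffSystem ι C) (i : ℤ) : C := ⨁ fun I : Level ι i => M.obj I.1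

/-- The differential; on `M^I` it is `∑_{s ∉ I} (-1)^{n(I,s)} φ_{I ∪ {s}, I}`. -/
def d (M : CoeffSystem ι C) (i : ℤ) : X M i ⟶ X M (i + 1) :=
  biproduct.desc fun I : Level ι i => ∑ s : {s : ι // s ∉ I.1},
    ((-1 : ℤ) ^ below I.1 s.1) •
      (M.map (homOfLE (Finset.subset_insert s.1 I.1)) ≫
        biproduct.ι (fun J : Level ι (i + 1) => M.obj J.1)
          ⟨insert s.1 I.1, card_insert_level I s.2⟩)

lemma map_ι_congr (M : CoeffSystem ι C) {j : ℤ} {I J J' : Finset ι} (hJ : J = J')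
    (h : I ≤ J) (h' : I ≤ J') (c : (J.card : ℤ) = j) (c' : (J'.card : ℤ) = j) :
    M.map (homOfLE h) ≫ biproduct.ι (fun K : Level ι j => M.obj K.1) ⟨J, c⟩ =
      M.map (homOfLE h') ≫ biproduct.ι (fun K : Level ι j => M.obj K.1) ⟨J', c'⟩ := by
  subst hJ
  rfl

lemma below_insert (I : Finset ι) {s : ι} (t : ι) (hs : s ∉ I) :
    below (insert s I) t = below I t + if s < t then 1 else 0 := by
  unfold below
  rw [Finset.filter_insert]
  split_ifs with h
  · rw [Finset.card_insert_of_notMem (by simp [hs])]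
  · rfl

lemma sign_cancel (I : Finset ι) {s t : ι} (hs : s ∉ I) (ht : t ∉ I) (hst : s ≠ t) :
    (-1 : ℤ) ^ below I s * (-1) ^ below (insert s I) t
      + (-1 : ℤ) ^ below I t * (-1) ^ below (insert t I) s = 0 := by
  rw [below_insert I t hs, below_insert I s ht]
  rcases lt_or_gt_of_ne hst with h | h
  · simp only [h, not_lt_of_gt h, if_true, if_false, pow_add]
    ring
  · simp only [h, not_lt_of_gt h, if_true, if_false, pow_add]
    ring

lemma d_comp_d (M : CoeffSystem ι C) (i : ℤ) : d M i ≫ d M (i + 1) = 0 := by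
  unfold d
  refine biproduct.hom_ext' _ _ fun I => ?_
  rw [← Category.assoc, biproduct.ι_desc, comp_zero, Preadditive.sum_comp]
  simp only [Preadditive.zsmul_comp, Category.assoc, biproduct.ι_desc, Preadditive.comp_sum,
    Preadditive.comp_zsmul, Finset.smul_sum, smul_smul]
  rw [Finset.sum_sigma']
  refine Finset.sum_involution
    (fun a _ => ⟨⟨a.2.1, fun h => a.2.2 (Finset.mem_insert_of_mem h)⟩,
      ⟨a.1.1, fun h => (Finset.mem_insert.1 h).elim
        (fun e => a.2.2 (by rw [← e]; exact Finset.mem_insert_self _ _)) a.1.2⟩⟩)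
    ?_ ?_ ?_ ?_
  · rintro ⟨⟨s, hs⟩, ⟨t, ht⟩⟩ -
    have hst : s ≠ t := fun e => ht (by rw [← e]; exact Finset.mem_insert_self _ _)
    have ht' : t ∉ I.1 := fun h => ht (Finset.mem_insert_of_mem h)
    dsimp only
    simp only [← Category.assoc, ← M.map_comp, homOfLE_comp]
    rw [map_ι_congr M (Finset.insert_comm s t I.1)
      (J := insert s (insert t I.1)) (J' := insert t (insert s I.1))
      (h' := (Finset.subset_insert _ _).trans (Finset.subset_insert _ _))
      (c' := by
        have := card_insert_level ⟨insert s I.1, card_insert_level I hs⟩ ht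
        exact this)]
    rw [← add_smul, sign_cancel I.1 hs ht' hst, zero_smul]
  · rintro ⟨⟨s, hs⟩, ⟨t, ht⟩⟩ - _ h
    have e : t = s := congrArg (fun a => a.1.1) h
    exact ht (by rw [e]; exact Finset.mem_insert_self _ _)
  · intro a _
    exact Finset.mem_sigma.2 ⟨Finset.mem_univ _, Finset.mem_univ _⟩
  · rintro ⟨⟨s, hs⟩, ⟨t, ht⟩⟩ -
    rfl

/-- The cochain complex associated with a coefficient system. -/
def complex (M : CoeffSystem ι C) : CochainComplex C ℤ :=
  CochainComplex.of (X M) (d M) (d_comp_d M)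

end CoeffSystem

end CoefficientSystem

/-! ### The homotopy category of bounded complexes -/

section Bounded

universe v u v' u'

variable {C : Type u} [Category.{v} C] [Preadditive C]

/-- A cochain complex with only finitely many nonzero terms. -/
def IsBoundedComplex (K : CochainComplex C ℤ) : Prop :=
  ∃ a b : ℤ, ∀ i : ℤ, (i < a ∨ b < i) → IsZero (K.X i)

/-- `K^b(C)`: bounded cochain complexes and homotopy classes of chain maps. -/
abbrev Kb (C : Type u) [Category.{v} C] [Preadditive C] :=
  ObjectProperty.FullSubcategory
    (fun K : HomotopyCategory C (ComplexShape.up ℤ) => IsBoundedComplex K.as)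

/-- A bounded complex as an object of `K^b(C)`. -/
def Kb.of (K : CochainComplex C ℤ) (hK : IsBoundedComplex K) : Kb C :=
  ⟨(HomotopyCategory.quotient C (ComplexShape.up ℤ)).obj K, hK⟩

lemma CoeffSystem.isBounded_complex {ι : Type*} [Fintype ι] [LinearOrder ι]
    [HasFiniteBiproducts C] (M : CoeffSystem ι C) : IsBoundedComplex M.complex := by
  refine ⟨0, Fintype.card ι, fun i hi => ?_⟩
  have hE : IsEmpty (Level ι i) := ⟨fun I => by
    have h1 := I.2
    have h2 : I.1.card ≤ Fintype.card ι := Finset.card_le_univ _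
    omega⟩
  rw [IsZero.iff_id_eq_zero]
  exact biproduct.hom_ext' _ _ fun I => hE.elim I

lemma IsBoundedComplex.map {D : Type u'} [Category.{v'} D] [Preadditive D]
    {K : CochainComplex C ℤ} (hK : IsBoundedComplex K) (F : C ⥤ D) [F.Additive] :
    IsBoundedComplex ((F.mapHomologicalComplex (ComplexShape.up ℤ)).obj K) := by
  obtain ⟨a, b, h⟩ := hK
  exact ⟨a, b, fun i hi => F.map_isZero (h i hi)⟩

end Bounded

instance indFunctor_additive {k G H : Type*} [CommRing k] [Group G] [Group H] (φ : G →* H) :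
    (Rep.indFunctor k φ).Additive where
  map_add {A B f g} := by
    ext x
    induction x using Representation.Coinvariants.induction_on with
    | h x => simp [Rep.indMap, Rep.add_hom]

/-! ### BN-pairs -/

section BN

universe u w

/-- The data `(B, N, S)` of a BN-pair on a group `G`, without axioms. The set `S ⊆ N/T`, where
`T = B ∩ N`, is indexed by `ι`, and the element with index `i` is the coset `s i * T`. -/
structure BNData (G : Type u) [Group G] (ι : Type w) where
  B : Subgroup G
  N : Subgroup G
  s : ι → G

namespace BNData

variable {G : Type u} [Group G] {ι : Type w} (D : BNData G ι)

/-- `T = B ∩ N`. -/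
def T : Subgroup G := D.B ⊓ D.N

/-- `N_I`, the inverse image in `N` of the subgroup `W_I` of `W = N/T` generated by `I`. -/
def NI (I : Set ι) : Subgroup G := Subgroup.closure ((D.T : Set G) ∪ D.s '' I)

/-- The standard parabolic subgroup `P_I = B W_I B`, that is, the subgroup generated by `B`
and `I`. -/
def P (I : Set ι) : Subgroup G := Subgroup.closure ((D.B : Set G) ∪ D.s '' I)

/-- The length of the class of `n` in `W = N/T` with respect to `S`. -/
def len (n : G) : ℕ :=
  sInf {k | ∃ l : List ι, l.length = k ∧ ((l.map D.s).prod)⁻¹ * n ∈ D.T}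

/-- `n` represents the element `w_I` of maximal length of `W_I`. -/
def IsLongest (I : Set ι) (n : G) : Prop :=
  n ∈ D.NI I ∧ ∀ m ∈ D.NI I, D.len m ≤ D.len n

/-- `P_I⁻`, the subgroup generated by `I` and the opposite Borel subgroup
`B⁻ = w_S⁻¹ B w_S`, with `w_S` the longest element of `W`. -/
def Pminus (I : Set ι) : Subgroup G :=
  Subgroup.closure ({g | ∃ n, D.IsLongest Set.univ n ∧ n * g * n⁻¹ ∈ D.B} ∪ D.s '' I)

/-- The standard Levi subgroup `L_I = P_I ∩ P_I⁻`. -/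
def L (I : Set ι) : Subgroup G := D.P I ⊓ D.Pminus I

lemma L_le_P (I : Set ι) : D.L I ≤ D.P I := inf_le_left

lemma s_mem_L {I : Set ι} {i : ι} (hi : i ∈ I) : D.s i ∈ D.L I :=
  ⟨Subgroup.subset_closure (Or.inr ⟨i, hi, rfl⟩), Subgroup.subset_closure (Or.inr ⟨i, hi, rfl⟩)⟩

lemma P_mono {I J : Set ι} (h : I ⊆ J) : D.P I ≤ D.P J :=
  Subgroup.closure_mono (Set.union_subset_union_right _ (Set.image_mono h))

/-- The BN-pair `(B ∩ L_I, N ∩ L_I, I)` of the Levi subgroup `L_I`. -/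
def levi (I : Finset ι) : BNData (D.L (I : Set ι)) {i // i ∈ I} where
  B := D.B.subgroupOf (D.L I)
  N := D.N.subgroupOf (D.L I)
  s i := ⟨D.s i.1, D.s_mem_L i.2⟩

/-- `D` is a split BN-pair of characteristic `p` of `G`, with `B = U ⋊ T`. -/
structure IsSplit (p : ℕ) (U : Subgroup G) : Prop where
  /-- `G` is generated by `B` and `N`. -/
  generates : D.B ⊔ D.N = ⊤
  /-- `T` is normal in `N`. -/
  normal_T : ∀ n ∈ D.N, ∀ t ∈ D.T, n * t * n⁻¹ ∈ D.T
  /-- The elements of `S` lie in `N/T`. -/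
  s_mem : ∀ i, D.s i ∈ D.N
  /-- Different indices give different elements of `S`. -/
  s_injective : ∀ i j, (D.s i)⁻¹ * D.s j ∈ D.T → i = j
  /-- The elements of `S` are involutions (nontrivial by `s_conj`). -/
  s_sq : ∀ i, D.s i * D.s i ∈ D.T
  /-- `S` generates `N/T`. -/
  s_generates : D.NI Set.univ = D.N
  /-- `s B w ⊆ B w B ∪ B s w B`. -/
  s_mul : ∀ i, ∀ n ∈ D.N, ∀ b ∈ D.B, ∃ b₁ ∈ D.B, ∃ b₂ ∈ D.B,
    D.s i * b * n = b₁ * n * b₂ ∨ D.s i * b * n = b₁ * (D.s i * n) * b₂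
  /-- `s B s⁻¹ ≠ B`. -/
  s_conj : ∀ i, ∃ b ∈ D.B, D.s i * b * (D.s i)⁻¹ ∉ D.B
  /-- `U` is a normal subgroup of `B`. -/
  U_le : U ≤ D.B
  U_normal : ∀ b ∈ D.B, ∀ x ∈ U, b * x * b⁻¹ ∈ U
  /-- `B` is the semidirect product of `U` and `T`. -/
  U_sup_T : U ⊔ D.T = D.B
  U_inf_T : U ⊓ D.T = ⊥
  /-- `U` is a `p`-group and `T` is a `p'`-group. -/
  U_pgroup : IsPGroup p U
  T_coprime : (Nat.card D.T).Coprime p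
  /-- The intersection of the conjugates of `B` under `N` is `T`. -/
  saturated : ∀ g, (∀ n ∈ D.N, n * g * n⁻¹ ∈ D.B) → g ∈ D.T
  /-- `U_I = U ∩ w_I⁻¹ U w_I` is normal in `U` for all `I ⊆ S`. -/
  U_I_normal : ∀ (I : Set ι) (n : G), D.IsLongest I n →
    ∀ x ∈ U, n * x * n⁻¹ ∈ U → ∀ u ∈ U, n * (u * x * u⁻¹) * n⁻¹ ∈ U

end BNData

end BN

/-! ### The complex `St(G)` -/

section Steinberg

universe u w

variable {G : Type u} [Group G]

/-- The map `ℤ[G/H] ⟶ ℤ[G/K]`, `gH ↦ gK`, for subgroups `H ≤ K`. -/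
def cosetMap {H K : Subgroup G} (h : H ≤ K) :
    Rep.ofMulAction ℤ G (G ⧸ H) ⟶ Rep.ofMulAction ℤ G (G ⧸ K) :=
  Rep.ofHom ⟨MonoidAlgebra.mapDomainLinearMap ℤ ℤ (Subgroup.quotientMapOfLE h), fun g => by
    ext x
    induction x using QuotientGroup.induction_on with
    | H x => simp⟩

lemma cosetMap_single {H K : Subgroup G} (h : H ≤ K) (g : G) :
    (cosetMap h).hom (MonoidAlgebra.single (g : G ⧸ H) (1 : ℤ)) =
      MonoidAlgebra.single (g : G ⧸ K) (1 : ℤ) := by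
  simp [cosetMap]

instance rep_hasFiniteBiproducts : HasFiniteBiproducts (Rep.{u} ℤ G) :=
  Abelian.hasFiniteBiproducts

namespace BNData

variable {ι : Type w} (D : BNData G ι)

/-- The coefficient system `I ↦ ℤ[G/P_I]` with maps `g P_I ↦ g P_J` for `I ⊆ J`. -/
def StSystem : CoeffSystem ι (Rep.{u} ℤ G) where
  obj I := Rep.ofMulAction ℤ G (G ⧸ D.P (I : Set ι))
  map f := cosetMap (D.P_mono (Finset.coe_subset.2 (leOfHom f)))
  map_id I := by
    ext x
    induction x using QuotientGroup.induction_on with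
    | H x => simp [cosetMap]
  map_comp f g := by
    ext x
    induction x using QuotientGroup.induction_on with
    | H x => simp [cosetMap]

variable [Fintype ι] [LinearOrder ι]

/-- The complex `St(G)` of `ℤG`-modules, with `⊕_{|I| = i} ℤ[G/P_I]` in degree `i`. -/
def St : CochainComplex (Rep.{u} ℤ G) ℤ := D.StSystem.complex

/-- `Res^G_{P_I} St(G)` as an object of `K^b(ℤP_I)`. -/
def resSt (I : Finset ι) : Kb (Rep.{u} ℤ (D.P (I : Set ι))) :=
  Kb.of (((Rep.resFunctor (D.P (I : Set ι)).subtype).mapHomologicalComplex _).obj D.St)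
    (D.StSystem.isBounded_complex.map _)

/-- `Ind^{P_I}_{L_I} St(L_I)` as an object of `K^b(ℤP_I)`. -/
def indSt (I : Finset ι) : Kb (Rep.{u} ℤ (D.P (I : Set ι))) :=
  Kb.of (((Rep.indFunctor ℤ (Subgroup.inclusion (D.L_le_P (I : Set ι)))).mapHomologicalComplex
      _).obj (D.levi I).St)
    ((D.levi I).StSystem.isBounded_complex.map _)

end BNData

end Steinberg

end

/-! Let W = N/T, let δ : G → W be the map with g ∈ B δ(g) B, and put d = w_I w_S, the longest of the
shortest representatives of the cosets W_I w. Number these cosets by a function f on W that respects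
the lengths of shortest representatives (`IsRank`), and let the rank of gP_J be the least value of f
∘ δ on it. The rank is invariant under P_I and does not increase along gP_J ↦ gP_K, so it filters
Res St(G) by subcomplexes of permutation modules (`RankedSystem.layer`).

Every piece below the top rank f(d) is contractible. If y ≠ d is a shortest representative, there is
an ascent y s_i > y with y s_i not of the form s_j y, j ∈ I (`exists_ascent`). A coset of rank f(y)
can be moved by P_I to some gP_J with δ(g) = y, and then the rank is f(y) exactly when y s_j > y for
all j ∈ J. Hence adding i to J induces bijections on the cosets of rank f(y) (`rank_map`,
`rank_map_injective`, `exists_of_rank_map`), and inverting them gives a contracting homotopy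
(`d_contract`). The filtration splits in each degree, so contractible pieces can be divided out in
the homotopy category (`isIso_quotient_map_of_isZero`). Only the top layer is left.

Conjugation by d turns the generators in I into generators: s_i d = d s_{e(i)} (`gen_mul_longest`).
Cosets of P_K of top rank exist only for K = e(J). They form a single P_I-orbit, with stabilizer P_I
∩ d P_{e(J)} d⁻¹ equal to the standard parabolic subgroup of L_I of type J
(`conj_mem_P_of_mem_levi_P`, `mem_levi_P_of_conj_mem_P`). So the top layer is induced from St(L_I),
up to the signs caused by e not preserving the order (`reindexSign`).

The combinatorics of W rests on the folding property `IsFolding`, which is read off from the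
multiplication of Bruhat cells (`weylGen_isFolding`) and implies the exchange condition. For I = ∅
the Levi complex lives in degree 0 only, which gives the Solomon–Tits theorem. -/

noncomputable section

/-! ### Word length in a group generated by involutions with the folding property -/

section WordLength

variable {W ι : Type*} [Group W]

/-- The product of the word `l` in the generators `s`. -/
def wordProd (s : ι → W) (l : List ι) : W := (l.map s).prod

@[simp] lemma wordProd_nil (s : ι → W) : wordProd s [] = 1 := rfl

@[simp] lemma wordProd_cons (s : ι → W) (i : ι) (l : List ι) :
    wordProd s (i :: l) = s i * wordProd s l := by simp [wordProd]

@[simp] lemma wordProd_append (s : ι → W) (l l' : List ι) :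
    wordProd s (l ++ l') = wordProd s l * wordProd s l' := by simp [wordProd]

/-- The least length of a word in the generators `s` that represents `w`. -/
def wordLength (s : ι → W) (w : W) : ℕ := sInf {k | ∃ l : List ι, l.length = k ∧ wordProd s l = w}

/-- The subgroup generated by the generators with index in `J`. -/
abbrev genBy (s : ι → W) (J : Set ι) : Subgroup W := Subgroup.closure (s '' J)

lemma wordLength_prod_le (s : ι → W) (l : List ι) : wordLength s (wordProd s l) ≤ l.length :=
  Nat.sInf_le ⟨l, rfl, rfl⟩

lemma wordLength_one (s : ι → W) : wordLength s 1 = 0 := Nat.le_zero.1 (wordLength_prod_le s [])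

lemma wordLength_gen_le (s : ι → W) (i : ι) : wordLength s (s i) ≤ 1 := by
  simpa using wordLength_prod_le s [i]

lemma gen_mem_genBy (s : ι → W) {J : Set ι} {j : ι} (hj : j ∈ J) : s j ∈ genBy s J :=
  Subgroup.subset_closure ⟨j, hj, rfl⟩

lemma genBy_mono (s : ι → W) {J K : Set ι} (h : J ⊆ K) : genBy s J ≤ genBy s K :=
  Subgroup.closure_mono (Set.image_mono h)

/-- `y` is the shortest element of `genBy s I * y`. -/
def IsLeftMin (s : ι → W) (I : Set ι) (y : W) : Prop :=
  ∀ i ∈ I, wordLength s y < wordLength s (s i * y)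

lemma wordProd_mem (s : ι → W) {J : Set ι} {l : List ι} (h : ∀ j ∈ l, j ∈ J) :
    wordProd s l ∈ genBy s J := by
  refine Subgroup.list_prod_mem _ fun x hx => ?_
  obtain ⟨j, hj, rfl⟩ := List.mem_map.1 hx
  exact Subgroup.subset_closure ⟨j, h j hj, rfl⟩

/-- `W` is generated by the involutions `s`. -/
structure IsInvolutive (s : ι → W) : Prop where
  sq : ∀ i, s i * s i = 1
  gen : ∀ w, ∃ l : List ι, wordProd s l = w

/-- The involutions `s` generate `W`, the length changes under multiplication by a generator,
and `s v t` is shorter than `v t` only if `s v = v t`, when `s v` and `v t` are longer than `v`. -/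
structure IsFolding (s : ι → W) : Prop extends IsInvolutive s where
  ne : ∀ i w, wordLength s (s i * w) ≠ wordLength s w
  fold : ∀ i j v, wordLength s v < wordLength s (s i * v) → wordLength s v < wordLength s (v * s j) →
    wordLength s (s i * (v * s j)) ≤ wordLength s (v * s j) → s i * v = v * s j

namespace IsInvolutive

variable {s : ι → W} (hs : IsInvolutive s)

local notation "ℓ" => wordLength s
local notation "π" => wordProd s

include hs

lemma exists_word (w : W) : ∃ l : List ι, l.length = ℓ w ∧ π l = w := by
  obtain ⟨l, hl⟩ := hs.gen w
  exact Nat.sInf_mem (s := {k | ∃ l : List ι, l.length = k ∧ π l = w}) ⟨_, l, rfl, hl⟩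

lemma eq_one_of_len {w : W} (h : ℓ w = 0) : w = 1 := by
  obtain ⟨l, hl, rfl⟩ := hs.exists_word w
  rw [h, List.length_eq_zero_iff] at hl
  simp [hl]

lemma len_mul_le (v w : W) : ℓ (v * w) ≤ ℓ v + ℓ w := by
  obtain ⟨a, ha, ea⟩ := hs.exists_word v
  obtain ⟨b, hb, eb⟩ := hs.exists_word w
  have := wordLength_prod_le s (a ++ b)
  rw [wordProd_append, List.length_append] at this
  rwa [← ha, ← hb, ← ea, ← eb]

lemma inv_gen (i : ι) : (s i)⁻¹ = s i := inv_eq_of_mul_eq_one_left (hs.sq i)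

lemma prod_reverse (l : List ι) : π l.reverse = (π l)⁻¹ := by
  induction l with
  | nil => simp
  | cons a l ih => simp [ih, hs.inv_gen]

lemma len_inv_le (w : W) : ℓ w⁻¹ ≤ ℓ w := by
  obtain ⟨l, hl, rfl⟩ := hs.exists_word w
  rw [← hs.prod_reverse, ← hl]
  exact (wordLength_prod_le s _).trans_eq (by simp)

@[simp] lemma len_inv (w : W) : ℓ w⁻¹ = ℓ w :=
  (hs.len_inv_le w).antisymm (by simpa using hs.len_inv_le w⁻¹)

lemma gen_mul_gen_mul (i : ι) (w : W) : s i * (s i * w) = w := by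
  rw [← mul_assoc, hs.sq, one_mul]

lemma mul_gen_mul_gen (i : ι) (w : W) : w * s i * s i = w := by
  rw [mul_assoc, hs.sq, mul_one]

end IsInvolutive

namespace IsFolding

variable {s : ι → W} (hs : IsFolding s)

local notation "ℓ" => wordLength s
local notation "π" => wordProd s

include hs

lemma len_gen_mul (i : ι) (w : W) : ℓ (s i * w) = ℓ w + 1 ∨ ℓ (s i * w) + 1 = ℓ w := by
  have h1 := hs.len_mul_le (s i) w
  have h2 := hs.len_mul_le (s i) (s i * w)
  rw [hs.gen_mul_gen_mul] at h2
  have h3 := wordLength_gen_le s i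
  have h4 := hs.ne i w
  omega

lemma len_mul_gen (w : W) (i : ι) : ℓ (w * s i) = ℓ w + 1 ∨ ℓ (w * s i) + 1 = ℓ w := by
  have := hs.len_gen_mul i w⁻¹
  rwa [← hs.len_inv, mul_inv_rev, inv_inv, hs.inv_gen, hs.len_inv] at this

lemma len_gen (i : ι) : ℓ (s i) = 1 := by
  have := hs.len_gen_mul i 1
  rw [mul_one, wordLength_one s] at this
  omega

/-- The exchange condition for a product `x * π l` of additive length. -/
lemma exchange (l : List ι) : ∀ (x : W) (i : ι), ℓ (x * π l) = ℓ x + l.length → ℓ x < ℓ (s i * x) →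
    ℓ (s i * (x * π l)) < ℓ (x * π l) →
    ∃ l', l'.Sublist l ∧ l'.length + 1 = l.length ∧ s i * (x * π l) = x * π l' := by
  induction l with
  | nil =>
    intro x i _ h1 h2
    simp only [wordProd_nil, mul_one] at h2
    omega
  | cons t l ih =>
    intro x i h h1 h2
    have e : x * π (t :: l) = (x * s t) * π l := by simp [mul_assoc]
    rw [e] at h h2 ⊢
    rw [List.length_cons] at h
    have h3 := hs.len_mul_le (x * s t) (π l)
    have h4 := wordLength_prod_le s l
    have h5 := hs.len_mul_gen x t
    have h6 : ℓ (x * s t) = ℓ x + 1 := by omega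
    -- Either t can be absorbed into x and the deleted letter comes later, or folding gives s_i x =
    -- x s_t and t itself is the deleted letter.
    by_cases h7 : ℓ (x * s t) < ℓ (s i * (x * s t))
    · obtain ⟨l', hl, hl', h'⟩ := ih (x * s t) i (by omega) h7 h2
      exact ⟨t :: l', hl.cons_cons t, by simp [hl'], by rw [h']; simp [mul_assoc]⟩
    · have := hs.fold i t x h1 (by omega) (by omega)
      refine ⟨l, List.sublist_cons_self _ _, rfl, ?_⟩
      rw [← mul_assoc, ← mul_assoc, this, hs.mul_gen_mul_gen]

/-- The exchange condition on the right. -/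
lemma exchange_right (l : List ι) (x : W) (i : ι) (h : ℓ (π l * x) = l.length + ℓ x)
    (h1 : ℓ x < ℓ (x * s i)) (h2 : ℓ (π l * x * s i) < ℓ (π l * x)) :
    ∃ l', l'.Sublist l ∧ l'.length + 1 = l.length ∧ π l * x * s i = π l' * x := by
  obtain ⟨l', hl, hl', h'⟩ := hs.exchange l.reverse x⁻¹ i
    (by rw [hs.prod_reverse, ← mul_inv_rev, hs.len_inv, hs.len_inv, h, List.length_reverse, add_comm])
    (by rw [← hs.inv_gen i, ← mul_inv_rev, hs.len_inv, hs.len_inv]; exact h1)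
    (by rw [hs.prod_reverse, ← hs.inv_gen i, ← mul_inv_rev, ← mul_inv_rev, hs.len_inv, hs.len_inv]
        exact h2)
  refine ⟨l'.reverse, by simpa using hl.reverse, by simpa using hl', ?_⟩
  have h3 := congrArg (·⁻¹) h'
  simpa [hs.prod_reverse, hs.inv_gen, mul_assoc] using h3

/-- Multiply by one generator of J at a time. If the length drops, the exchange condition only
deletes a letter, so the reduced word stays in the alphabet J. -/
lemma exists_word_genBy {J : Set ι} {w : W} (hw : w ∈ genBy s J) :
    ∃ l : List ι, (∀ j ∈ l, j ∈ J) ∧ l.length = ℓ w ∧ π l = w := by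
  have key : ∀ (i : ι) (_ : i ∈ J) (w : W),
      (∃ l : List ι, (∀ j ∈ l, j ∈ J) ∧ l.length = ℓ w ∧ π l = w) →
      ∃ l : List ι, (∀ j ∈ l, j ∈ J) ∧ l.length = ℓ (s i * w) ∧ π l = s i * w := by
    rintro i hi w ⟨l, hl, hl', rfl⟩
    rcases hs.len_gen_mul i (π l) with h | h
    · refine ⟨i :: l, ?_, by simp [hl', h], by simp⟩
      simpa [hi] using hl
    · have h1 := hs.len_gen i
      obtain ⟨l', h2, h3, h4⟩ := hs.exchange l 1 i (by rw [one_mul, wordLength_one s, ← hl', zero_add])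
        (by rw [wordLength_one s, mul_one]; omega) (by rw [one_mul]; omega)
      rw [one_mul, one_mul] at h4
      exact ⟨l', fun j hj => hl j (h2.subset hj), by omega, h4.symm⟩
  induction hw using Subgroup.closure_induction_left with
  | one => exact ⟨[], by simp [wordLength_one s]⟩
  | mul_left x hx y _ ih =>
    obtain ⟨i, hi, rfl⟩ := hx
    exact key i hi y ih
  | inv_mul_cancel x hx y _ ih =>
    obtain ⟨i, hi, rfl⟩ := hx
    rw [hs.inv_gen]
    exact key i hi y ih

lemma mem_of_gen_mem_genBy {J : Set ι} (hinj : Function.Injective s) {i : ι}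
    (h : s i ∈ genBy s J) : i ∈ J := by
  obtain ⟨l, hl, h1, h2⟩ := hs.exists_word_genBy h
  rw [hs.len_gen, List.length_eq_one_iff] at h1
  obtain ⟨j, rfl⟩ := h1
  rw [wordProd_cons, wordProd_nil, mul_one] at h2
  rw [← hinj h2]
  exact hl j (by simp)

/-- Induction on an element of `genBy s J`, adding generators on the right of reduced words. -/
lemma genBy_induction {J : Set ι} {p : W → Prop} (one : p 1)
    (mul : ∀ v ∈ genBy s J, ∀ j ∈ J, ℓ v < ℓ (v * s j) → p v → p (v * s j)) {w : W}
    (hw : w ∈ genBy s J) : p w := by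
  obtain ⟨l, hl, h1, rfl⟩ := hs.exists_word_genBy hw
  clear hw
  induction l using List.reverseRecOn with
  | nil => exact one
  | append_singleton l j ih =>
    simp only [wordProd_append, wordProd_cons, wordProd_nil, mul_one, List.length_append,
      List.length_cons, List.length_nil, zero_add, List.mem_append, List.mem_singleton] at *
    have h2 := wordLength_prod_le s l
    have h3 := hs.len_mul_gen (π l) j
    have h4 : ∀ j ∈ l, j ∈ J := fun j hj => hl j (Or.inl hj)
    exact mul _ (wordProd_mem s h4) j (hl j (Or.inr rfl)) (by omega) (ih h4 (by omega))

lemma genBy_univ : genBy s Set.univ = ⊤ := by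
  refine eq_top_iff.2 fun w _ => ?_
  obtain ⟨l, rfl⟩ := hs.gen w
  exact wordProd_mem s (by simp)

/-- If v s_j > v but x v s_j < x v, the exchange condition deletes a letter of x, and x · v s_j v⁻¹
is a shorter element of x W_J. -/
lemma len_mul_of_forall_le {J : Set ι} {x : W} (hx : ∀ v ∈ genBy s J, ℓ x ≤ ℓ (x * v)) {v : W}
    (hv : v ∈ genBy s J) : ℓ (x * v) = ℓ x + ℓ v := by
  refine hs.genBy_induction (p := fun v => ℓ (x * v) = ℓ x + ℓ v) (by simp [wordLength_one s]) ?_ hv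
  intro v hv j hj h1 h2
  rw [← mul_assoc]
  rcases hs.len_mul_gen (x * v) j with h3 | h3
  · have := hs.len_mul_gen v j
    omega
  · obtain ⟨l, hl, rfl⟩ := hs.exists_word x
    obtain ⟨l', h4, h5, h6⟩ := hs.exchange_right l v j (by omega) h1 (by omega)
    have h7 := hx (v * s j * v⁻¹) (mul_mem (mul_mem hv (gen_mem_genBy s hj)) (inv_mem hv))
    rw [← mul_assoc, ← mul_assoc, h6, mul_inv_cancel_right] at h7
    have := wordLength_prod_le s l'
    omega

omit hs in
lemma exists_min_mul (J : Set ι) (x : W) :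
    ∃ v ∈ genBy s J, ∀ u ∈ genBy s J, ℓ (x * v) ≤ ℓ (x * v * u) := by
  obtain ⟨v, hv, h⟩ := WellFounded.has_min (measure fun v => ℓ (x * v)).wf
    {v | v ∈ genBy s J} ⟨1, one_mem (genBy s J)⟩
  exact ⟨v, hv, fun u hu => by rw [mul_assoc]; exact not_lt.1 (h (v * u) (mul_mem hv hu))⟩

/-- An element without right descents in `J` is additive with respect to `genBy s J`. -/
lemma len_mul_of_right {J : Set ι} {x : W} (hx : ∀ j ∈ J, ℓ x < ℓ (x * s j)) {v : W}
    (hv : v ∈ genBy s J) : ℓ (x * v) = ℓ x + ℓ v := by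
  obtain ⟨u, hu, hm⟩ := exists_min_mul (s := s) J x
  have key := fun v hv => hs.len_mul_of_forall_le hm (v := v) hv
  suffices u = 1 by
    subst this
    simpa using key v hv
  -- Here x = (xu)u⁻¹ with additive lengths. If u ≠ 1, the last letter j of a reduced word of u⁻¹
  -- satisfies x s_j < x, against the hypothesis.
  by_contra h1
  obtain ⟨l, hl, h2, h3⟩ := hs.exists_word_genBy (inv_mem hu)
  rcases List.eq_nil_or_concat' l with rfl | ⟨l, j, rfl⟩
  · exact h1 (by simpa using h3.symm)
  · have h4 := key u⁻¹ (inv_mem hu)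
    rw [mul_inv_cancel_right, ← h2] at h4
    have h5 : ∀ j ∈ l, j ∈ J := fun j hj => hl j (by simp [hj])
    have h6 := key (π l) (wordProd_mem s h5)
    have h7 : x * u * π l = x * s j := by
      rw [← hs.mul_gen_mul_gen j (π l)]
      simp only [wordProd_append, wordProd_cons, wordProd_nil, mul_one] at h3
      rw [h3]; group
    rw [h7] at h6
    have := hx j (hl j (by simp))
    have := wordLength_prod_le s l
    simp at h4
    omega

lemma len_mul_of_left {J : Set ι} {x : W} (hx : ∀ j ∈ J, ℓ x < ℓ (s j * x)) {v : W}
    (hv : v ∈ genBy s J) : ℓ (v * x) = ℓ v + ℓ x := by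
  have := hs.len_mul_of_right (J := J) (x := x⁻¹) (v := v⁻¹) (fun j hj => by
    rw [← hs.inv_gen, ← mul_inv_rev, hs.len_inv, hs.len_inv]; exact hx j hj) (inv_mem hv)
  rw [← mul_inv_rev, hs.len_inv, hs.len_inv, hs.len_inv] at this
  omega

lemma exists_isLeftMin (I : Set ι) (x : W) : ∃ u ∈ genBy s I, IsLeftMin s I (u * x) := by
  obtain ⟨v, hv, h⟩ := exists_min_mul (s := s) I x⁻¹
  refine ⟨v⁻¹, inv_mem hv, fun i hi => ?_⟩
  have h1 := h (s i) (gen_mem_genBy s hi)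
  rw [← hs.len_inv, ← hs.len_inv (x⁻¹ * v * s i)] at h1
  simp only [mul_inv_rev, inv_inv, hs.inv_gen] at h1
  exact h1.lt_of_ne' (hs.ne _ _)

/-- Both y and uy have additive length with W_I, so ℓ(u) is added when passing in either direction
and must be 0. -/
lemma isLeftMin_unique {I : Set ι} {y u : W} (hy : IsLeftMin s I y) (hu : u ∈ genBy s I)
    (h : IsLeftMin s I (u * y)) : u = 1 := by
  have h1 := hs.len_mul_of_left hy hu
  have h2 := hs.len_mul_of_left h (inv_mem hu)
  rw [inv_mul_cancel_left, hs.len_inv] at h2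
  exact hs.eq_one_of_len (by omega)

/-- Deodhar's lemma. -/
lemma isLeftMin_mul_gen {I : Set ι} {y : W} (hy : IsLeftMin s I y) (j : ι) :
    IsLeftMin s I (y * s j) ∨ ∃ i ∈ I, s i * y = y * s j := by
  by_contra! h
  obtain ⟨h1, h2⟩ := h
  simp only [IsLeftMin, not_forall, not_lt] at h1
  obtain ⟨i, hi, h1⟩ := h1
  have h3 := hy i hi
  refine h2 i hi (hs.fold i j y h3 ?_ h1)
  rcases hs.len_mul_gen y j with h4 | h4
  · omega
  · have h5 := hs.len_gen_mul i (y * s j)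
    have h6 := hs.len_mul_gen (s i * y) j
    have h7 := hs.len_gen_mul i y
    rw [mul_assoc] at h6
    omega

/-- If `d` is shortest in `genBy s I * d * genBy s K`, then the elements of `d * genBy s K` not in
`genBy s I * d` lie in cosets of `genBy s I` with a longer shortest element, and those in
`genBy s I * d` come from the generators normalised into `I`. -/
lemma mul_genBy_cases {I K : Set ι} {d : W} (hd : IsLeftMin s I d) (hK : ∀ k ∈ K, ℓ d < ℓ (d * s k))
    {v : W} (hv : v ∈ genBy s K) :
    ∃ u ∈ genBy s I, ∃ y, IsLeftMin s I y ∧ d * v = u * y ∧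
      ((y = d ∧ v ∈ genBy s {k | k ∈ K ∧ ∃ i ∈ I, s i * d = d * s k}) ∨ ℓ d < ℓ y) := by
  refine hs.genBy_induction (p := fun v => ∃ u ∈ genBy s I, ∃ y, IsLeftMin s I y ∧ d * v = u * y ∧
      ((y = d ∧ v ∈ genBy s {k | k ∈ K ∧ ∃ i ∈ I, s i * d = d * s k}) ∨ ℓ d < ℓ y)) ?_ ?_ hv
  · exact ⟨1, one_mem _, d, hd, by simp, Or.inl ⟨rfl, one_mem _⟩⟩
  · rintro v hv j hj hlt ⟨u, hu, y, hy, h1, h2⟩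
    have h3 : d * (v * s j) = u * (y * s j) := by rw [← mul_assoc, h1, mul_assoc]
    -- By Deodhar's lemma s_j either crosses y into W_I, leaving y unchanged, or gives a new minimal
    -- element. In the second case the lengths of d v and d v s_j are additive in both
    -- factorisations, so ℓ(y s_j) > ℓ(y) ≥ ℓ(d).
    rcases hs.isLeftMin_mul_gen hy j with h4 | ⟨i, hi, h4⟩
    · refine ⟨u, hu, y * s j, h4, h3, Or.inr ?_⟩
      have h5 := hs.len_mul_of_right hK hv
      have h6 := hs.len_mul_of_right hK (mul_mem hv (gen_mem_genBy s hj))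
      rw [h1, hs.len_mul_of_left hy hu] at h5
      rw [h3, hs.len_mul_of_left h4 hu] at h6
      rcases h2 with ⟨rfl, -⟩ | h2 <;> omega
    · refine ⟨u * s i, mul_mem hu (gen_mem_genBy s hi), y, hy, by rw [h3, ← h4, mul_assoc], ?_⟩
      refine h2.imp_left ?_
      rintro ⟨rfl, h5⟩
      exact ⟨rfl, mul_mem h5 (gen_mem_genBy s ⟨hj, i, hi, h4⟩)⟩

/-- If every generator in `J` is a right descent of `w`, then `w` ends with every element of
`genBy s J`. -/
lemma len_mul_of_descents {J : Set ι} {w : W} (hw : ∀ j ∈ J, ℓ (w * s j) < ℓ w) {v : W}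
    (hv : v ∈ genBy s J) : ℓ (w * v) + ℓ v = ℓ w := by
  suffices h : ∀ v ∈ genBy s J, ℓ (w * v⁻¹) + ℓ v = ℓ w by
    simpa [hs.len_inv] using h v⁻¹ (inv_mem hv)
  intro v hv
  refine hs.genBy_induction (p := fun v => ℓ (w * v⁻¹) + ℓ v = ℓ w) (by simp [wordLength_one s]) ?_ hv
  intro v hv j hj h1 h2
  obtain ⟨l, hl, h3⟩ := hs.exists_word (w * v⁻¹)
  have h4 : π l * v = w := by rw [h3, inv_mul_cancel_right]
  -- Since v s_j > v, the letter that disappears from w s_j belongs to w v⁻¹ and not to v.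
  obtain ⟨l', h5, h6, h7⟩ := hs.exchange_right l v j (by rw [h4]; omega) h1 (by rw [h4]; exact hw j hj)
  have h8 : w * (v * s j)⁻¹ = π l' := by
    rw [mul_inv_rev, hs.inv_gen, ← mul_assoc, ← h4, h7, mul_inv_cancel_right]
  have h9 := wordLength_prod_le s l'
  have h10 := hs.len_mul_gen v j
  have h11 := hs.len_mul_le (w * (v * s j)⁻¹) (v * s j)
  rw [inv_mul_cancel_right] at h11
  rw [h8] at h11 ⊢
  omega

end IsFolding
end WordLength

/-! ### Longest elements and the numbering of the cosets of W_I -/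

section WordLength

variable {W ι : Type*} [Group W]

/-- `w` is an element of maximal length of `genBy s J`. -/
def IsLongestIn (s : ι → W) (J : Set ι) (w : W) : Prop :=
  w ∈ genBy s J ∧ ∀ v ∈ genBy s J, wordLength s v ≤ wordLength s w

lemma exists_isLongestIn [Finite W] (s : ι → W) (J : Set ι) : ∃ w, IsLongestIn s J w := by
  obtain ⟨w, hw, h⟩ := Set.exists_max_image {w | w ∈ genBy s J} (wordLength s) (Set.toFinite _)
    ⟨1, one_mem (genBy s J)⟩
  exact ⟨w, hw, h⟩

/-- `f` numbers the cosets of `genBy s I` injectively, and it refines the order by the length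
of the shortest element. -/
structure IsRank (s : ι → W) (I : Set ι) (f : W → ℕ) : Prop where
  mul : ∀ u ∈ genBy s I, ∀ w, f (u * w) = f w
  lt : ∀ y z, IsLeftMin s I y → IsLeftMin s I z → wordLength s y < wordLength s z → f y < f z
  eq : ∀ v w, f v = f w → ∃ u ∈ genBy s I, w = u * v

namespace IsFolding

variable {s : ι → W} (hs : IsFolding s)

local notation "ℓ" => wordLength s
local notation "π" => wordProd s

include hs

lemma longest_inv {J : Set ι} {w : W} (hw : IsLongestIn s J w) : IsLongestIn s J w⁻¹ :=
  ⟨inv_mem hw.1, by simpa [hs.len_inv] using hw.2⟩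

lemma longest_mul {J : Set ι} {w : W} (hw : IsLongestIn s J w) {v : W} (hv : v ∈ genBy s J) :
    ℓ (w * v) + ℓ v = ℓ w := by
  refine hs.len_mul_of_descents (fun j hj => ?_) hv
  have h1 := hw.2 _ (mul_mem hw.1 (gen_mem_genBy s hj))
  have h2 := hs.len_mul_gen w j
  omega

lemma mul_longest {J : Set ι} {w : W} (hw : IsLongestIn s J w) {v : W} (hv : v ∈ genBy s J) :
    ℓ (v * w) + ℓ v = ℓ w := by
  have := hs.longest_mul (hs.longest_inv hw) (inv_mem hv)
  rwa [← mul_inv_rev, hs.len_inv, hs.len_inv, hs.len_inv] at this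

lemma longest_sq {J : Set ι} {w : W} (hw : IsLongestIn s J w) : w * w = 1 :=
  hs.eq_one_of_len (by have := hs.longest_mul hw hw.1; omega)

lemma eq_gen_of_len {w : W} (h : ℓ w = 1) : ∃ i, w = s i := by
  obtain ⟨l, hl, rfl⟩ := hs.exists_word w
  rw [h, List.length_eq_one_iff] at hl
  obtain ⟨i, rfl⟩ := hl
  exact ⟨i, by simp⟩

section Coset

variable {I : Set ι} {a b : W} (ha : IsLongestIn s I a) (hb : IsLongestIn s Set.univ b)

include ha hb

/-- Multiplication by w_S complements lengths in W, and multiplication by w_I complements them in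
W_I. The two reversals cancel. -/
lemma len_mul_longest {u : W} (hu : u ∈ genBy s I) : ℓ (u * (a * b)) = ℓ u + ℓ (a * b) := by
  have h1 := fun v => hs.mul_longest hb (v := v) (by simp [hs.genBy_univ])
  have h2 := h1 (u * a)
  have h3 := h1 a
  have h4 := hs.mul_longest ha hu
  rw [mul_assoc] at h2
  omega

lemma isLeftMin_longest : IsLeftMin s I (a * b) := fun i hi => by
  rw [hs.len_mul_longest ha hb (gen_mem_genBy s hi), hs.len_gen]
  omega

/-- Conjugation by w_I preserves length on W_I, and conjugation by w_S preserves it on W. So the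
conjugate of s_i by w_I w_S has length 1 and is a generator. -/
lemma gen_mul_longest {i : ι} (hi : i ∈ I) : ∃ k, s i * (a * b) = a * b * s k := by
  have h1 := hs.longest_mul ha (mul_mem (gen_mem_genBy s hi) ha.1)
  have h2 := hs.mul_longest ha (gen_mem_genBy s hi)
  have h3 := hs.longest_mul hb (v := a * (s i * a) * b) (by simp [hs.genBy_univ])
  have h4 := hs.mul_longest hb (v := a * (s i * a)) (by simp [hs.genBy_univ])
  have h5 := hs.len_gen i
  obtain ⟨k, hk⟩ := hs.eq_gen_of_len (w := b * (a * (s i * a) * b)) (by omega)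
  refine ⟨k, ?_⟩
  have h6 := hs.longest_sq ha
  have h7 := hs.longest_sq hb
  calc s i * (a * b) = a * a * (s i * (a * b)) := by rw [h6, one_mul]
    _ = a * (b * b) * (a * (s i * (a * b))) := by rw [h7, mul_one]; group
    _ = _ := by rw [← hk]; group

lemma len_le_longest {y : W} (hy : IsLeftMin s I y) : ℓ y ≤ ℓ (a * b) := by
  have h1 := hs.len_mul_of_left hy ha.1
  have h2 := hs.mul_longest hb (v := a) (by simp [hs.genBy_univ])
  have h3 := hb.2 (a * y) (by simp [hs.genBy_univ])
  omega

/-- If every ascent y s_k had the form s_i y with i ∈ I, then w_I y would have every generator as a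
right descent, hence be w_S, and y = w_I w_S. The generator k found here is the direction in which
the layer of y is contracted. -/
lemma exists_ascent {y : W} (hy : IsLeftMin s I y) (hne : y ≠ a * b) :
    ∃ k, ℓ y < ℓ (y * s k) ∧ ∀ i ∈ I, s i * y ≠ y * s k := by
  by_contra! h
  have h1 : ∀ k ∈ Set.univ, ℓ (a * y * s k) < ℓ (a * y) := by
    intro k _
    rw [hs.len_mul_of_left hy ha.1, mul_assoc]
    rcases hs.len_mul_gen y k with hk | hk
    · obtain ⟨i, hi, e⟩ := h k (by omega)
      rw [← e, ← mul_assoc, hs.len_mul_of_left hy (mul_mem ha.1 (gen_mem_genBy s hi))]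
      have := hs.longest_mul ha (gen_mem_genBy s hi)
      have := hs.len_gen i
      omega
    · have := hs.len_mul_le a (y * s k)
      omega
  have h2 := hs.len_mul_of_descents h1 (v := b) (by simp [hs.genBy_univ])
  have h3 := hs.longest_mul hb (v := b⁻¹ * (a * y)) (by simp [hs.genBy_univ])
  rw [mul_inv_cancel_left] at h3
  have h4 := hs.eq_one_of_len (w := b⁻¹ * (a * y)) (by omega)
  rw [inv_mul_eq_one] at h4
  exact hne (by rw [h4, ← mul_assoc, hs.longest_sq ha, one_mul])

end Coset

lemma exists_isRank [Finite W] (I : Set ι) : ∃ f : W → ℕ, IsRank s I f := by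
  choose r hr hr' using hs.exists_isLeftMin I
  obtain ⟨n, ⟨e⟩⟩ := Finite.exists_equiv_fin W
  have hm : ∀ u ∈ genBy s I, ∀ w, r (u * w) * (u * w) = r w * w := by
    intro u hu w
    have h1 := hs.isLeftMin_unique (hr' w) (u := r (u * w) * u * (r w)⁻¹)
      (mul_mem (mul_mem (hr _) hu) (inv_mem (hr _))) (by
        have := hr' (u * w)
        rw [← mul_assoc] at this
        simpa [mul_assoc] using this)
    rw [← one_mul (r w * w), ← h1]
    group
  have hy : ∀ y, IsLeftMin s I y → r y * y = y := fun y h => by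
    rw [hs.isLeftMin_unique h (hr y) (hr' y), one_mul]
  -- Lexicographic order on the shortest representative r(w)w: length first, then an enumeration of
  -- W. As e takes values below n = |W|, the residue modulo n recovers the representative.
  refine ⟨fun w => ℓ (r w * w) * n + e (r w * w), fun u hu w => by simp only [hm u hu w], ?_, ?_⟩
  · intro y z h1 h2 h3
    simp only [hy y h1, hy z h2]
    have h4 := (e y).2
    have h5 : (ℓ y + 1) * n ≤ ℓ z * n := Nat.mul_le_mul_right n h3
    rw [add_mul] at h5
    omega
  · intro v w h
    have h1 := congrArg (· % n) h
    simp only [Nat.mul_add_mod_self_right, Nat.mod_eq_of_lt (e _).2] at h1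
    have h2 := e.injective (Fin.ext h1)
    refine ⟨(r w)⁻¹ * r v, mul_mem (inv_mem (hr w)) (hr v), ?_⟩
    rw [mul_assoc, h2, inv_mul_cancel_left]

end IsFolding

namespace IsRank

variable {s : ι → W} {I : Set ι} {f : W → ℕ} (hf : IsRank s I f) (hs : IsFolding s)

local notation "ℓ" => wordLength s

include hf hs

/-- By `mul_genBy_cases`, right multiplication by W_J either keeps y in its W_I-coset or leads to a
coset with a longer representative. -/
lemma le_mul {y : W} (hy : IsLeftMin s I y) {J : Set ι} (hJ : ∀ j ∈ J, ℓ y < ℓ (y * s j)) {v : W}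
    (hv : v ∈ genBy s J) : f y ≤ f (y * v) := by
  obtain ⟨u, hu, z, hz, h1, h2⟩ := hs.mul_genBy_cases hy hJ hv
  rw [h1, hf.mul u hu]
  rcases h2 with ⟨rfl, -⟩ | h2
  · exact le_rfl
  · exact (hf.lt _ _ hy hz h2).le

lemma lt_of_len_lt {y w : W} (hy : IsLeftMin s I y) (h : ℓ w < ℓ y) : f w < f y := by
  obtain ⟨u, hu, h1⟩ := hs.exists_isLeftMin I w
  rw [← hf.mul u hu w]
  refine hf.lt _ _ h1 hy (lt_of_le_of_lt ?_ h)
  have := hs.len_mul_of_left h1 (inv_mem hu)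
  rw [inv_mul_cancel_left] at this
  omega

lemma le_longest {a b : W} (ha : IsLongestIn s I a) (hb : IsLongestIn s Set.univ b) (w : W) :
    f w ≤ f (a * b) := by
  obtain ⟨u, hu, h1⟩ := hs.exists_isLeftMin I w
  rw [← hf.mul u hu w]
  rcases (hs.len_le_longest ha hb h1).lt_or_eq with h2 | h2
  · exact (hf.lt _ _ h1 (hs.isLeftMin_longest ha hb) h2).le
  · by_cases h3 : u * w = a * b
    · rw [h3]
    -- A minimal element z of the same length as w_I w_S satisfies ℓ(w_I z) = ℓ(w_S), so w_I z = w_S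
    -- by uniqueness of the longest element.
    · exfalso
      have h4 := hs.len_mul_of_left h1 ha.1
      have h5 := hs.mul_longest hb (v := a) (by simp [hs.genBy_univ])
      have h6 := hs.longest_mul hb (v := b⁻¹ * (a * (u * w))) (by simp [hs.genBy_univ])
      rw [mul_inv_cancel_left] at h6
      have h7 := hs.eq_one_of_len (w := b⁻¹ * (a * (u * w))) (by omega)
      rw [inv_mul_eq_one] at h7
      exact h3 (by rw [h7, ← mul_assoc, hs.longest_sq ha, one_mul])

end IsRank

end WordLength

/-! ### Bruhat cells and the folding property of the Weyl group -/

section Bruhat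

universe u w

namespace BNData

variable {G : Type u} [Group G] {ι : Type w} (D : BNData G ι)

/-- `W` is the Weyl group of `D`, with generators `s`, and `g` lies in the double coset
`B (δ g) B`. -/
structure IsBruhat {W : Type*} [Group W] (s : ι → W) (δ : G → W) : Prop extends IsFolding s where
  injective : Function.Injective s
  gen_mem : ∀ i, D.s i ∈ D.N
  eq_one_iff : ∀ g, δ g = 1 ↔ g ∈ D.B
  mul_left : ∀ b ∈ D.B, ∀ g, δ (b * g) = δ g
  mul_right : ∀ b ∈ D.B, ∀ g, δ (g * b) = δ g
  inv : ∀ g, δ g⁻¹ = (δ g)⁻¹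
  apply_s : ∀ i, δ (D.s i) = s i
  mul_N : ∀ n ∈ D.N, ∀ m ∈ D.N, δ (n * m) = δ n * δ m
  surj : ∀ w, ∃ n ∈ D.N, δ n = w
  exists_eq : ∀ g h, δ g = δ h → ∃ b ∈ D.B, ∃ b' ∈ D.B, g = b * h * b'
  gen_mul : ∀ i g h, δ g = s i → δ (g * h) = δ h ∨ δ (g * h) = s i * δ h
  gen_mul_of_le : ∀ i g h, δ g = s i → wordLength s (δ h) ≤ wordLength s (s i * δ h) →
    δ (g * h) = s i * δ h

/-- `g` lies in the double coset `B n B` for some `n ∈ N` with image `w`. -/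
def Cell {W : Type*} [Group W] (q : D.N →* W) (g : G) (w : W) : Prop :=
  ∃ n : D.N, q n = w ∧ ∃ b ∈ D.B, ∃ b' ∈ D.B, g = b * n * b'

section Cell

variable {D} {W : Type*} [Group W] {q : D.N →* W}

lemma Cell.left {b g : G} {w : W} (hb : b ∈ D.B) : D.Cell q g w → D.Cell q (b * g) w := by
  rintro ⟨n, hn, c, hc, c', hc', rfl⟩
  exact ⟨n, hn, b * c, mul_mem hb hc, c', hc', by group⟩

lemma Cell.right {b g : G} {w : W} (hb : b ∈ D.B) : D.Cell q g w → D.Cell q (g * b) w := by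
  rintro ⟨n, hn, c, hc, c', hc', rfl⟩
  exact ⟨n, hn, c, hc, c' * b, mul_mem hc' hb, by group⟩

lemma Cell.inv {g : G} {w : W} : D.Cell q g w → D.Cell q g⁻¹ w⁻¹ := by
  rintro ⟨n, rfl, c, hc, c', hc', rfl⟩
  exact ⟨n⁻¹, by simp, c'⁻¹, inv_mem hc', c⁻¹, inv_mem hc, by simp [mul_assoc]⟩

lemma cell_coe (n : D.N) : D.Cell q n (q n) := ⟨n, rfl, 1, one_mem _, 1, one_mem _, by simp⟩

lemma Cell.factor {g : G} {v w : W} (hq : Function.Surjective q) (h : D.Cell q g (v * w)) :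
    ∃ g₁ g₂, g = g₁ * g₂ ∧ D.Cell q g₁ v ∧ D.Cell q g₂ w := by
  obtain ⟨n, hn, b, hb, b', hb', rfl⟩ := h
  obtain ⟨m, rfl⟩ := hq v
  refine ⟨b * m, (m⁻¹ * n : D.N) * b', ?_, (cell_coe m).left hb, ?_⟩
  · push_cast; group
  · have h := cell_coe (q := q) (m⁻¹ * n)
    rw [map_mul, hn, map_inv, inv_mul_cancel_left] at h
    exact h.right hb'

end Cell

variable {D} {p : ℕ} {U : Subgroup G} (hD : D.IsSplit p U)

/-- The generator of the Weyl group with index `i`, where `q` is the map from `N` to the Weyl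
group. -/
abbrev weylGen {W : Type*} [Group W] (hD : D.IsSplit p U) (q : D.N →* W) (i : ι) : W :=
  q ⟨D.s i, hD.s_mem i⟩

section Weyl

variable {W : Type*} [Group W] {q : D.N →* W} (hq : Function.Surjective q)
  (hk : ∀ n : D.N, q n = 1 ↔ (n : G) ∈ D.B)

local notation "S" => weylGen hD q

include hk

lemma Cell.mem_iff {g : G} {w : W} (h : D.Cell q g w) : w = 1 ↔ g ∈ D.B := by
  obtain ⟨n, rfl, b, hb, b', hb', rfl⟩ := h
  rw [hk, Subgroup.mul_mem_cancel_right _ hb', Subgroup.mul_mem_cancel_left _ hb]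

omit hk in
lemma cell_one {b : G} (hb : b ∈ D.B) : D.Cell q b 1 :=
  ⟨1, map_one q, b, hb, 1, one_mem _, by simp⟩

include hD

lemma weylGen_sq (i : ι) : S i * S i = 1 := by
  rw [← map_mul, hk]
  exact (hD.s_sq i).1

lemma weylGen_injective : Function.Injective S := fun i j h => by
  refine hD.s_injective i j ?_
  have : q (⟨D.s i, hD.s_mem i⟩⁻¹ * ⟨D.s j, hD.s_mem j⟩) = 1 := by
    rw [map_mul, map_inv, inv_mul_eq_one]
    exact h
  rw [hk] at this
  exact Subgroup.mem_inf.2 ⟨this, mul_mem (inv_mem (hD.s_mem i)) (hD.s_mem j)⟩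

lemma weylGen_inv (i : ι) : (S i)⁻¹ = S i := inv_eq_of_mul_eq_one_left (weylGen_sq hD hk i)

lemma weylGen_ne_one (i : ι) : S i ≠ 1 := fun h => by
  rw [hk] at h
  obtain ⟨b, hb, h1⟩ := hD.s_conj i
  exact h1 (mul_mem (mul_mem h hb) (inv_mem h))

/-- This is the axiom `s_mul`, freed from the choice of representatives: two representatives of a
generator differ by an element of B. -/
lemma Cell.mul_gen_cases {g h : G} {w : W} {i : ι} (hg : D.Cell q g (S i)) (hh : D.Cell q h w) :
    D.Cell q (g * h) w ∨ D.Cell q (g * h) (S i * w) := by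
  obtain ⟨n, hn, b, hb, b', hb', rfl⟩ := hg
  obtain ⟨m, rfl, c, hc, c', hc', rfl⟩ := hh
  have ht : (D.s i)⁻¹ * n ∈ D.B := by
    have : q (⟨D.s i, hD.s_mem i⟩⁻¹ * n) = 1 := by rw [map_mul, map_inv, hn, inv_mul_cancel]
    rwa [hk] at this
  obtain ⟨b₁, h₁, b₂, h₂, e⟩ := hD.s_mul i m m.2 ((D.s i)⁻¹ * n * b' * c)
    (mul_mem (mul_mem ht hb') hc)
  have e' : b * n * b' * (c * m * c') = b * (D.s i * ((D.s i)⁻¹ * n * b' * c) * m) * c' := by group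
  rw [e']
  rcases e with e | e <;> rw [e]
  · exact Or.inl (((((cell_coe m).left h₁).right h₂).left hb).right hc')
  · have := cell_coe (q := q) (⟨D.s i, hD.s_mem i⟩ * m)
    rw [map_mul] at this
    exact Or.inr ((((this.left h₁).right h₂).left hb).right hc')

lemma Cell.mul_gen_cases_right {g h : G} {w : W} {i : ι} (hg : D.Cell q g (S i))
    (hh : D.Cell q h w) : D.Cell q (h * g) w ∨ D.Cell q (h * g) (w * S i) := by
  have h1 := hg.inv
  rw [weylGen_inv hD hk] at h1
  refine (Cell.mul_gen_cases hD hk h1 hh.inv).imp (fun h => ?_) fun h => ?_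
  · simpa using h.inv
  · simpa [weylGen_inv hD hk] using h.inv

/-- The union of the cells is stable under left multiplication by B and by the generators of N, and
contains 1, so it is G. -/
lemma exists_cell (g : G) : ∃ w, D.Cell q g w := by
  let p : G → Prop := fun g => ∀ h w, D.Cell q h w → ∃ w', D.Cell q (g * h) w'
  have hmul : ∀ x y, p x → p y → p (x * y) := fun x y hx hy h w hw => by
    obtain ⟨w', hw'⟩ := hy h w hw
    obtain ⟨w'', h''⟩ := hx _ _ hw'
    exact ⟨w'', by rwa [mul_assoc]⟩
  have hB : ∀ b ∈ D.B, p b := fun b hb h w hw => ⟨w, hw.left hb⟩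
  have hS : ∀ i g, D.Cell q g (S i) → p g := fun i g hg h w hw =>
    (Cell.mul_gen_cases hD hk hg hw).elim (fun h => ⟨_, h⟩) fun h => ⟨_, h⟩
  have hN : ∀ n ∈ D.N, p n := fun n hn => by
    rw [← hD.s_generates] at hn
    induction hn using Subgroup.closure_induction'' with
    | mem x hx =>
      rcases hx with hx | ⟨i, -, rfl⟩
      · exact hB x hx.1
      · exact hS i _ (cell_coe ⟨D.s i, hD.s_mem i⟩)
    | inv_mem x hx =>
      rcases hx with hx | ⟨i, -, rfl⟩
      · exact hB _ (inv_mem hx.1)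
      · have := (cell_coe (q := q) ⟨D.s i, hD.s_mem i⟩).inv
        rw [weylGen_inv hD hk] at this
        exact hS i _ this
    | one => exact hB 1 (one_mem _)
    | mul x y _ _ hx hy => exact hmul x y hx hy
  have hp : ∀ g, p g := fun g => by
    have hg : g ∈ D.B ⊔ D.N := hD.generates ▸ Subgroup.mem_top g
    rw [Subgroup.sup_eq_closure] at hg
    induction hg using Subgroup.closure_induction'' with
    | mem x hx => exact hx.elim (hB x) (hN x)
    | inv_mem x hx => exact hx.elim (fun h => hB _ (inv_mem h)) fun h => hN _ (inv_mem h)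
    | one => exact hB 1 (one_mem _)
    | mul x y _ _ hx hy => exact hmul x y hx hy
  simpa using hp g 1 1 (cell_one (one_mem _))

include hq

lemma weylGen_isInvolutive : IsInvolutive S where
  sq := weylGen_sq hD hk
  gen w := by
    obtain ⟨⟨n, hn⟩, rfl⟩ := hq w
    have hn' : n ∈ D.NI Set.univ := hD.s_generates ▸ hn
    suffices h : ∃ l, ∃ h : n ∈ D.N, wordProd S l = q ⟨n, h⟩ by
      obtain ⟨l, _, h⟩ := h
      exact ⟨l, h⟩
    clear hn
    induction hn' using Subgroup.closure_induction_left with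
    | one => exact ⟨[], one_mem _, (map_one q).symm⟩
    | mul_left x hx y _ ih =>
      obtain ⟨l, h, e⟩ := ih
      rcases hx with hx | ⟨i, -, rfl⟩
      · refine ⟨l, mul_mem hx.2 h, e.trans ?_⟩
        have := (hk ⟨x, hx.2⟩).2 hx.1
        rw [← one_mul (q ⟨y, h⟩), ← this, ← map_mul]
        rfl
      · refine ⟨i :: l, mul_mem (hD.s_mem i) h, ?_⟩
        rw [wordProd_cons, e, ← map_mul]
        rfl
    | inv_mul_cancel x hx y _ ih =>
      obtain ⟨l, h, e⟩ := ih
      rcases hx with hx | ⟨i, -, rfl⟩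
      · refine ⟨l, mul_mem (inv_mem hx.2) h, e.trans ?_⟩
        have := (hk ⟨x⁻¹, inv_mem hx.2⟩).2 (inv_mem hx.1)
        rw [← one_mul (q ⟨y, h⟩), ← this, ← map_mul]
        rfl
      · refine ⟨i :: l, mul_mem (inv_mem (hD.s_mem i)) h, ?_⟩
        rw [wordProd_cons, e, ← weylGen_inv hD hk, ← map_inv, ← map_mul]
        rfl

local notation "ℓ" => wordLength S

/-- Disjointness of the cells, by induction on the smaller length. Write w = s_i v with v shorter
and remove a factor in B s_i B from g: then v is w' or s_i w', and the first is excluded by the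
lengths. -/
lemma Cell.eq_of_len_le (k : ℕ) : ∀ (g : G) (w w' : W), ℓ w = k → ℓ w ≤ ℓ w' → D.Cell q g w →
    D.Cell q g w' → w = w' := by
  have hs := weylGen_isInvolutive hD hq hk
  induction k with
  | zero =>
    intro g w w' h0 _ h1 h2
    have h3 := hs.eq_one_of_len h0
    rw [h3, eq_comm, h2.mem_iff hk, ← h1.mem_iff hk, h3]
  | succ k ih =>
    intro g w w' h0 hle h1 h2
    obtain ⟨l, hl, e⟩ := hs.exists_word w
    rw [h0] at hl
    obtain ⟨i, l, rfl⟩ := List.exists_cons_of_length_eq_add_one hl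
    rw [wordProd_cons] at e
    have hlen := wordLength_prod_le S l
    generalize wordProd S l = v at *
    subst e
    obtain ⟨g₁, g₂, rfl, h3, h4⟩ := h1.factor hq
    have h5 := h3.inv
    rw [weylGen_inv hD hk] at h5
    have h6 := Cell.mul_gen_cases hD hk h5 h2
    rw [inv_mul_cancel_left] at h6
    have h7 := hs.len_mul_le (S i) v
    have h8 := hs.len_mul_le (S i) (S i * w')
    rw [hs.gen_mul_gen_mul] at h8
    have h9 := wordLength_gen_le S i
    simp only [List.length_cons] at hl
    rcases h6 with h6 | h6
    · have := ih g₂ v w' (by omega) (by omega) h4 h6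
      subst this
      omega
    · have := ih g₂ v (S i * w') (by omega) (by omega) h4 h6
      rw [this, hs.gen_mul_gen_mul]

lemma Cell.unique {g : G} {w w' : W} (h : D.Cell q g w) (h' : D.Cell q g w') : w = w' := by
  rcases le_total (ℓ w) (ℓ w') with h1 | h1
  · exact Cell.eq_of_len_le hD hq hk _ g w w' rfl h1 h h'
  · exact (Cell.eq_of_len_le hD hq hk _ g w' w rfl h1 h' h).symm

/-- If the product stayed in the cell of w = v s_j with v shorter, cancelling s_j on the right and
induction would give s_i v = v s_j or s_i v = v. The first makes s_i w = v shorter than w, the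
second makes s_i trivial. -/
lemma Cell.gen_mul_of_le (k : ℕ) : ∀ (i : ι) (g h : G) (w : W), ℓ w = k → D.Cell q g (S i) →
    D.Cell q h w → ℓ w ≤ ℓ (S i * w) → D.Cell q (g * h) (S i * w) := by
  have hs := weylGen_isInvolutive hD hq hk
  induction k with
  | zero =>
    intro i g h w h0 hg hh _
    have h3 := hs.eq_one_of_len h0
    subst h3
    rw [mul_one]
    exact hg.right ((hh.mem_iff hk).1 rfl)
  | succ k ih =>
    intro i g h w h0 hg hh hle
    refine (Cell.mul_gen_cases hD hk hg hh).resolve_left fun h1 => ?_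
    obtain ⟨l, hl, e⟩ := hs.exists_word w
    rw [h0] at hl
    obtain ⟨l, j, rfl⟩ := (List.eq_nil_or_concat' l).resolve_left (by rintro rfl; simp at hl)
    simp only [wordProd_append, wordProd_cons, wordProd_nil, mul_one] at e
    have hlen := wordLength_prod_le S l
    generalize wordProd S l = v at *
    subst e
    obtain ⟨h₁, h₂, rfl, h3, h4⟩ := hh.factor hq
    have a1 := hs.len_mul_le (S i * v) (S j)
    have a2 := hs.len_mul_le v (S j)
    have a3 := wordLength_gen_le S j
    simp only [List.length_append, List.length_cons, List.length_nil] at hl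
    rw [mul_assoc] at a1
    have h5 := ih i g h₁ v (by omega) hg h3 (by omega)
    have h6 := h4.inv
    rw [weylGen_inv hD hk] at h6
    have h7 := Cell.mul_gen_cases_right hD hk h6 h1
    rw [mul_assoc, mul_inv_cancel_right, hs.mul_gen_mul_gen] at h7
    rcases h7 with h7 | h7
    · have := h5.unique hD hq hk h7
      rw [← mul_assoc, this, hs.mul_gen_mul_gen] at hle
      omega
    · have := h5.unique hD hq hk h7
      exact weylGen_ne_one hD hk i (mul_eq_right.1 this)

/-- The double coset of a generator is closed under multiplication up to `B`. -/
lemma exists_cell_mul (i : ι) :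
    ∃ g h, D.Cell q g (S i) ∧ D.Cell q h (S i) ∧ D.Cell q (g * h) (S i) := by
  have hs := weylGen_isInvolutive hD hq hk
  obtain ⟨b, hb, h⟩ := hD.s_conj i
  have h1 := cell_coe (q := q) ⟨D.s i, hD.s_mem i⟩
  have h2 := h1.inv
  rw [weylGen_inv hD hk] at h2
  refine ⟨_, _, h1.right hb, h2, ?_⟩
  rcases Cell.mul_gen_cases hD hk (h1.right hb) h2 with h3 | h3
  · exact h3
  · rw [hs.sq] at h3
    exact absurd ((h3.mem_iff hk).1 rfl) h

omit hD hk in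
lemma exists_cell_eq (w : W) : ∃ g, D.Cell q g w := by
  obtain ⟨n, rfl⟩ := hq w
  exact ⟨n, cell_coe n⟩

lemma weylGen_isFolding : IsFolding S where
  toIsInvolutive := weylGen_isInvolutive hD hq hk
  ne i w h := by
    have hs := weylGen_isInvolutive hD hq hk
    -- Suppose s_i w and w have equal length. With g₁, g₂ and g₁g₂ all in B s_i B and g in the cell
    -- of w, the product g₁g₂g lies in the cell of w when computed in two steps, and in that of s_i
    -- w when computed in one.
    obtain ⟨g₁, g₂, h1, h2, h3⟩ := exists_cell_mul hD hq hk i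
    obtain ⟨g, hg⟩ := exists_cell_eq hq w
    have h4 := Cell.gen_mul_of_le hD hq hk _ i _ _ w rfl h2 hg h.ge
    have h5 := Cell.gen_mul_of_le hD hq hk _ i _ _ _ rfl h1 h4 (by rw [hs.gen_mul_gen_mul, h])
    have h6 := Cell.gen_mul_of_le hD hq hk _ i _ _ w rfl h3 hg h.ge
    rw [hs.gen_mul_gen_mul] at h5
    rw [mul_assoc] at h6
    exact weylGen_ne_one hD hk i (mul_eq_right.1 (h6.unique hD hq hk h5))
  fold i j v h h' hle := by
    have hs := weylGen_isInvolutive hD hq hk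
    obtain ⟨g₁, g₂, h1, h2, h3⟩ := exists_cell_mul hD hq hk i
    -- For g in the cell of s_i v s_j, both g₂g and g₁g₂g lie in the cell of v s_j. Removing a right
    -- factor of type s_j puts g₁k₁ in the cell of v s_j or of v, while k₁ in the cell of v forces
    -- it into that of s_i v.
    obtain ⟨g, hg⟩ := exists_cell_eq hq (S i * (v * S j))
    have hle' : ℓ (S i * (v * S j)) ≤ ℓ (S i * (S i * (v * S j))) := by
      rwa [hs.gen_mul_gen_mul]
    have h4 := Cell.gen_mul_of_le hD hq hk _ i _ _ _ rfl h2 hg hle'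
    have h5 := Cell.gen_mul_of_le hD hq hk _ i _ _ _ rfl h3 hg hle'
    rw [hs.gen_mul_gen_mul] at h4 h5
    obtain ⟨k₁, k₂, h6, h7, h8⟩ := h4.factor hq
    have h9 := Cell.gen_mul_of_le hD hq hk _ i _ _ _ rfl h1 h7 h.le
    have h10 := h8.inv
    rw [weylGen_inv hD hk] at h10
    have h11 := Cell.mul_gen_cases_right hD hk h10 h5
    have e : g₁ * g₂ * g * k₂⁻¹ = g₁ * k₁ := by rw [mul_assoc g₁, h6]; group
    rw [e, hs.mul_gen_mul_gen] at h11
    rcases h11 with h11 | h11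
    · exact h9.unique hD hq hk h11
    · exact absurd (mul_eq_right.1 (h9.unique hD hq hk h11)) (weylGen_ne_one hD hk i)

lemma exists_isBruhat_of_hom : ∃ δ : G → W, D.IsBruhat S δ := by
  choose δ hδ using exists_cell hD hk
  have key : ∀ g w, D.Cell q g w → δ g = w := fun g w h => (hδ g).unique hD hq hk h
  have hN : ∀ n : D.N, δ n = q n := fun n => key _ _ (cell_coe n)
  refine ⟨δ, { toIsFolding := weylGen_isFolding hD hq hk
               injective := weylGen_injective hD hk
               gen_mem := hD.s_mem
               eq_one_iff := fun g => (hδ g).mem_iff hk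
               mul_left := fun b hb g => key _ _ ((hδ g).left hb)
               mul_right := fun b hb g => key _ _ ((hδ g).right hb)
               inv := fun g => key _ _ (hδ g).inv
               apply_s := fun i => hN ⟨D.s i, hD.s_mem i⟩
               mul_N := fun n hn m hm => ?_
               surj := fun w => ?_
               exists_eq := fun g h e => ?_
               gen_mul := fun i g h hg => ?_
               gen_mul_of_le := fun i g h hg hle => ?_ }⟩
  · rw [hN ⟨n, hn⟩, hN ⟨m, hm⟩, ← map_mul, ← hN]
    rfl
  · obtain ⟨n, rfl⟩ := hq w
    exact ⟨n, n.2, hN n⟩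
  · obtain ⟨n, hn, b, hb, b', hb', rfl⟩ := hδ g
    obtain ⟨m, hm, c, hc, c', hc', rfl⟩ := hδ h
    have ht : ((m⁻¹ * n : D.N) : G) ∈ D.B := by
      rw [← hk, map_mul, map_inv, hn, hm, e, inv_mul_cancel]
    exact ⟨b * c⁻¹, mul_mem hb (inv_mem hc), c'⁻¹ * (m⁻¹ * n : D.N) * b',
      mul_mem (mul_mem (inv_mem hc') ht) hb', by push_cast; group⟩
  · have h1 := hδ g
    rw [hg] at h1
    exact (Cell.mul_gen_cases hD hk h1 (hδ h)).imp (key _ _) (key _ _)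
  · have h1 := hδ g
    rw [hg] at h1
    exact key _ _ (Cell.gen_mul_of_le hD hq hk _ i _ _ _ rfl h1 (hδ h) hle)

end Weyl

include hD

lemma exists_isBruhat : ∃ (W : Type u) (_ : Group W) (s : ι → W) (δ : G → W), D.IsBruhat s δ := by
  have hn : (D.T.subgroupOf D.N).Normal := ⟨fun t ht n => hD.normal_T n n.2 t ht⟩
  refine ⟨D.N ⧸ D.T.subgroupOf D.N, inferInstance, _,
    exists_isBruhat_of_hom hD (q := QuotientGroup.mk' (D.T.subgroupOf D.N))
      (QuotientGroup.mk'_surjective _) fun n => ?_⟩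
  rw [QuotientGroup.mk'_apply, QuotientGroup.eq_one_iff, Subgroup.mem_subgroupOf]
  exact and_iff_left n.2

end BNData
end Bruhat

/-! ### Parabolic subgroups and lengths in terms of the Bruhat map -/

section Bruhat

universe u w

namespace BNData
namespace IsBruhat

variable {G : Type u} [Group G] {ι : Type w} {D : BNData G ι}
  {W : Type*} [Group W] {s : ι → W} {δ : G → W} (hδ : D.IsBruhat s δ)

local notation "ℓ" => wordLength s

include hδ

lemma exists_mul_eq {g : G} {v w : W} (h : δ g = v * w) : ∃ g₁ g₂, g = g₁ * g₂ ∧ δ g₁ = v ∧ δ g₂ = w := by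
  obtain ⟨n, hn, rfl⟩ := hδ.surj v
  obtain ⟨m, hm, rfl⟩ := hδ.surj w
  rw [← hδ.mul_N n hn m hm] at h
  obtain ⟨b, hb, b', hb', rfl⟩ := hδ.exists_eq _ _ h
  exact ⟨b * n, m * b', by group, hδ.mul_left b hb n, hδ.mul_right b' hb' m⟩

lemma mul_gen_of_le {i : ι} {g h : G} (hg : δ g = s i) (hle : ℓ (δ h) ≤ ℓ (δ h * s i)) :
    δ (h * g) = δ h * s i := by
  have h1 := hδ.gen_mul_of_le i g⁻¹ h⁻¹ (by rw [hδ.inv, hg, hδ.inv_gen]) (by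
    rw [hδ.inv, hδ.len_inv, ← hδ.inv_gen i, ← mul_inv_rev, hδ.len_inv]; exact hle)
  rw [← mul_inv_rev, hδ.inv, hδ.inv, ← hδ.inv_gen i, ← mul_inv_rev] at h1
  exact inv_injective h1

/-- Along a reduced word of δ(g) each letter increases the length, so no step of the multiplication
branches. -/
lemma mul_of_len {g h : G} (hl : ℓ (δ g * δ h) = ℓ (δ g) + ℓ (δ h)) : δ (g * h) = δ g * δ h := by
  obtain ⟨l, h1, h2⟩ := hδ.exists_word (δ g)
  induction l generalizing g with
  | nil =>
    have h3 : δ g = 1 := by simpa using h2.symm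
    rw [h3, one_mul]
    exact hδ.mul_left g ((hδ.eq_one_iff g).1 h3) h
  | cons i l ih =>
    rw [wordProd_cons] at h2
    obtain ⟨g₁, g₂, rfl, h3, h4⟩ := hδ.exists_mul_eq h2.symm
    have h5 := hδ.len_mul_le (s i) (δ g₂ * δ h)
    have h6 := hδ.len_mul_le (δ g₂) (δ h)
    have h7 := wordLength_prod_le s l
    rw [← h2, ← h4] at h1 hl
    rw [← h4] at h7
    have h8 := wordLength_gen_le s i
    have h9 := hδ.len_mul_le (s i) (δ g₂)
    simp only [List.length_cons] at h1
    rw [mul_assoc] at hl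
    have h10 := ih (g := g₂) (by omega) (by omega) h4.symm
    rw [mul_assoc, hδ.gen_mul_of_le i g₁ _ h3 (by rw [h10]; omega), h10, ← h2, h4, mul_assoc]

lemma mul_mem_genBy {J : Set ι} {g : G} (hg : δ g ∈ genBy s J) (h : G) :
    δ (g * h) * (δ h)⁻¹ ∈ genBy s J := by
  obtain ⟨l, hl, -, h1⟩ := hδ.exists_word_genBy hg
  clear hg
  induction l generalizing g with
  | nil =>
    have h3 : δ g = 1 := by simpa using h1.symm
    rw [hδ.mul_left g ((hδ.eq_one_iff g).1 h3) h, mul_inv_cancel]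
    exact one_mem _
  | cons i l ih =>
    rw [wordProd_cons] at h1
    obtain ⟨g₁, g₂, rfl, h3, h4⟩ := hδ.exists_mul_eq h1.symm
    have h5 := ih (fun j hj => hl j (by simp [hj])) h4.symm
    rw [mul_assoc]
    rcases hδ.gen_mul i g₁ (g₂ * h) h3 with h6 | h6 <;> rw [h6]
    · exact h5
    · rw [mul_assoc]
      exact mul_mem (gen_mem_genBy s (hl i (by simp))) h5

lemma inv_mul_mem_genBy {J : Set ι} {h : G} (hh : δ h ∈ genBy s J) (g : G) :
    (δ g)⁻¹ * δ (g * h) ∈ genBy s J := by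
  have := inv_mem (hδ.mul_mem_genBy (g := h⁻¹) (by rw [hδ.inv]; exact inv_mem hh) g⁻¹)
  rwa [← mul_inv_rev, hδ.inv, hδ.inv, mul_inv_rev, inv_inv, inv_inv] at this

/-- This is P_J = B W_J B: by `mul_mem_genBy` the right-hand side defines a subgroup, and conversely
g factors along a word of δ(g) in the alphabet J. -/
lemma mem_P_iff {J : Set ι} {g : G} : g ∈ D.P J ↔ δ g ∈ genBy s J := by
  constructor
  · intro hg
    let H : Subgroup G :=
      { carrier := {g | δ g ∈ genBy s J}
        one_mem' := by
          have := (hδ.eq_one_iff 1).2 (one_mem _)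
          rw [Set.mem_ofPred, this]
          exact one_mem _
        mul_mem' := fun {a b} ha hb => by
          have := mul_mem (hδ.mul_mem_genBy ha b) hb
          rwa [inv_mul_cancel_right] at this
        inv_mem' := fun {a} ha => by
          rw [Set.mem_ofPred, hδ.inv]
          exact inv_mem ha }
    suffices D.P J ≤ H from this hg
    refine (Subgroup.closure_le _).2 ?_
    rintro _ (hb | ⟨i, hi, rfl⟩)
    · change δ _ ∈ genBy s J
      rw [(hδ.eq_one_iff _).2 hb]
      exact one_mem _
    · change δ _ ∈ genBy s J
      rw [hδ.apply_s]
      exact gen_mem_genBy s hi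
  · intro hg
    obtain ⟨l, hl, -, h1⟩ := hδ.exists_word_genBy hg
    clear hg
    induction l generalizing g with
    | nil => exact Subgroup.subset_closure (Or.inl ((hδ.eq_one_iff g).1 (by simpa using h1.symm)))
    | cons i l ih =>
      rw [wordProd_cons] at h1
      obtain ⟨g₁, g₂, rfl, h3, h4⟩ := hδ.exists_mul_eq h1.symm
      refine mul_mem ?_ (ih (fun j hj => hl j (by simp [hj])) h4.symm)
      obtain ⟨b, hb, b', hb', rfl⟩ := hδ.exists_eq g₁ (D.s i) (by rw [h3, hδ.apply_s])
      exact mul_mem (mul_mem (Subgroup.subset_closure (Or.inl hb))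
        (Subgroup.subset_closure (Or.inr ⟨i, hl i (by simp), rfl⟩)))
        (Subgroup.subset_closure (Or.inl hb'))

omit hδ in
lemma _root_.BNData.B_le_P (D : BNData G ι) (J : Set ι) : D.B ≤ D.P J := fun _ hb =>
  Subgroup.subset_closure (Or.inl hb)

omit hδ in
lemma _root_.BNData.s_mem_P (D : BNData G ι) {J : Set ι} {i : ι} (hi : i ∈ J) : D.s i ∈ D.P J :=
  Subgroup.subset_closure (Or.inr ⟨i, hi, rfl⟩)

lemma exists_P_mul_eq {I : Set ι} {u : W} (hu : u ∈ genBy s I) (g : G) :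
    ∃ p ∈ D.P I, δ (p * g) = u * δ g := by
  obtain ⟨n, hn, e⟩ := hδ.surj (δ g)
  obtain ⟨m, hm, rfl⟩ := hδ.surj u
  obtain ⟨b, hb, b', hb', rfl⟩ := hδ.exists_eq g n e.symm
  refine ⟨m * b⁻¹, hδ.mem_P_iff.2 (by rwa [hδ.mul_right _ (inv_mem hb)]), ?_⟩
  have : m * b⁻¹ * (b * n * b') = m * n * b' := by group
  rw [this, hδ.mul_right b' hb', hδ.mul_right b' hb', hδ.mul_left b hb, hδ.mul_N m hm n hn]

/-! ### Length and longest elements in `N` -/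

lemma T_eq_one {t : G} (ht : t ∈ D.T) : δ t = 1 := (hδ.eq_one_iff t).2 ht.1

lemma prod_s (l : List ι) : (l.map D.s).prod ∈ D.N ∧ δ (l.map D.s).prod = wordProd s l := by
  induction l with
  | nil => exact ⟨one_mem _, (hδ.eq_one_iff 1).2 (one_mem _)⟩
  | cons i l ih =>
    rw [List.map_cons, List.prod_cons, wordProd_cons]
    exact ⟨mul_mem (hδ.gen_mem i) ih.1, by rw [hδ.mul_N _ (hδ.gen_mem i) _ ih.1, ih.2, hδ.apply_s]⟩

lemma len_eq {n : G} (hn : n ∈ D.N) : D.len n = ℓ (δ n) := by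
  unfold BNData.len wordLength
  congr 1
  ext k
  refine exists_congr fun l => and_congr_right fun _ => ?_
  obtain ⟨h1, h2⟩ := hδ.prod_s l
  have h3 : ((l.map D.s).prod)⁻¹ * n ∈ D.N := mul_mem (inv_mem h1) hn
  rw [BNData.T, Subgroup.mem_inf, and_iff_left h3, ← hδ.eq_one_iff,
    hδ.mul_N _ (inv_mem h1) n hn, hδ.inv, h2, inv_mul_eq_one]

lemma mem_NI_iff {J : Set ι} {n : G} : n ∈ D.NI J ↔ n ∈ D.N ∧ δ n ∈ genBy s J := by
  constructor
  · intro h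
    have h1 : D.NI J ≤ D.P J := Subgroup.closure_mono (Set.union_subset_union_left _ fun t ht => ht.1)
    have h2 : D.NI J ≤ D.N := (Subgroup.closure_le _).2
      (Set.union_subset (fun t ht => ht.2) (by rintro _ ⟨i, -, rfl⟩; exact hδ.gen_mem i))
    exact ⟨h2 h, hδ.mem_P_iff.1 (h1 h)⟩
  · rintro ⟨hn, h⟩
    obtain ⟨l, hl, -, e⟩ := hδ.exists_word_genBy h
    obtain ⟨h1, h2⟩ := hδ.prod_s l
    have h3 : ((l.map D.s).prod)⁻¹ * n ∈ D.T := by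
      refine Subgroup.mem_inf.2 ⟨?_, mul_mem (inv_mem h1) hn⟩
      exact (hδ.eq_one_iff _).1 (by rw [hδ.mul_N _ (inv_mem h1) n hn, hδ.inv, h2, e, inv_mul_cancel])
    have h4 : (l.map D.s).prod ∈ D.NI J := Subgroup.list_prod_mem _ fun x hx => by
      obtain ⟨j, hj, rfl⟩ := List.mem_map.1 hx
      exact Subgroup.subset_closure (Or.inr ⟨j, hl j hj, rfl⟩)
    have := mul_mem h4 (Subgroup.subset_closure (Or.inl h3))
    rwa [mul_inv_cancel_left] at this

/-- Translates longest elements, defined through representatives in N, into the Weyl group of the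
Bruhat map. -/
lemma isLongest_iff {J : Set ι} {n : G} :
    D.IsLongest J n ↔ n ∈ D.N ∧ IsLongestIn s J (δ n) := by
  constructor
  · rintro ⟨h1, h2⟩
    obtain ⟨h3, h4⟩ := hδ.mem_NI_iff.1 h1
    refine ⟨h3, h4, fun v hv => ?_⟩
    obtain ⟨m, hm, rfl⟩ := hδ.surj v
    rw [← hδ.len_eq hm, ← hδ.len_eq h3]
    exact h2 m (hδ.mem_NI_iff.2 ⟨hm, hv⟩)
  · rintro ⟨h1, h2, h3⟩
    refine ⟨hδ.mem_NI_iff.2 ⟨h1, h2⟩, fun m hm => ?_⟩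
    obtain ⟨h4, h5⟩ := hδ.mem_NI_iff.1 hm
    rw [hδ.len_eq h4, hδ.len_eq h1]
    exact h3 _ h5

end IsBruhat
end BNData

/-! ### Ranks of cosets -/

/-- The least value of `f` on the coset `x`. -/
def cosetRank {G : Type*} [Group G] (f : G → ℕ) {H : Subgroup G} (x : G ⧸ H) : ℕ :=
  sInf {k | ∃ g : G, (g : G ⧸ H) = x ∧ f g = k}

section CosetRank

variable {G : Type*} [Group G] {f : G → ℕ} {H K : Subgroup G}

lemma exists_cosetRank (x : G ⧸ H) : ∃ g : G, (g : G ⧸ H) = x ∧ f g = cosetRank f x := by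
  obtain ⟨g, rfl⟩ := QuotientGroup.mk_surjective x
  exact Nat.sInf_mem (s := {k | ∃ h : G, (h : G ⧸ H) = g ∧ f h = k}) ⟨_, g, rfl, rfl⟩

lemma cosetRank_le (g : G) : cosetRank f (g : G ⧸ H) ≤ f g := Nat.sInf_le ⟨g, rfl, rfl⟩

lemma cosetRank_map_le (h : H ≤ K) (x : G ⧸ H) :
    cosetRank f (Subgroup.quotientMapOfLE h x) ≤ cosetRank f x := by
  obtain ⟨g, rfl, e⟩ := exists_cosetRank (f := f) x
  rw [← e]
  exact cosetRank_le g

lemma cosetRank_smul {q : G} (hq : ∀ g, f (q * g) = f g) (x : G ⧸ H) :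
    cosetRank f (q • x) = cosetRank f x := by
  refine le_antisymm ?_ ?_
  · obtain ⟨g, rfl, e⟩ := exists_cosetRank (f := f) x
    rw [← e, ← hq]
    exact cosetRank_le (q * g)
  · obtain ⟨g, h1, e⟩ := exists_cosetRank (f := f) (q • x)
    have hx : x = ((q⁻¹ * g : G) : G ⧸ H) := eq_inv_smul_iff.2 h1.symm
    have hg : f g = f (q⁻¹ * g) := by rw [← hq (q⁻¹ * g), mul_inv_cancel_left]
    rw [← e, hg, hx]
    exact cosetRank_le _

end CosetRank
end Bruhat

/-! ### Cosets of parabolic subgroups of a given rank -/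

section Bruhat

universe u w

lemma quotientMapOfLE_coe {G : Type*} [Group G] {H K : Subgroup G} (h : H ≤ K) (g : G) :
    Subgroup.quotientMapOfLE h (g : G ⧸ H) = (g : G ⧸ K) := rfl

lemma smul_coset_coe {G : Type*} [Group G] {H : Subgroup G} (q g : G) :
    q • (g : G ⧸ H) = ((q * g : G) : G ⧸ H) := rfl

lemma quotientMapOfLE_smul {G : Type*} [Group G] {H K : Subgroup G} (h : H ≤ K) (q : G)
    (x : G ⧸ H) :
    Subgroup.quotientMapOfLE h (q • x) = q • Subgroup.quotientMapOfLE h x := by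
  induction x using QuotientGroup.induction_on
  rfl

namespace BNData
namespace IsBruhat

variable {G : Type u} [Group G] {ι : Type w} {D : BNData G ι}
  {W : Type*} [Group W] {s : ι → W} {δ : G → W} (hδ : D.IsBruhat s δ)
  {I : Set ι} {f : W → ℕ} (hf : IsRank s I f)

local notation "ℓ" => wordLength s
local notation "F" => fun g => f (δ g)

include hδ hf

lemma rank_mul {q : G} (hq : q ∈ D.P I) (g : G) : f (δ (q * g)) = f (δ g) := by
  have := hf.mul _ (hδ.mul_mem_genBy (hδ.mem_P_iff.1 hq) g) (δ g)
  rwa [inv_mul_cancel_right] at this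

/-- The function f separates the cosets of W_I, and P_I moves an element of one cell into any cell
of the same W_I-coset. -/
lemma exists_smul_of_rank {H : Subgroup G} {x : G ⧸ H} {y : W} (hx : cosetRank F x = f y) :
    ∃ q ∈ D.P I, ∃ g : G, x = q • (g : G ⧸ H) ∧ δ g = y := by
  obtain ⟨h, rfl, e⟩ := exists_cosetRank (f := F) x
  obtain ⟨u, hu, rfl⟩ := hf.eq _ _ (e.trans hx)
  obtain ⟨p, hp, e'⟩ := hδ.exists_P_mul_eq hu h
  refine ⟨p⁻¹, inv_mem hp, p * h, ?_, e'⟩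
  rw [eq_inv_smul_iff, smul_coset_coe]

/-- A descent j ∈ J would allow splitting off a factor in P_J, giving an element of gP_J in the cell
of the shorter y s_j, hence of smaller rank. Together with `rank_of_ascents` this characterises rank
f(y) by ascents. -/
lemma ascent_of_rank {J : Set ι} {y : W} (hy : IsLeftMin s I y) {g : G} (hg : δ g = y)
    (h : cosetRank F (g : G ⧸ D.P J) = f y) {j : ι} (hj : j ∈ J) : ℓ y < ℓ (y * s j) := by
  rcases hδ.len_mul_gen y j with h1 | h1
  · omega
  · exfalso
    have h2 := hf.lt_of_len_lt hδ.toIsFolding hy (w := y * s j) (by omega)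
    obtain ⟨g₁, g₂, rfl, h3, h4⟩ := hδ.exists_mul_eq (g := g) (v := y * s j) (w := s j)
      (by rw [hg, hδ.mul_gen_mul_gen])
    have h5 : ((g₁ * g₂ : G) : G ⧸ D.P J) = g₁ := by
      rw [QuotientGroup.mk_mul_of_mem]
      exact hδ.mem_P_iff.2 (h4 ▸ gen_mem_genBy s hj)
    have h6 := cosetRank_le (f := F) (H := D.P J) g₁
    rw [h5] at h
    simp only [h3] at h6
    omega

lemma rank_of_ascents {K : Set ι} {y : W} (hy : IsLeftMin s I y)
    (hK : ∀ k ∈ K, ℓ y < ℓ (y * s k)) {g : G} (hg : δ g = y) :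
    cosetRank F (g : G ⧸ D.P K) = f y := by
  refine le_antisymm (hg ▸ cosetRank_le (f := F) g) ?_
  obtain ⟨h, h1, e⟩ := exists_cosetRank (f := F) (g : G ⧸ D.P K)
  rw [← e]
  have h2 : g⁻¹ * h ∈ D.P K := QuotientGroup.eq.1 h1.symm
  have h3 := hf.le_mul hδ.toIsFolding hy hK (hδ.inv_mul_mem_genBy (hδ.mem_P_iff.1 h2) g)
  rwa [mul_inv_cancel_left, hg, mul_inv_cancel_left] at h3

section Ascent

variable {y : W} (hy : IsLeftMin s I y) {i : ι} (hi : wordLength s y < wordLength s (y * s i))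
  {J K : Set ι} (hJK : J ≤ K) (hK : K ⊆ insert i J)

include hy hi hK

/-- Since y ascends along J and along i, it ascends along K, so enlarging J does not lower the rank.
-/
lemma rank_map {x : G ⧸ D.P J} (hx : cosetRank F x = f y) :
    cosetRank F (Subgroup.quotientMapOfLE (D.P_mono hJK) x) = f y := by
  obtain ⟨q, hq, g, rfl, hg⟩ := hδ.exists_smul_of_rank hf hx
  rw [cosetRank_smul (hδ.rank_mul hf hq)] at hx
  have h1 : ∀ k ∈ K, ℓ y < ℓ (y * s k) := fun k hk => (hK hk).elim (fun e => e ▸ hi)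
    fun h => hδ.ascent_of_rank hf hy hg hx h
  have h2 := hδ.rank_of_ascents hf hy h1 hg
  rwa [quotientMapOfLE_smul, cosetRank_smul (hδ.rank_mul hf hq), quotientMapOfLE_coe]

lemma rank_map_injective (hi' : ∀ j ∈ I, s j * y ≠ y * s i) {x x' : G ⧸ D.P J}
    (hx : cosetRank F x = f y) (hx' : cosetRank F x' = f y)
    (e : Subgroup.quotientMapOfLE (D.P_mono hJK) x = Subgroup.quotientMapOfLE (D.P_mono hJK) x') :
    x = x' := by
  obtain ⟨q, hq, g, rfl, hg⟩ := hδ.exists_smul_of_rank hf hx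
  obtain ⟨h, h1, h2⟩ := exists_cosetRank (f := F) (q⁻¹ • x')
  rw [cosetRank_smul (hδ.rank_mul hf (inv_mem hq)), hx'] at h2
  rw [cosetRank_smul (hδ.rank_mul hf hq)] at hx
  have hx'' : x' = q • (h : G ⧸ D.P J) := by rw [h1, smul_inv_smul]
  subst hx''
  have h3 : ∀ k ∈ K, ℓ y < ℓ (y * s k) := fun k hk => (hK hk).elim (fun e => e ▸ hi)
    fun h => hδ.ascent_of_rank hf hy hg hx h
  rw [quotientMapOfLE_smul, quotientMapOfLE_smul, smul_left_cancel_iff, quotientMapOfLE_coe,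
    quotientMapOfLE_coe] at e
  have h4 : g⁻¹ * h ∈ D.P K := QuotientGroup.eq.1 e
  have h5 := hδ.mem_P_iff.1 h4
  have h6 : δ h = y * δ (g⁻¹ * h) := by
    have := hδ.mul_of_len (g := g) (h := g⁻¹ * h) (by rw [hg, hδ.len_mul_of_right h3 h5])
    rwa [mul_inv_cancel_left, hg] at this
  -- As h has rank f(y), a longer minimal element is impossible, so δ(g⁻¹h) is a product of
  -- generators k ∈ K with y s_k = s_j y for some j ∈ I. The choice of i excludes k = i, leaving an
  -- element of W_J.
  obtain ⟨u, hu, z, hz, h7, h8⟩ := hδ.mul_genBy_cases hy h3 h5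
  congr 1
  refine QuotientGroup.eq.2 (hδ.mem_P_iff.2 ?_)
  rcases h8 with ⟨rfl, h8⟩ | h8
  · refine genBy_mono s ?_ h8
    rintro k ⟨hk, j, hj, e⟩
    rcases hK hk with rfl | hk
    · exact absurd e (hi' j hj)
    · exact hk
  · have := hf.lt _ _ hy hz h8
    rw [← hf.mul u hu z, ← h7, ← h6] at this
    omega

end Ascent

omit hδ hf in
-- An element realising the minimum on a coset of P_K also realises it on the smaller coset of P_J
-- through it.
lemma exists_of_rank_map {φ : G → ℕ} {J K : Set ι} (hJK : J ≤ K) (z : G ⧸ D.P K) :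
    ∃ x : G ⧸ D.P J, cosetRank φ x = cosetRank φ z ∧
      Subgroup.quotientMapOfLE (D.P_mono hJK) x = z := by
  obtain ⟨h, rfl, e⟩ := exists_cosetRank (f := φ) z
  refine ⟨h, le_antisymm (e ▸ cosetRank_le h) ?_, rfl⟩
  exact cosetRank_map_le (D.P_mono hJK) (h : G ⧸ D.P J)

section Longest

variable {a b : W} (ha : IsLongestIn s I a) (hb : IsLongestIn s Set.univ b)
  {e : I → ι} (he : ∀ i : I, s i * (a * b) = a * b * s (e i))
  {n : G} (hn : δ n = a * b)

include ha hb

lemma rank_le_longest {H : Subgroup G} (x : G ⧸ H) : cosetRank F x ≤ f (a * b) := by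
  obtain ⟨h, rfl, e⟩ := exists_cosetRank (f := F) x
  exact e ▸ hf.le_longest hδ.toIsFolding ha hb _

omit hf in
include he in
lemma ascent_longest (i : I) : ℓ (a * b) < ℓ (a * b * s (e i)) := by
  rw [← he, hδ.len_mul_longest ha hb (gen_mem_genBy s i.2), hδ.len_gen]
  omega

include he in
lemma subset_range_of_rank {J : Set ι} {x : G ⧸ D.P J} (hx : cosetRank F x = f (a * b)) :
    J ⊆ Set.range e := by
  intro j hj
  obtain ⟨q, hq, g, rfl, hg⟩ := hδ.exists_smul_of_rank hf hx
  rw [cosetRank_smul (hδ.rank_mul hf hq)] at hx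
  have hd := hδ.isLeftMin_longest ha hb
  have h1 := hδ.ascent_of_rank hf hd hg hx hj
  have h2 : δ (g * D.s j) = a * b * s j := by
    rw [hδ.mul_gen_of_le (hδ.apply_s j) (by rw [hg]; exact h1.le), hg]
  have h3 : ((g * D.s j : G) : G ⧸ D.P J) = g := QuotientGroup.mk_mul_of_mem _ (D.s_mem_P hj)
  have h4 := cosetRank_le (f := F) (H := D.P J) (g * D.s j)
  rw [h3, hx, h2] at h4
  -- The coset has maximal rank and contains g s_j, so d s_j lies in W_I d. The lengths then force d
  -- s_j = s_i d with i ∈ I, that is, j = e(i).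
  obtain ⟨u, hu, h5⟩ := hf.eq _ _ (h4.antisymm (hf.le_longest hδ.toIsFolding ha hb _))
  have h6 := hδ.len_mul_longest ha hb hu
  have h7 := hδ.len_mul_gen (a * b) j
  rw [← h5] at h6
  obtain ⟨i, rfl⟩ := hδ.eq_gen_of_len (w := u) (by omega)
  have hi := hδ.mem_of_gen_mem_genBy hδ.injective hu
  refine ⟨⟨i, hi⟩, hδ.injective ?_⟩
  rw [he ⟨i, hi⟩] at h5
  exact (mul_left_cancel h5).symm

omit ha hb in
include hn in
lemma exists_smul_longest {J : Set ι} {x : G ⧸ D.P J} (hx : cosetRank F x = f (a * b)) :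
    ∃ q ∈ D.P I, x = q • (n : G ⧸ D.P J) := by
  obtain ⟨q, hq, g, rfl, hg⟩ := hδ.exists_smul_of_rank hf hx
  obtain ⟨c, hc, c', hc', rfl⟩ := hδ.exists_eq g n (hg.trans hn.symm)
  refine ⟨q * c, mul_mem hq (D.B_le_P I hc), ?_⟩
  have : ((c * n * c' : G) : G ⧸ D.P J) = ((c * n : G) : G ⧸ D.P J) :=
    QuotientGroup.mk_mul_of_mem _ (D.B_le_P J hc')
  rw [this, mul_smul, smul_coset_coe c]

include he hn in
lemma rank_longest {J : Set ι} (hJ : J ⊆ Set.range e) :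
    cosetRank F (n : G ⧸ D.P J) = f (a * b) := by
  refine hδ.rank_of_ascents hf (hδ.isLeftMin_longest ha hb) (fun j hj => ?_) hn
  obtain ⟨i, rfl⟩ := hJ hj
  exact hδ.ascent_longest ha hb he i

end Longest

end IsBruhat
end BNData
end Bruhat

/-! ### Conjugation by w_I w_S and the parabolic subgroups of the Levi subgroup -/

section Bruhat

universe u w

lemma IsFolding.longest_unique {W ι : Type*} [Group W] {s : ι → W} (hs : IsFolding s) {J : Set ι}
    {a b : W} (ha : IsLongestIn s J a) (hb : IsLongestIn s J b) : a = b := by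
  have h1 := hs.longest_mul hb (mul_mem (inv_mem hb.1) ha.1)
  rw [mul_inv_cancel_left] at h1
  have h2 := ha.2 b hb.1
  have h3 := hs.eq_one_of_len (w := b⁻¹ * a) (by omega)
  exact (inv_mul_eq_one.1 h3).symm

lemma conj_mem_of_mem_closure {G : Type*} [Group G] {A : Set G} {K : Subgroup G} {n : G}
    (h : ∀ x ∈ A, n * x * n⁻¹ ∈ K) {g : G} (hg : g ∈ Subgroup.closure A) : n * g * n⁻¹ ∈ K := by
  have h1 : Subgroup.closure A ≤ K.comap (MulAut.conj n).toMonoidHom :=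
    (Subgroup.closure_le _).2 h
  exact h1 hg

lemma inv_conj_mem_of_mem_closure {G : Type*} [Group G] {A : Set G} {K : Subgroup G} {n : G}
    (h : ∀ x ∈ A, n⁻¹ * x * n ∈ K) {g : G} (hg : g ∈ Subgroup.closure A) : n⁻¹ * g * n ∈ K := by
  have := conj_mem_of_mem_closure (n := n⁻¹) (by simpa using h) hg
  rwa [inv_inv] at this

namespace BNData
namespace IsBruhat

variable {G : Type u} [Group G] {ι : Type w} {D : BNData G ι}
  {W : Type*} [Group W] {s : ι → W} {δ : G → W} (hδ : D.IsBruhat s δ)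

local notation "ℓ" => wordLength s

include hδ

/-- Additivity of length gives δ(cn) = δ(n) δ(n⁻¹cn), while δ(cn) = δ(n) because c ∈ B. -/
lemma conj_mem_B {K : Set ι} {n : G} (hK : ∀ k ∈ K, ℓ (δ n) < ℓ (δ n * s k)) {c : G}
    (hc : c ∈ D.B) (h : n⁻¹ * c * n ∈ D.P K) : n⁻¹ * c * n ∈ D.B := by
  rw [← hδ.eq_one_iff]
  have h1 := hδ.mul_of_len (g := n) (h := n⁻¹ * c * n)
    (hδ.len_mul_of_right hK (hδ.mem_P_iff.1 h))
  have h2 : n * (n⁻¹ * c * n) = c * n := by group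
  rw [h2, hδ.mul_left c hc] at h1
  exact mul_eq_left.1 h1.symm

/-- The elements n⁻¹ c s_j and n⁻¹ s_j lie in the same Bruhat cell. Comparing them produces h = n c₁
n⁻¹, which lies in P_I and hence, by `conj_mem_B` for n⁻¹, in B. -/
lemma exists_conj_mul_gen {I : Set ι} {n : G} (hn : IsLeftMin s I (δ n)) {j : ι} (hj : j ∈ I)
    {c : G} (hc : c ∈ D.B) :
    ∃ h ∈ D.B, n⁻¹ * h * n ∈ D.B ∧ ∃ c' ∈ D.B, c * D.s j = h * D.s j * c' := by
  have h1 : ∀ i ∈ I, ℓ (δ n⁻¹) < ℓ (δ n⁻¹ * s i) := fun i hi => by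
    rw [hδ.inv, ← hδ.inv_gen i, ← mul_inv_rev, hδ.len_inv, hδ.len_inv]
    exact hn i hi
  have h2 : δ (c * D.s j) = s j := by rw [hδ.mul_left c hc, hδ.apply_s]
  have h3 := hδ.mul_gen_of_le (h := n⁻¹) h2 (h1 j hj).le
  rw [← hδ.mul_gen_of_le (h := n⁻¹) (hδ.apply_s j) (h1 j hj).le] at h3
  obtain ⟨c₁, hc₁, c₂, hc₂, h4⟩ := hδ.exists_eq _ _ h3
  have h5 : c * D.s j = n * c₁ * n⁻¹ * D.s j * c₂ := by
    calc c * D.s j = n * (n⁻¹ * (c * D.s j)) := by group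
      _ = _ := by rw [h4]; group
  have h6 : (n⁻¹)⁻¹ * c₁ * n⁻¹ ∈ D.P I := by
    have h7 : (n⁻¹)⁻¹ * c₁ * n⁻¹ = c * D.s j * c₂⁻¹ * (D.s j)⁻¹ := by rw [h5]; group
    rw [h7]
    exact mul_mem (mul_mem (mul_mem (D.B_le_P I hc) (D.s_mem_P hj))
      (inv_mem (D.B_le_P I hc₂))) (inv_mem (D.s_mem_P hj))
  have h8 := hδ.conj_mem_B h1 hc₁ h6
  rw [inv_inv] at h8
  refine ⟨n * c₁ * n⁻¹, h8, ?_, c₂, hc₂, h5⟩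
  have : n⁻¹ * (n * c₁ * n⁻¹) * n = c₁ := by group
  rwa [this]

section Levi

variable {I : Finset ι} {m w : G} (hm : m ∈ D.N) (hw : w ∈ D.N)
  (ha : IsLongestIn s (I : Set ι) (δ m)) (hb : IsLongestIn s Set.univ (δ w))
  {e : {i // i ∈ I} → ι} (he : ∀ i : {i // i ∈ I}, s i * (δ m * δ w) = δ m * δ w * s (e i))

include hm hw he

lemma conj_mem_genBy {J : Set {i // i ∈ I}} {u : W} (hu : u ∈ genBy s (Subtype.val '' J)) :
    (δ (m * w))⁻¹ * u * δ (m * w) ∈ genBy s (e '' J) := by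
  suffices h : genBy s (Subtype.val '' J) ≤
      (genBy s (e '' J)).comap (MulAut.conj (δ (m * w))⁻¹).toMonoidHom by
    simpa using h hu
  refine (Subgroup.closure_le _).2 ?_
  rintro _ ⟨_, ⟨i, hi, rfl⟩, rfl⟩
  have h1 : (δ (m * w))⁻¹ * s i * δ (m * w) = s (e i) := by
    rw [hδ.mul_N m hm w hw, mul_assoc, he, inv_mul_cancel_left]
  simpa [h1] using gen_mem_genBy s (Set.mem_image_of_mem e hi)

lemma mem_genBy_of_conj {J : Set {i // i ∈ I}} {v : W} (hv : v ∈ genBy s (e '' J)) :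
    δ (m * w) * v * (δ (m * w))⁻¹ ∈ genBy s (Subtype.val '' J) := by
  suffices h : genBy s (e '' J) ≤
      (genBy s (Subtype.val '' J)).comap (MulAut.conj (δ (m * w))).toMonoidHom by
    simpa using h hv
  refine (Subgroup.closure_le _).2 ?_
  rintro _ ⟨_, ⟨i, hi, rfl⟩, rfl⟩
  have h1 : δ (m * w) * s (e i) * (δ (m * w))⁻¹ = s i := by
    rw [hδ.mul_N m hm w hw, ← he, mul_inv_cancel_right]
  simpa [h1] using gen_mem_genBy s (Set.mem_image_of_mem Subtype.val hi)

lemma conj_s_mem_P {J : Set {i // i ∈ I}} {i : {i // i ∈ I}} (hi : i ∈ J) :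
    (m * w)⁻¹ * D.s i * (m * w) ∈ D.P (e '' J) := by
  rw [hδ.mem_P_iff, hδ.mul_N _ (mul_mem (inv_mem (mul_mem hm hw)) (hδ.gen_mem i)) _ (mul_mem hm hw),
    hδ.mul_N _ (inv_mem (mul_mem hm hw)) _ (hδ.gen_mem i), hδ.inv, hδ.apply_s]
  exact hδ.conj_mem_genBy hm hw he (gen_mem_genBy s (Set.mem_image_of_mem Subtype.val hi))

include ha hb

/-- With `mem_Pminus_of_conj_mem_P`, this says that the opposite parabolic P_I⁻ is the conjugate of
P_{e(I)} by d = w_I w_S. The point is that w_S d = d⁻¹ w_I d lies in W_{e(I)}. -/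
lemma conj_mem_P_of_mem_Pminus {g : G} (hg : g ∈ D.Pminus (I : Set ι)) :
    (m * w)⁻¹ * g * (m * w) ∈ D.P (Set.range e) := by
  refine inv_conj_mem_of_mem_closure ?_ hg
  rintro g (⟨x, hx, hg⟩ | ⟨i, hi, rfl⟩)
  · obtain ⟨hxN, hx⟩ := hδ.isLongest_iff.1 hx
    have h1 : δ x = δ w := hδ.longest_unique hx hb
    have h2 : x * (m * w) ∈ D.P (Set.range e) := by
      rw [hδ.mem_P_iff, hδ.mul_N x hxN _ (mul_mem hm hw), h1]
      have h3 : δ m ∈ genBy s (Subtype.val '' (Set.univ : Set {i // i ∈ I})) := by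
        simpa using ha.1
      have h4 := hδ.conj_mem_genBy hm hw he h3
      rw [Set.image_univ, hδ.mul_N m hm w hw] at h4
      have h5 : (δ m * δ w)⁻¹ * δ m * (δ m * δ w) = δ w * (δ m * δ w) := by
        rw [mul_inv_rev, inv_mul_cancel_right, inv_eq_of_mul_eq_one_left (hδ.longest_sq hb)]
      rwa [hδ.mul_N m hm w hw, ← h5]
    have h6 : (m * w)⁻¹ * g * (m * w) = (x * (m * w))⁻¹ * (x * g * x⁻¹) * (x * (m * w)) := by group
    have h7 := mul_mem (mul_mem (inv_mem h2) (D.B_le_P (Set.range e) hg)) h2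
    rwa [← h6] at h7
  · have := hδ.conj_s_mem_P hm hw he (J := Set.univ) (i := ⟨i, hi⟩) trivial
    rwa [Set.image_univ] at this

lemma mem_Pminus_of_conj_mem_P {g : G} (hg : (m * w)⁻¹ * g * (m * w) ∈ D.P (Set.range e)) :
    g ∈ D.Pminus (I : Set ι) := by
  suffices h : m * w * ((m * w)⁻¹ * g * (m * w)) * (m * w)⁻¹ ∈ D.Pminus (I : Set ι) by
    have h1 : m * w * ((m * w)⁻¹ * g * (m * w)) * (m * w)⁻¹ = g := by group
    rwa [h1] at h
  have hT : D.T ≤ D.Pminus (I : Set ι) := fun t ht => by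
    refine Subgroup.subset_closure (Or.inl ⟨w, hδ.isLongest_iff.2 ⟨hw, hb⟩, ?_⟩)
    rw [← hδ.eq_one_iff, hδ.mul_N _ (mul_mem hw ht.2) _ (inv_mem hw), hδ.mul_N w hw t ht.2,
      hδ.T_eq_one ht, hδ.inv, mul_one, mul_inv_cancel]
  have hS : ∀ i ∈ I, D.s i ∈ D.Pminus (I : Set ι) := fun i hi =>
    Subgroup.subset_closure (Or.inr ⟨i, hi, rfl⟩)
  refine conj_mem_of_mem_closure ?_ hg
  rintro x (hx | ⟨_, ⟨i, rfl⟩, rfl⟩)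
  · have h1 : m ∈ D.Pminus (I : Set ι) := by
      have h2 : D.NI (I : Set ι) ≤ D.Pminus (I : Set ι) := (Subgroup.closure_le _).2
        (Set.union_subset hT (by rintro _ ⟨i, hi, rfl⟩; exact hS i hi))
      exact h2 (hδ.mem_NI_iff.2 ⟨hm, ha.1⟩)
    have h3 : w * x * w⁻¹ ∈ D.Pminus (I : Set ι) := by
      -- The definition of B⁻ allows every representative of the longest element, and w⁻¹ is one of
      -- them.
      refine Subgroup.subset_closure (Or.inl ⟨w⁻¹, hδ.isLongest_iff.2 ⟨inv_mem hw, ?_⟩, ?_⟩)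
      · rw [hδ.inv]
        exact hδ.longest_inv hb
      · have : w⁻¹ * (w * x * w⁻¹) * w⁻¹⁻¹ = x := by group
        rwa [this]
    have h4 := mul_mem (mul_mem h1 h3) (inv_mem h1)
    have h5 : m * (w * x * w⁻¹) * m⁻¹ = m * w * x * (m * w)⁻¹ := by group
    rwa [h5] at h4
  · have hN := mul_mem (mul_mem (mul_mem hm hw) (hδ.gen_mem (e i))) (inv_mem (mul_mem hm hw))
    have h1 : δ (m * w * D.s (e i) * (m * w)⁻¹) = s i := by
      rw [hδ.mul_N _ (mul_mem (mul_mem hm hw) (hδ.gen_mem _)) _ (inv_mem (mul_mem hm hw)),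
        hδ.mul_N _ (mul_mem hm hw) _ (hδ.gen_mem _), hδ.inv, hδ.apply_s, hδ.mul_N m hm w hw, ← he,
        mul_inv_cancel_right]
    have h2 : (D.s i)⁻¹ * (m * w * D.s (e i) * (m * w)⁻¹) ∈ D.T := by
      have h3 := mul_mem (inv_mem (hδ.gen_mem (i : ι))) hN
      refine Subgroup.mem_inf.2 ⟨?_, h3⟩
      rw [← hδ.eq_one_iff, hδ.mul_N _ (inv_mem (hδ.gen_mem _)) _ hN, h1, hδ.inv, hδ.apply_s,
        inv_mul_cancel]
    have h4 := mul_mem (hS i i.2) (hT h2)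
    rwa [mul_inv_cancel_left] at h4

lemma ascent_conj (i : {i // i ∈ I}) : ℓ (δ (m * w)) < ℓ (δ (m * w) * s (e i)) := by
  rw [hδ.mul_N m hm w hw]
  exact hδ.ascent_longest (I := (I : Set ι)) (e := e) ha hb he i

lemma mem_L_of_conj_mem_B {c : G} (hc : c ∈ D.B) (h : (m * w)⁻¹ * c * (m * w) ∈ D.B) :
    c ∈ D.L (I : Set ι) :=
  Subgroup.mem_inf.2 ⟨D.B_le_P _ hc, hδ.mem_Pminus_of_conj_mem_P hm hw ha hb he (D.B_le_P _ h)⟩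

/-- It suffices to check generators. An element of B ∩ L_I is conjugated into P_{e(I)}, and
`conj_mem_B` then places it in B. -/
lemma conj_mem_P_of_mem_levi_P {J : Set {i // i ∈ I}} {q : D.L (I : Set ι)}
    (hq : q ∈ (D.levi I).P J) : (m * w)⁻¹ * q * (m * w) ∈ D.P (e '' J) := by
  induction hq using Subgroup.closure_induction with
  | mem q hq =>
    rcases hq with hq | ⟨i, hi, rfl⟩
    · have hq : (q : G) ∈ D.B := hq
      have h1 := hδ.conj_mem_P_of_mem_Pminus hm hw ha hb he q.2.2
      have h2 := hδ.conj_mem_B (by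
        rintro _ ⟨i, rfl⟩
        exact hδ.ascent_conj hm hw ha hb he i) hq h1
      exact D.B_le_P (e '' J) h2
    · exact hδ.conj_s_mem_P hm hw he hi
  | one => simp
  | mul x y _ _ hx hy =>
    have := mul_mem hx hy
    have h1 : (m * w)⁻¹ * x * (m * w) * ((m * w)⁻¹ * y * (m * w)) =
      (m * w)⁻¹ * (x * y : D.L (I : Set ι)) * (m * w) := by push_cast; group
    rwa [h1] at this
  | inv x _ hx =>
    have := inv_mem hx
    have h1 : ((m * w)⁻¹ * x * (m * w))⁻¹ =
      (m * w)⁻¹ * (x⁻¹ : D.L (I : Set ι)) * (m * w) := by push_cast; group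
    rwa [h1] at this

/-- The two length-additive factorisations q d = d (d⁻¹qd) show that δ(q) lies in W_J. A word of
δ(q) is then stripped off using only elements of the Levi parabolic, and the remaining factor lies
in B ∩ dBd⁻¹, which is contained in L_I. -/
lemma mem_levi_P_of_conj_mem_P {J : Set {i // i ∈ I}} {q : G} (hq : q ∈ D.P (I : Set ι))
    (h : (m * w)⁻¹ * q * (m * w) ∈ D.P (e '' J)) :
    q ∈ ((D.levi I).P J).map (D.L (I : Set ι)).subtype := by
  have hB : ∀ c ∈ D.B, (m * w)⁻¹ * c * (m * w) ∈ D.B →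
      c ∈ ((D.levi I).P J).map (D.L (I : Set ι)).subtype := fun c hc hc' =>
    ⟨⟨c, hδ.mem_L_of_conj_mem_B hm hw ha hb he hc hc'⟩, Subgroup.subset_closure (Or.inl hc), rfl⟩
  have hS : ∀ i ∈ J, D.s i ∈ ((D.levi I).P J).map (D.L (I : Set ι)).subtype := fun i hi =>
    ⟨(D.levi I).s i, (D.levi I).s_mem_P hi, rfl⟩
  have hd : IsLeftMin s (I : Set ι) (δ (m * w)) := by
    rw [hδ.mul_N m hm w hw]
    exact hδ.isLeftMin_longest ha hb
  have key : ∀ l : List ι, (∀ j ∈ l, j ∈ Subtype.val '' J) → ∀ g, δ g = wordProd s l →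
      ∃ x ∈ ((D.levi I).P J).map (D.L (I : Set ι)).subtype, x⁻¹ * g ∈ D.B := by
    intro l
    induction l with
    | nil => exact fun _ g hg => ⟨1, one_mem _, by simpa using (hδ.eq_one_iff g).1 hg⟩
    | cons j l ih =>
      intro hl g hg
      obtain ⟨j, hj, rfl⟩ := hl j (by simp)
      rw [wordProd_cons] at hg
      obtain ⟨g₁, g₂, rfl, h1, h2⟩ := hδ.exists_mul_eq hg
      obtain ⟨c, hc, c', hc', rfl⟩ := hδ.exists_eq g₁ (D.s j) (by rw [h1, hδ.apply_s])
      -- The left factor c ∈ B need not lie in L_I, so it is first replaced by an element of B ∩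
      -- dBd⁻¹ at the cost of a factor of B on the right.
      obtain ⟨x, hx, hx', c'', hc'', h3⟩ := hδ.exists_conj_mul_gen hd (Finset.mem_coe.2 j.2) hc
      obtain ⟨y, hy, h4⟩ := ih (fun i hi => hl i (by simp [hi])) (c'' * c' * g₂)
        (by rw [hδ.mul_left _ (mul_mem hc'' hc'), h2])
      refine ⟨x * D.s j * y, mul_mem (mul_mem (hB x hx hx') (hS j hj)) hy, ?_⟩
      rw [h3]
      have : (x * D.s j * y)⁻¹ * (x * D.s j * c'' * c' * g₂) = y⁻¹ * (c'' * c' * g₂) := by group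
      rwa [this]
  have h1 := hδ.mul_of_len (g := q) (h := m * w) (by
    rw [hδ.mul_N m hm w hw]
    exact hδ.len_mul_longest ha hb (hδ.mem_P_iff.1 hq))
  have h2 := hδ.mul_of_len (g := m * w) (h := (m * w)⁻¹ * q * (m * w))
    (hδ.len_mul_of_right (J := e '' J) (by
      rintro _ ⟨i, -, rfl⟩
      exact hδ.ascent_conj hm hw ha hb he i) (hδ.mem_P_iff.1 h))
  have h3 : m * w * ((m * w)⁻¹ * q * (m * w)) = q * (m * w) := by group
  rw [h3, h1] at h2
  have h4 := hδ.mem_genBy_of_conj hm hw he (hδ.mem_P_iff.1 h)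
  rw [← h2, mul_inv_cancel_right] at h4
  obtain ⟨l, hl, -, h5⟩ := hδ.exists_word_genBy h4
  obtain ⟨x, hx, h6⟩ := key l hl q h5.symm
  obtain ⟨y, hy, rfl⟩ := id hx
  have h7 := hδ.conj_mem_P_of_mem_levi_P hm hw ha hb he hy
  have h8 : (m * w)⁻¹ * (((D.L (I : Set ι)).subtype y)⁻¹ * q) * (m * w) =
    ((m * w)⁻¹ * y * (m * w))⁻¹ * ((m * w)⁻¹ * q * (m * w)) := by
    simp only [Subgroup.subtype_apply]; group
  have h9 := hδ.conj_mem_B (K := e '' J) (by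
    rintro _ ⟨i, -, rfl⟩
    exact hδ.ascent_conj hm hw ha hb he i) h6 (by rw [h8]; exact mul_mem (inv_mem h7) h)
  have := mul_mem hx (hB _ h6 h9)
  rwa [mul_inv_cancel_left] at this

end Levi

end IsBruhat
end BNData
end Bruhat

/-! ### Functoriality of the complex of a coefficient system -/

section CoefficientSystem

universe v u w w' v' u'

variable {ι : Type w} [Fintype ι] [LinearOrder ι]
variable {C : Type u} [Category.{v} C] [Preadditive C] [HasFiniteBiproducts C]

namespace CoeffSystem

/-- The inclusion of the summand `M^I`. -/
abbrev incl (M : CoeffSystem ι C) {i : ℤ} (I : Level ι i) : M.obj I.1 ⟶ X M i :=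
  biproduct.ι (fun I : Level ι i => M.obj I.1) I

/-- The projection to the summand `M^I`. -/
abbrev proj (M : CoeffSystem ι C) {i : ℤ} (I : Level ι i) : X M i ⟶ M.obj I.1 :=
  biproduct.π (fun I : Level ι i => M.obj I.1) I

omit [LinearOrder ι] in
lemma X_hom_ext {M : CoeffSystem ι C} {i : ℤ} {A : C} {f g : X M i ⟶ A}
    (h : ∀ I : Level ι i, incl M I ≫ f = incl M I ≫ g) : f = g := biproduct.hom_ext' _ _ h

omit [LinearOrder ι] in
lemma incl_proj_self (M : CoeffSystem ι C) {i : ℤ} (I : Level ι i) :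
    incl M I ≫ proj M I = 𝟙 _ := by
  rw [biproduct.ι_π_self]

omit [LinearOrder ι] in
lemma incl_proj_ne (M : CoeffSystem ι C) {i : ℤ} {I J : Level ι i} (h : I ≠ J) :
    incl M I ≫ proj M J = 0 := by
  rw [biproduct.ι_π_ne _ h]

omit [LinearOrder ι] in
lemma sum_proj_incl (M : CoeffSystem ι C) (i : ℤ) :
    ∑ I : Level ι i, proj M I ≫ incl M I = 𝟙 (X M i) := by
  classical
  refine X_hom_ext fun I => ?_
  rw [Preadditive.comp_sum, Finset.sum_eq_single I]
  · rw [← Category.assoc, incl_proj_self, Category.id_comp, Category.comp_id]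
  · intro J _ h
    rw [← Category.assoc, incl_proj_ne M h.symm, zero_comp]
  · simp

omit [LinearOrder ι] in
lemma lift_desc (M : CoeffSystem ι C) {i : ℤ} {A B : C} (f : ∀ I : Level ι i, A ⟶ M.obj I.1)
    (g : ∀ I : Level ι i, M.obj I.1 ⟶ B) :
    (biproduct.lift f : A ⟶ X M i) ≫ (biproduct.desc g : X M i ⟶ B) = ∑ I, f I ≫ g I := by
  rw [← Category.id_comp (biproduct.desc g), ← sum_proj_incl M i, Preadditive.sum_comp,
    Preadditive.comp_sum]
  simp

lemma incl_d (M : CoeffSystem ι C) {i : ℤ} (I : Level ι i) :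
    incl M I ≫ d M i = ∑ s : {s : ι // s ∉ I.1},
      ((-1 : ℤ) ^ below I.1 s.1) • (M.map (homOfLE (Finset.subset_insert s.1 I.1)) ≫
        incl M ⟨insert s.1 I.1, card_insert_level I s.2⟩) := by
  rw [d, biproduct.ι_desc]

lemma complex_d (M : CoeffSystem ι C) (i : ℤ) : M.complex.d i (i + 1) = d M i := by
  unfold complex
  exact CochainComplex.of_d _ _ _

/-- A map out of the complex of a coefficient system, given by its components. -/
def homMk (M : CoeffSystem ι C) (K : CochainComplex C ℤ) (f : ∀ i, X M i ⟶ K.X i)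
    (h : ∀ i, f i ≫ K.d i (i + 1) = d M i ≫ f (i + 1)) : M.complex ⟶ K where
  f := f
  comm' i j hij := by
    obtain rfl : i + 1 = j := hij
    rw [complex_d]
    exact h i

/-- The components of the map of complexes associated with a map of coefficient systems. -/
def mapX {M N : CoeffSystem ι C} (φ : M ⟶ N) (i : ℤ) : X M i ⟶ X N i :=
  biproduct.map fun I => φ.app I.1

omit [LinearOrder ι] in
lemma incl_mapX {M N : CoeffSystem ι C} (φ : M ⟶ N) {i : ℤ} (I : Level ι i) :
    incl M I ≫ mapX φ i = φ.app I.1 ≫ incl N I := by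
  rw [mapX, biproduct.ι_map]

lemma mapX_d {M N : CoeffSystem ι C} (φ : M ⟶ N) (i : ℤ) :
    mapX φ i ≫ d N i = d M i ≫ mapX φ (i + 1) := by
  refine X_hom_ext fun I => ?_
  rw [← Category.assoc, incl_mapX, Category.assoc, incl_d, ← Category.assoc, incl_d,
    Preadditive.comp_sum, Preadditive.sum_comp]
  refine Finset.sum_congr rfl fun s _ => ?_
  rw [Preadditive.comp_zsmul, Preadditive.zsmul_comp, Category.assoc, incl_mapX,
    φ.naturality_assoc]

/-- The map of complexes associated with a map of coefficient systems. -/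
def mapComplex {M N : CoeffSystem ι C} (φ : M ⟶ N) : M.complex ⟶ N.complex :=
  homMk M _ (mapX φ) fun i => by
    rw [complex_d]
    exact mapX_d φ i

omit [LinearOrder ι] in
lemma mapX_comp {M N K : CoeffSystem ι C} (φ : M ⟶ N) (ψ : N ⟶ K) (i : ℤ) :
    mapX (φ ≫ ψ) i = mapX φ i ≫ mapX ψ i :=
  X_hom_ext fun I => by simp [mapX]

omit [LinearOrder ι] in
lemma mapX_zero (M N : CoeffSystem ι C) (i : ℤ) : mapX (0 : M ⟶ N) i = 0 :=
  X_hom_ext fun I => by simp [mapX]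

omit [LinearOrder ι] in
lemma mapX_id (M : CoeffSystem ι C) (i : ℤ) : mapX (𝟙 M) i = 𝟙 _ :=
  X_hom_ext fun I => by simp [mapX]

/-- Isomorphic coefficient systems have isomorphic complexes. -/
def complexIso {M N : CoeffSystem ι C} (α : M ≅ N) : M.complex ≅ N.complex where
  hom := mapComplex α.hom
  inv := mapComplex α.inv
  hom_inv_id := HomologicalComplex.hom_ext _ _ fun i =>
    (mapX_comp α.hom α.inv i).symm.trans (by rw [α.hom_inv_id]; exact mapX_id M i)
  inv_hom_id := HomologicalComplex.hom_ext _ _ fun i =>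
    (mapX_comp α.inv α.hom i).symm.trans (by rw [α.inv_hom_id]; exact mapX_id N i)

/-- The short complex of complexes given by a short complex of coefficient systems. -/
def shortComplex {M N K : CoeffSystem ι C} (φ : M ⟶ N) (ψ : N ⟶ K) (h : φ ≫ ψ = 0) :
    ShortComplex (CochainComplex C ℤ) where
  f := mapComplex φ
  g := mapComplex ψ
  zero := HomologicalComplex.hom_ext _ _ fun i =>
    (mapX_comp φ ψ i).symm.trans (by rw [h]; exact mapX_zero M K i)

/-- A pointwise split exact sequence of coefficient systems gives a degreewise split exact
sequence of complexes. -/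
def splitting {M N K : CoeffSystem ι C} (φ : M ⟶ N) (ψ : N ⟶ K) (h : φ ≫ ψ = 0)
    (r : ∀ I, N.obj I ⟶ M.obj I) (t : ∀ I, K.obj I ⟶ N.obj I)
    (hr : ∀ I, φ.app I ≫ r I = 𝟙 _) (ht : ∀ I, t I ≫ ψ.app I = 𝟙 _)
    (hid : ∀ I, r I ≫ φ.app I + ψ.app I ≫ t I = 𝟙 _) (i : ℤ) :
    ((shortComplex φ ψ h).map (HomologicalComplex.eval C _ i)).Splitting where
  r := (biproduct.map fun I => r I.1 : X N i ⟶ X M i)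
  s := (biproduct.map fun I => t I.1 : X K i ⟶ X N i)
  f_r := by
    change mapX φ i ≫ (biproduct.map fun I => r I.1 : X N i ⟶ X M i) = 𝟙 (X M i)
    exact X_hom_ext fun I => by simp [mapX, reassoc_of% hr]
  s_g := by
    change (biproduct.map fun I => t I.1 : X K i ⟶ X N i) ≫ mapX ψ i = 𝟙 (X K i)
    exact X_hom_ext fun I => by simp [mapX, reassoc_of% ht]
  id := by
    change (biproduct.map fun I => r I.1 : X N i ⟶ X M i) ≫ mapX φ i +
      mapX ψ i ≫ (biproduct.map fun I => t I.1 : X K i ⟶ X N i) = 𝟙 (X N i)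
    refine X_hom_ext fun I => ?_
    have := congrArg (· ≫ incl N I) (hid I.1)
    simpa [mapX, Preadditive.add_comp] using this

open HomotopyCategory in
/-- In the homotopy category, the quotient by a contractible pointwise split subsystem is an
isomorphism. -/
lemma isIso_quotient_map_of_isZero [HasZeroObject C] {M N K : CoeffSystem ι C} (φ : M ⟶ N)
    (ψ : N ⟶ K) (h : φ ≫ ψ = 0)
    (r : ∀ I, N.obj I ⟶ M.obj I) (t : ∀ I, K.obj I ⟶ N.obj I)
    (hr : ∀ I, φ.app I ≫ r I = 𝟙 _) (ht : ∀ I, t I ≫ ψ.app I = 𝟙 _)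
    (hid : ∀ I, r I ≫ φ.app I + ψ.app I ≫ t I = 𝟙 _)
    (hM : IsZero ((quotient C (ComplexShape.up ℤ)).obj M.complex)) :
    IsIso ((quotient C (ComplexShape.up ℤ)).map (mapComplex ψ)) := by
  have : HasBinaryBiproducts C := hasBinaryBiproducts_of_finite_biproducts C
  -- A degreewise split sequence gives a distinguished triangle. Its second map is an isomorphism
  -- when its first object vanishes.
  have hT := (distinguished_iff_iso_trianglehOfDegreewiseSplit _).2
    ⟨shortComplex φ ψ h, splitting φ ψ h r t hr ht hid, ⟨Iso.refl _⟩⟩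
  exact (Pretriangulated.Triangle.isZero₁_iff_isIso₂ _ hT).1 hM

section Additive

variable {D : Type u'} [Category.{v'} D] [Preadditive D] [HasFiniteBiproducts D]
  (F : C ⥤ D) [F.Additive] (M : CoeffSystem ι C)

/-- The coefficient system obtained by applying a functor. -/
abbrev whisker : CoeffSystem ι D := M ⋙ F

lemma map_incl_lift {i : ℤ} (I : Level ι i) :
    F.map (incl M I) ≫ biproduct.lift (fun J : Level ι i => F.map (proj M J)) =
      incl (whisker F M) I := by
  refine biproduct.hom_ext _ _ fun J => ?_
  rw [Category.assoc, biproduct.lift_π, ← F.map_comp]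
  by_cases h : I = J
  · subst h
    rw [biproduct.ι_π_self, F.map_id]
    exact (incl_proj_self (whisker F M) I).symm
  · rw [biproduct.ι_π_ne _ h, F.map_zero]
    exact (incl_proj_ne (whisker F M) h).symm

/-- An additive functor commutes with the terms of the complex of a coefficient system. -/
def mapXIso (i : ℤ) : X (whisker F M) i ≅ F.obj (X M i) where
  hom := biproduct.desc fun I => F.map (incl M I)
  inv := biproduct.lift fun I => F.map (proj M I)
  hom_inv_id := X_hom_ext fun I => by
    rw [← Category.assoc, Category.comp_id]
    refine Eq.trans ?_ (map_incl_lift F M I)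
    exact congrArg (· ≫ _) (biproduct.ι_desc _ _)
  inv_hom_id := by
    refine (lift_desc (whisker F M) _ _).trans ?_
    simp only [← F.map_comp, ← F.map_sum]
    rw [sum_proj_incl, F.map_id]

lemma incl_mapXIso {i : ℤ} (I : Level ι i) :
    incl (whisker F M) I ≫ (mapXIso F M i).hom = F.map (incl M I) := biproduct.ι_desc _ _

lemma mapXIso_d (i : ℤ) : (mapXIso F M i).hom ≫ F.map (d M i) =
    d (whisker F M) i ≫ (mapXIso F M (i + 1)).hom := by
  refine X_hom_ext fun I => ?_
  rw [← Category.assoc, incl_mapXIso, ← Category.assoc, incl_d, ← F.map_comp, incl_d,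
    Preadditive.sum_comp, F.map_sum]
  refine Finset.sum_congr rfl fun s _ => ?_
  rw [Preadditive.zsmul_comp, Category.assoc, incl_mapXIso, F.map_zsmul, F.map_comp]
  rfl

/-- An additive functor commutes with the formation of the complex of a coefficient system. -/
def mapComplexIso : (whisker F M).complex ≅
    (F.mapHomologicalComplex (ComplexShape.up ℤ)).obj M.complex :=
  HomologicalComplex.Hom.isoOfComponents (fun i => mapXIso F M i) (by
    intro i j hij
    obtain rfl : i + 1 = j := hij
    rw [complex_d, Functor.mapHomologicalComplex_obj_d, complex_d]
    exact mapXIso_d F M i)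

end Additive

end CoeffSystem
end CoefficientSystem

/-! ### Contraction of a coefficient system along one index -/

section CoefficientSystem

universe v u w w' v' u'

variable {ι : Type w} [Fintype ι] [LinearOrder ι]
variable {C : Type u} [Category.{v} C] [Preadditive C] [HasFiniteBiproducts C]

namespace CoeffSystem

lemma sum_notMem_insert {ι : Type*} [Fintype ι] [DecidableEq ι] {A : Type*} [AddCommMonoid A]
    {J : Finset ι} {a : ι} (ha : a ∉ J) (g : {t : ι // t ∉ J} → A) :
    ∑ t, g t = g ⟨a, ha⟩ + ∑ t : {t : ι // t ∉ insert a J},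
      g ⟨t.1, fun h => t.2 (Finset.mem_insert_of_mem h)⟩ := by
  rw [Fintype.sum_eq_add_sum_subtype_ne g ⟨a, ha⟩]
  congr 1
  refine Fintype.sum_equiv
    { toFun := fun t => ⟨t.1.1, fun h => (Finset.mem_insert.1 h).elim
        (fun e => t.2 (Subtype.ext e)) t.1.2⟩
      invFun := fun t => ⟨⟨t.1, fun h => t.2 (Finset.mem_insert_of_mem h)⟩,
        fun h => t.2 (Finset.mem_insert.2 (Or.inl (congrArg Subtype.val h)))⟩
      left_inv := fun _ => rfl
      right_inv := fun _ => rfl } _ _ fun _ => rfl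

omit [LinearOrder ι] in
lemma incl_congr (M : CoeffSystem ι C) {j : ℤ} {J J' : Finset ι} (hJ : J = J')
    (c : (J.card : ℤ) = j) (c' : (J'.card : ℤ) = j) :
    incl M ⟨J, c⟩ = M.map (homOfLE hJ.le) ≫ incl M ⟨J', c'⟩ := by
  subst hJ
  exact (Category.id_comp _).symm.trans (congrArg (· ≫ _) (M.map_id J).symm)

lemma sign_cancel_insert (J : Finset ι) {s t : ι} (hs : s ∉ J) (ht : t ∉ J) (hst : s ≠ t) :
    (-1 : ℤ) ^ below (insert s J) t * (-1) ^ below (insert t J) s +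
      (-1) ^ below J s * (-1) ^ below J t = 0 := by
  rw [below_insert J t hs, below_insert J s ht]
  rcases lt_or_gt_of_ne hst with h | h <;>
  · simp only [h, not_lt_of_gt h, if_true, if_false, pow_add]
    ring

section Contract

variable (M : CoeffSystem ι C) (a : ι)
  (hM : ∀ {J K : Finset ι} (h : J ≤ K), a ∉ J → K ⊆ insert a J → IsIso (M.map (homOfLE h)))

omit [Fintype ι] [Preadditive C] [HasFiniteBiproducts C] in
include hM in
lemma isIso_map_erase (I : Finset ι) : IsIso (M.map (homOfLE (Finset.erase_subset a I))) :=
  hM _ (Finset.notMem_erase _ _) (Finset.insert_erase_subset _ _)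

omit [Fintype ι] in
lemma card_erase_level {j : ℤ} (I : Level ι (j + 1)) (h : a ∈ I.1) :
    ((I.1.erase a).card : ℤ) = j := by
  have h1 := Finset.card_erase_add_one h
  have h2 := I.2
  omega

/-- The contracting homotopy of the complex of `M` given by inverting the maps
`M^I ⟶ M^{I ∪ {a}}`. -/
def contract (j : ℤ) : X M (j + 1) ⟶ X M j :=
  biproduct.desc fun I : Level ι (j + 1) =>
    haveI := isIso_map_erase M a hM I.1
    if h : a ∈ I.1 then (-1 : ℤ) ^ below (I.1.erase a) a •
      (inv (M.map (homOfLE (Finset.erase_subset a I.1))) ≫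
        incl M ⟨I.1.erase a, card_erase_level a I h⟩)
    else 0

lemma incl_contract_of_notMem {j : ℤ} (I : Level ι (j + 1)) (h : a ∉ I.1) :
    incl M I ≫ contract M a hM j = 0 := by
  rw [contract, biproduct.ι_desc, dif_neg h]

lemma map_incl_contract {j : ℤ} {J I : Finset ι} (hJ : (J.card : ℤ) = j)
    (hI : (I.card : ℤ) = j + 1) (ha : a ∉ J) (h : J ≤ I) (e : I = insert a J) :
    M.map (homOfLE h) ≫ incl M ⟨I, hI⟩ ≫ contract M a hM j =
      (-1 : ℤ) ^ below J a • incl M ⟨J, hJ⟩ := by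
  subst e
  have h1 := isIso_map_erase M a hM (insert a J)
  have h2 := Finset.erase_insert ha
  rw [contract, biproduct.ι_desc, dif_pos (Finset.mem_insert_self a J), Preadditive.comp_zsmul]
  dsimp only
  have h3 : M.map (homOfLE h) = M.map (homOfLE h2.ge) ≫
      M.map (homOfLE (Finset.erase_subset a (insert a J))) := by
    rw [← M.map_comp]
    rfl
  rw [h3, Category.assoc, IsIso.hom_inv_id_assoc, ← incl_congr M h2.symm hJ, h2]

/-- The complex is the cone of the isomorphisms from the part without a to the part with a. On M^I
with a ∉ I only the summand s = a of the differential survives. On M^I with a ∈ I the remaining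
terms cancel in pairs by the anticommutation of signs. -/
lemma d_contract (j : ℤ) :
    d M (j + 1) ≫ contract M a hM (j + 1) + contract M a hM j ≫ d M j = 𝟙 _ := by
  refine X_hom_ext fun I => ?_
  rw [Preadditive.comp_add, Category.comp_id, ← Category.assoc, ← Category.assoc]
  obtain ⟨I, hI⟩ := I
  by_cases ha : a ∈ I
  · obtain ⟨J, ha', rfl⟩ : ∃ J, a ∉ J ∧ insert a J = I :=
      ⟨I.erase a, Finset.notMem_erase _ _, Finset.insert_erase ha⟩
    have hJ : (J.card : ℤ) = j := by
      rw [Finset.card_insert_of_notMem ha'] at hI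
      push_cast at hI
      omega
    have hJI : J ≤ insert a J := Finset.subset_insert a J
    have := hM hJI ha' subset_rfl
    -- Precomposing with the isomorphism M^J ⟶ M^{J ∪ {a}} removes the inverses from the homotopy.
    rw [← cancel_epi (M.map (homOfLE hJI)), Preadditive.comp_add]
    have e1 : M.map (homOfLE hJI) ≫ (incl M ⟨insert a J, hI⟩ ≫ contract M a hM j) ≫ d M j =
        (-1 : ℤ) ^ below J a • ∑ s : {s : ι // s ∉ J}, ((-1 : ℤ) ^ below J s.1) •
          (M.map (homOfLE (Finset.subset_insert s.1 J)) ≫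
            incl M ⟨insert s.1 J, card_insert_level ⟨J, hJ⟩ s.2⟩) := by
      rw [← Category.assoc, map_incl_contract M a hM hJ hI ha' hJI rfl, Preadditive.zsmul_comp,
        incl_d]
    have e2 : M.map (homOfLE hJI) ≫ (incl M ⟨insert a J, hI⟩ ≫ d M (j + 1)) ≫
        contract M a hM (j + 1) = ∑ t : {t : ι // t ∉ insert a J},
          ((-1 : ℤ) ^ below (insert a J) t.1 * (-1) ^ below (insert t.1 J) a) •
          (M.map (homOfLE (Finset.subset_insert t.1 J)) ≫ incl M ⟨insert t.1 J,
            card_insert_level ⟨J, hJ⟩ fun h => t.2 (Finset.mem_insert_of_mem h)⟩) := by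
      rw [incl_d, Preadditive.sum_comp, Preadditive.comp_sum]
      refine Finset.sum_congr rfl fun t _ => ?_
      have ht := t.2
      rw [Finset.mem_insert, not_or] at ht
      have h1 : insert t.1 J ≤ insert t.1 (insert a J) := Finset.insert_subset_insert _ hJI
      have h2 := map_incl_contract M a hM (J := insert t.1 J) (I := insert t.1 (insert a J))
        (j := j + 1) (card_insert_level ⟨J, hJ⟩ ht.2)
        (card_insert_level ⟨insert a J, hI⟩ t.2)
        (by rw [Finset.mem_insert, not_or]; exact ⟨fun e => ht.1 e.symm, ha'⟩) h1
        (Finset.insert_comm _ _ _)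
      have h3 : M.map (homOfLE hJI) ≫ M.map (homOfLE (Finset.subset_insert t.1 (insert a J))) =
          M.map (homOfLE (Finset.subset_insert t.1 J)) ≫ M.map (homOfLE h1) := by
        rw [← M.map_comp, ← M.map_comp]
        rfl
      dsimp only
      rw [Preadditive.zsmul_comp, Preadditive.comp_zsmul, mul_smul, Category.assoc,
        ← Category.assoc, h3, Category.assoc, h2, Preadditive.comp_zsmul]
    rw [e1, e2, sum_notMem_insert ha', smul_add, Finset.smul_sum, add_left_comm,
      ← Finset.sum_add_distrib, Finset.sum_eq_zero, add_zero, smul_smul, ← mul_pow, neg_one_mul,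
      neg_neg, one_pow, one_smul]
    intro t _
    have ht := t.2
    rw [Finset.mem_insert, not_or] at ht
    rw [smul_smul, ← add_smul]
    exact (congrArg (· • _) (sign_cancel_insert J ha' ht.2 (Ne.symm ht.1))).trans (zero_smul _ _)
  · rw [incl_contract_of_notMem M a hM _ ha, zero_comp, add_zero, incl_d, Preadditive.sum_comp]
    rw [Finset.sum_eq_single ⟨a, ha⟩]
    · have := map_incl_contract M a hM (J := I) (I := insert a I) (j := j + 1) hI
        (card_insert_level ⟨I, hI⟩ ha) ha (Finset.subset_insert _ _) rfl
      rw [Preadditive.zsmul_comp, Category.assoc, this, smul_smul, ← mul_pow, neg_one_mul,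
        neg_neg, one_pow, one_smul]
    · rintro ⟨t, ht⟩ - hne
      rw [Preadditive.zsmul_comp, Category.assoc, incl_contract_of_notMem, comp_zero, smul_zero]
      rw [Finset.mem_insert, not_or]
      exact ⟨fun e => hne (Subtype.ext e.symm), ha⟩
    · simp

include hM in
lemma isZero_quotient_complex [HasZeroObject C] :
    IsZero ((HomotopyCategory.quotient C (ComplexShape.up ℤ)).obj M.complex) := by
  rw [HomotopyCategory.isZero_quotient_obj_iff]
  refine ⟨{ hom := fun i j => if h : j + 1 = i then by subst h; exact contract M a hM j else 0
            zero := fun i j h => dif_neg h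
            comm := fun i => ?_ }⟩
  obtain ⟨j, rfl⟩ : ∃ j, i = j + 1 := ⟨i - 1, by ring⟩
  rw [dNext_eq _ (show (ComplexShape.up ℤ).Rel (j + 1) (j + 1 + 1) from rfl),
    prevD_eq _ (show (ComplexShape.up ℤ).Rel j (j + 1) from rfl), dif_pos rfl, dif_pos rfl,
    complex_d, complex_d]
  exact ((add_zero _).trans (d_contract M a hM j)).symm

end Contract

end CoeffSystem
end CoefficientSystem

/-! ### Change of the index set along an injection -/

section Reindex

universe v u w w'

variable {ι : Type w} [Fintype ι] [LinearOrder ι] {κ : Type w'} [Fintype κ] [LinearOrder κ]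
variable {C : Type u} [Category.{v} C] [Preadditive C] [HasFiniteBiproducts C]

namespace CoeffSystem

omit [Fintype κ] in
lemma neg_one_pow_below (J : Finset κ) (t : κ) :
    (-1 : ℤ) ^ below J t = ∏ a ∈ J, if a < t then -1 else 1 := by
  rw [below, Finset.prod_ite, Finset.prod_const, Finset.prod_const_one, mul_one]

/-- The sign of the rearrangement of `J` caused by an injective map `e`. -/
def reindexSign (e : κ ↪ ι) (J : Finset κ) : ℤ :=
  ∏ a ∈ J, ∏ b ∈ J, if a < b ∧ e b < e a then -1 else 1

omit [Fintype ι] [Fintype κ] in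
lemma reindexSign_mul_self (e : κ ↪ ι) (J : Finset κ) :
    reindexSign e J * reindexSign e J = 1 := by
  rw [reindexSign, ← Finset.prod_mul_distrib]
  refine Finset.prod_eq_one fun a _ => ?_
  rw [← Finset.prod_mul_distrib]
  refine Finset.prod_eq_one fun b _ => ?_
  split_ifs <;> rfl

omit [Fintype ι] [Fintype κ] in
-- Modulo 2, the number of a ∈ J with e(a) < e(t) is the number with a < t plus the number of pairs
-- {a, t} whose order e reverses.
lemma reindexSign_insert (e : κ ↪ ι) (J : Finset κ) {t : κ} (ht : t ∉ J) :
    reindexSign e J * (-1) ^ below (J.map e) (e t) =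
      (-1) ^ below J t * reindexSign e (insert t J) := by
  have h : (-1 : ℤ) ^ below (J.map e) (e t) = (∏ a ∈ J, if a < t then -1 else 1) *
      ((∏ b ∈ J, if t < b ∧ e b < e t then -1 else 1) *
        ∏ a ∈ J, if a < t ∧ e t < e a then -1 else 1) := by
    rw [neg_one_pow_below, Finset.prod_map, ← Finset.prod_mul_distrib, ← Finset.prod_mul_distrib]
    refine Finset.prod_congr rfl fun a ha => ?_
    have hne : a ≠ t := fun h => ht (h ▸ ha)
    have hne' : e a ≠ e t := fun h => hne (e.injective h)
    rcases lt_or_gt_of_ne hne with h1 | h1 <;> rcases lt_or_gt_of_ne hne' with h2 | h2 <;>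
    simp [h1, h2, not_lt_of_gt h1, not_lt_of_gt h2]
  rw [h, neg_one_pow_below, reindexSign, reindexSign, Finset.prod_insert ht,
    Finset.prod_insert ht]
  simp only [Finset.prod_insert ht, Finset.prod_mul_distrib, lt_irrefl, false_and, if_false]
  ring

variable {N : CoeffSystem κ C} {M : CoeffSystem ι C} (e : κ ↪ ι)
  (α : ∀ J : Finset κ, N.obj J ≅ M.obj (J.map e))

/-- The image of a subset with `i` elements. -/
abbrev mapLevel {i : ℤ} (J : Level κ i) : Level ι i :=
  ⟨J.1.map e, by rw [Finset.card_map]; exact J.2⟩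

/-- The components of the map of complexes given by a change of index sets. -/
def reindexX (i : ℤ) : X N i ⟶ X M i :=
  biproduct.desc fun J : Level κ i => reindexSign e J.1 •
    ((α J.1).hom ≫ incl M (mapLevel e J))

/-- The inverse of `reindexX`. -/
def reindexXInv (i : ℤ) : X M i ⟶ X N i :=
  biproduct.desc fun I : Level ι i => ∑ J : Level κ i, if h : mapLevel e J = I then
    -- The transition map of an equality of subsets plays the role of the transport from M^I.
    reindexSign e J.1 • ((M.map (homOfLE (congrArg Subtype.val h).ge) : _ ⟶ M.obj (J.1.map e)) ≫
      (α J.1).inv ≫ incl N J) else 0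

omit [Fintype ι] [Fintype κ] [LinearOrder ι] [LinearOrder κ] in
lemma mapLevel_injective (i : ℤ) : Function.Injective (mapLevel (i := i) e) := fun _ _ h =>
  Subtype.ext (Finset.map_injective e (congrArg Subtype.val h))

lemma incl_reindexXInv {i : ℤ} (J : Level κ i) : incl M (mapLevel e J) ≫ reindexXInv e α i =
    reindexSign e J.1 • ((α J.1).inv ≫ incl N J) := by
  rw [reindexXInv, biproduct.ι_desc, Finset.sum_eq_single J, dif_pos rfl]
  · have : M.map (homOfLE (le_refl (J.1.map e))) = 𝟙 _ := M.map_id _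
    exact congrArg (reindexSign e J.1 • ·) ((congrArg (· ≫ _) this).trans (Category.id_comp _))
  · intro K _ h
    exact dif_neg fun h' => h (mapLevel_injective e i h')
  · simp

lemma incl_reindexX {i : ℤ} (J : Level κ i) : incl N J ≫ reindexX e α i = reindexSign e J.1 •
    ((α J.1).hom ≫ incl M (mapLevel e J)) :=
  biproduct.ι_desc _ _

variable (hα : ∀ {J K : Finset κ} (h : J ≤ K), N.map (homOfLE h) ≫ (α K).hom =
    (α J).hom ≫ M.map (homOfLE (Finset.map_subset_map.2 h)))
  (hM : ∀ I : Finset ι, (∀ J : Finset κ, J.map e ≠ I) → IsZero (M.obj I))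

/-- The terms of the complexes are isomorphic if `M` vanishes on subsets outside the image. -/
def reindexXIso (i : ℤ) : X N i ≅ X M i where
  hom := reindexX e α i
  inv := reindexXInv e α i
  hom_inv_id := X_hom_ext fun J => by
    rw [← Category.assoc, incl_reindexX, Preadditive.zsmul_comp, Category.assoc, incl_reindexXInv,
      Preadditive.comp_zsmul, smul_smul, reindexSign_mul_self, one_smul, Category.comp_id,
      Iso.hom_inv_id_assoc]
  inv_hom_id := X_hom_ext fun I => by
    by_cases h : ∃ J, mapLevel e J = I
    · obtain ⟨J, rfl⟩ := h
      rw [← Category.assoc, incl_reindexXInv, Preadditive.zsmul_comp, Category.assoc,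
        incl_reindexX, Preadditive.comp_zsmul, smul_smul, reindexSign_mul_self, one_smul,
        Category.comp_id, Iso.inv_hom_id_assoc]
    · refine (hM I.1 fun J hJ => h ⟨⟨J, ?_⟩, Subtype.ext hJ⟩).eq_of_src _ _
      rw [← Finset.card_map e, hJ]
      exact I.2

include hα hM in
lemma reindexX_d (i : ℤ) : reindexX e α i ≫ d M i = d N i ≫ reindexX e α (i + 1) := by
  refine X_hom_ext fun J => ?_
  rw [← Category.assoc, incl_reindexX, ← Category.assoc, incl_d, Preadditive.zsmul_comp,
    Category.assoc, incl_d, Preadditive.sum_comp, Preadditive.comp_sum, Finset.smul_sum]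
  symm
  refine Fintype.sum_of_injective
    (fun t : {t : κ // t ∉ J.1} => (⟨e t.1, by
      rw [mapLevel, Finset.mem_map']; exact t.2⟩ : {s : ι // s ∉ (mapLevel e J).1}))
    (fun a b h => Subtype.ext (e.injective (congrArg Subtype.val h))) _ _ ?_ ?_
  -- Generators outside the image of e lead to subsets on which M vanishes.
  · intro s hs
    have : IsZero (M.obj (insert s.1 (mapLevel e J).1)) := by
      refine hM _ fun K hK => hs ?_
      obtain ⟨t, -, ht⟩ := Finset.mem_map.1 (hK.ge (Finset.mem_insert_self _ _))
      exact ⟨⟨t, fun h => s.2 (ht ▸ Finset.mem_map_of_mem e h)⟩, Subtype.ext ht⟩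
    rw [this.eq_of_tgt (M.map _) 0, zero_comp, smul_zero, comp_zero, smul_zero]
  · intro t
    have h1 : J.1.map e ≤ (insert t.1 J.1).map e := Finset.map_subset_map.2 (Finset.subset_insert _ _)
    have h2 := hα (Finset.subset_insert t.1 J.1)
    rw [Preadditive.zsmul_comp, Category.assoc, incl_reindexX, Preadditive.comp_zsmul,
      ← Category.assoc, h2, Category.assoc, Preadditive.comp_zsmul, smul_smul, smul_smul]
    have h3 := map_ι_congr M (Finset.map_insert e t.1 J.1) h1 (Finset.subset_insert _ _)
      (mapLevel e ⟨insert t.1 J.1, card_insert_level J t.2⟩).2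
      (card_insert_level (mapLevel e J) (by rw [mapLevel, Finset.mem_map']; exact t.2))
    exact (congrArg₂ (fun (n : ℤ) f => n • ((α J.1).hom ≫ f))
      (reindexSign_insert e J.1 t.2).symm h3)

/-- A coefficient system that vanishes outside of the image of `2^κ` has the same complex as its
restriction to `2^κ`. -/
def reindexIso : N.complex ≅ M.complex :=
  HomologicalComplex.Hom.isoOfComponents (fun i => reindexXIso e α hM i) (by
    intro i j hij
    obtain rfl : i + 1 = j := hij
    rw [complex_d, complex_d]
    exact reindexX_d e α hα hM i)

end CoeffSystem

end Reindex

/-! ### Permutation modules and equivariant partial maps -/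

section PartialMaps

universe u

variable {Q : Type u} [Group Q] {X Y Z : Type u} [MulAction Q X] [MulAction Q Y] [MulAction Q Z]

lemma Rep.ofMulAction_hom_ext {A : Rep.{u} ℤ Q} {f g : Rep.ofMulAction ℤ Q X ⟶ A}
    (h : ∀ x, f.hom (MonoidAlgebra.single x (1 : ℤ)) = g.hom (MonoidAlgebra.single x (1 : ℤ))) :
    f = g := by
  refine Rep.hom_ext (DFunLike.ext f.hom g.hom fun v => ?_)
  induction v using MonoidAlgebra.induction_linear with
  | zero => rw [map_zero, map_zero]
  | add v w hv hw => rw [map_add, map_add, hv, hw]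
  | single x r =>
    have e : (MonoidAlgebra.single x r : MonoidAlgebra ℤ X) = r • MonoidAlgebra.single x 1 := by
      rw [MonoidAlgebra.smul_single, smul_eq_mul, mul_one]
    rw [e]
    exact (map_zsmul f.hom r _).trans ((congrArg (r • ·) (h x)).trans (map_zsmul g.hom r _).symm)

/-- The basis element of an element of `X`, with value zero on `none`. -/
def optionSingle (x : Option X) : Rep.ofMulAction ℤ Q X :=
  x.elim 0 fun x => MonoidAlgebra.single x (1 : ℤ)

/-- The map of permutation modules given by an equivariant partially defined map. -/
def partialHom (f : X → Option Y) (hf : ∀ (q : Q) x, f (q • x) = (f x).map (q • ·)) :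
    Rep.ofMulAction ℤ Q X ⟶ Rep.ofMulAction ℤ Q Y :=
  Rep.ofHom ⟨Finsupp.lift _ _ _ (fun x => optionSingle (Q := Q) (f x)) ∘ₗ
    (MonoidAlgebra.coeffLinearEquiv ℤ).toLinearMap, fun q => by
      ext x
      cases h : f x <;> simp [optionSingle, hf, h]⟩

lemma partialHom_single (f : X → Option Y) (hf : ∀ (q : Q) x, f (q • x) = (f x).map (q • ·))
    (x : X) : (partialHom f hf).hom (MonoidAlgebra.single x (1 : ℤ)) =
      optionSingle (Q := Q) (f x) := by
  simp [partialHom]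

lemma partialHom_comp_eq {f : X → Option Y} {g : Y → Option Z} {h : X → Option Z}
    (hf : ∀ (q : Q) x, f (q • x) = (f x).map (q • ·))
    (hg : ∀ (q : Q) x, g (q • x) = (g x).map (q • ·))
    (hh : ∀ (q : Q) x, h (q • x) = (h x).map (q • ·)) (e : ∀ x, (f x).bind g = h x) :
    partialHom f hf ≫ partialHom g hg = partialHom h hh := by
  refine Rep.ofMulAction_hom_ext fun x => ?_
  rw [partialHom_single, Rep.hom_comp, ← e]
  refine (congrArg (partialHom g hg).hom (partialHom_single f hf x)).trans ?_
  cases f x with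
  | none => exact map_zero _
  | some y => exact partialHom_single g hg y

lemma partialHom_id_eq {f : X → Option X} (hf : ∀ (q : Q) x, f (q • x) = (f x).map (q • ·))
    (e : ∀ x, f x = some x) : partialHom f hf = 𝟙 _ := by
  refine Rep.ofMulAction_hom_ext fun x => ?_
  rw [partialHom_single, e]
  rfl

/-- The isomorphism of permutation modules given by an equivariant bijection. -/
def permIso (f : X ≃ Y) (hf : ∀ (q : Q) x, f (q • x) = q • f x) :
    Rep.ofMulAction ℤ Q X ≅ Rep.ofMulAction ℤ Q Y where
  hom := partialHom (fun x => some (f x)) fun q x => congrArg some (hf q x)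
  inv := partialHom (fun x => some (f.symm x)) fun q x => congrArg some (by
    rw [f.symm_apply_eq, hf, f.apply_symm_apply])
  hom_inv_id := by
    rw [partialHom_comp_eq (h := some) _ _ (fun _ _ => rfl) (by simp)]
    exact partialHom_id_eq _ fun _ => rfl
  inv_hom_id := by
    rw [partialHom_comp_eq (h := some) _ _ (fun _ _ => rfl) (by simp)]
    exact partialHom_id_eq _ fun _ => rfl

lemma isIso_partialHom {f : X → Option Y} (hf : ∀ (q : Q) x, f (q • x) = (f x).map (q • ·))
    (g : X → Y) (hg : ∀ x, f x = some (g x)) (h : Function.Bijective g) :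
    IsIso (partialHom f hf) := by
  have hg' : ∀ (q : Q) x, g (q • x) = q • g x := fun q x => by
    have := hf q x
    rw [hg, hg] at this
    exact Option.some_injective _ this
  have : partialHom f hf = (permIso (Equiv.ofBijective g h) hg').hom := by
    refine Rep.ofMulAction_hom_ext fun x => ?_
    rw [partialHom_single, hg]
    exact (partialHom_single (fun x => some (g x)) (fun q x => congrArg some (hg' q x)) x).symm
  rw [this]
  infer_instance

lemma isZero_ofMulAction [IsEmpty X] : IsZero (Rep.ofMulAction ℤ Q X : Rep.{u} ℤ Q) := by
  rw [IsZero.iff_id_eq_zero]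
  exact Rep.ofMulAction_hom_ext fun x => isEmptyElim x

end PartialMaps

/-! ### Layers of a ranked system of permutation modules -/

section RankedSystem

universe u w

/-- A functor from the subsets of `ι` to `Q`-sets together with a `Q`-invariant rank function that
does not increase along the transition maps. -/
structure RankedSystem (Q : Type u) [Group Q] (ι : Type w) where
  /-- The set attached to a subset of `ι`. -/
  X : Finset ι → Type u
  [action : ∀ J, MulAction Q (X J)]
  /-- The transition maps. -/
  map : ∀ {J K : Finset ι}, J ≤ K → X J → X K
  /-- The rank functions. -/
  rank : ∀ {J : Finset ι}, X J → ℕ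
  map_smul : ∀ {J K : Finset ι} (h : J ≤ K) (q : Q) (x : X J), map h (q • x) = q • map h x
  map_refl : ∀ {J : Finset ι} (x : X J), map le_rfl x = x
  map_map : ∀ {J K L : Finset ι} (h : J ≤ K) (h' : K ≤ L) (x : X J),
    map h' (map h x) = map (h.trans h') x
  rank_smul : ∀ {J : Finset ι} (q : Q) (x : X J), rank (q • x) = rank x
  rank_map_le : ∀ {J K : Finset ι} (h : J ≤ K) (x : X J), rank (map h x) ≤ rank x

namespace RankedSystem

attribute [instance] action

variable {Q : Type u} [Group Q] {ι : Type w} (R : RankedSystem Q ι) (A A' A'' : Set ℕ)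

/-- The elements with rank in `A`. -/
abbrev Layer (J : Finset ι) : Type u := {x : R.X J // R.rank x ∈ A}

instance (J : Finset ι) : MulAction Q (R.Layer A J) where
  smul q x := ⟨q • x.1, by rw [R.rank_smul]; exact x.2⟩
  one_smul x := Subtype.ext (one_smul Q x.1)
  mul_smul q r x := Subtype.ext (mul_smul q r x.1)

lemma layer_smul_val {J : Finset ι} (q : Q) (x : R.Layer A J) : (q • x).1 = q • x.1 := rfl

open Classical in
/-- An element of `X J` as an element of a layer, if it has suitable rank. -/
def toLayer {J : Finset ι} (x : R.X J) : Option (R.Layer A J) :=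
  if h : R.rank x ∈ A then some ⟨x, h⟩ else none

variable {A} in
lemma toLayer_of_mem {J : Finset ι} {x : R.X J} (h : R.rank x ∈ A) :
    R.toLayer A x = some ⟨x, h⟩ := dif_pos h

variable {A} in
lemma toLayer_of_notMem {J : Finset ι} {x : R.X J} (h : R.rank x ∉ A) :
    R.toLayer A x = none := dif_neg h

lemma toLayer_smul {J : Finset ι} (q : Q) (x : R.X J) :
    R.toLayer A (q • x) = (R.toLayer A x).map (q • ·) := by
  by_cases h : R.rank x ∈ A
  · rw [R.toLayer_of_mem h, R.toLayer_of_mem (by rwa [R.rank_smul])]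
    rfl
  · rw [R.toLayer_of_notMem h, R.toLayer_of_notMem (by rwa [R.rank_smul])]
    rfl

/-- The transition map between layers as a partial map, possibly with a change of layer. -/
def step {J K : Finset ι} (h : J ≤ K) (x : R.Layer A J) : Option (R.Layer A' K) :=
  R.toLayer A' (R.map h x.1)

lemma step_smul {J K : Finset ι} (h : J ≤ K) (q : Q) (x : R.Layer A J) :
    R.step A A' h (q • x) = (R.step A A' h x).map (q • ·) := by
  rw [step, layer_smul_val, R.map_smul, toLayer_smul]
  rfl

/-- The map of permutation modules given by `step`. -/
def stepHom {J K : Finset ι} (h : J ≤ K) : Rep.ofMulAction ℤ Q (R.Layer A J) ⟶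
    Rep.ofMulAction ℤ Q (R.Layer A' K) :=
  partialHom (R.step A A' h) (R.step_smul A A' h)

lemma stepHom_single {J K : Finset ι} (h : J ≤ K) (x : R.Layer A J) (y : R.Layer A' K)
    (e : R.map h x.1 = y.1) : (R.stepHom A A' h).hom (MonoidAlgebra.single x (1 : ℤ)) =
      MonoidAlgebra.single y (1 : ℤ) := by
  rw [stepHom, partialHom_single, step, R.toLayer_of_mem (by rw [e]; exact y.2)]
  exact congrArg (MonoidAlgebra.single · (1 : ℤ)) (Subtype.ext e)

/-- The hypothesis excludes the only obstruction: an element killed at the middle stage whose final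
image would survive. -/
lemma stepHom_comp {J K L : Finset ι} (h : J ≤ K) (h' : K ≤ L)
    (H : ∀ x : R.X J, R.rank x ∈ A → R.rank (R.map (h.trans h') x) ∈ A'' →
      R.rank (R.map h x) ∈ A') :
    R.stepHom A A' h ≫ R.stepHom A' A'' h' = R.stepHom A A'' (h.trans h') := by
  refine partialHom_comp_eq _ _ _ fun x => ?_
  by_cases h1 : R.rank (R.map h x.1) ∈ A'
  · rw [step, R.toLayer_of_mem h1, Option.bind_some, step, step, R.map_map]
  · rw [step, R.toLayer_of_notMem h1, Option.bind_none, step, R.toLayer_of_notMem]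
    exact fun h2 => h1 (H x.1 x.2 h2)

lemma stepHom_refl {J : Finset ι} : R.stepHom A A (le_refl J) = 𝟙 _ :=
  partialHom_id_eq _ fun x => by
    rw [step, R.map_refl, R.toLayer_of_mem x.2]

/-- The coefficient system of permutation modules given by the elements with rank in an interval. -/
def layer [hA : A.OrdConnected] : CoeffSystem ι (Rep.{u} ℤ Q) where
  obj J := Rep.ofMulAction ℤ Q (R.Layer A J)
  map f := R.stepHom A A (leOfHom f)
  map_id _ := R.stepHom_refl A
  -- The intermediate rank lies between the final and the initial one, so it is in A by
  -- order-connectedness.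
  map_comp f g := (R.stepHom_comp A A A (leOfHom f) (leOfHom g) fun x h h' =>
    hA.out h' h ⟨by rw [← R.map_map (leOfHom f) (leOfHom g)]; exact R.rank_map_le _ _,
      R.rank_map_le _ _⟩).symm

/-- The natural map between layers. -/
def transfer [A.OrdConnected] [A'.OrdConnected]
    (H : ∀ m n, m ≤ n → n ∈ A → m ∈ A' → m ∈ A ∧ n ∈ A') : R.layer A ⟶ R.layer A' where
  app J := R.stepHom A A' (le_refl J)
  naturality J K f := by
    refine (R.stepHom_comp A A A' (leOfHom f) (le_refl K) fun x h h' => ?_).trans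
      (R.stepHom_comp A A' A' (le_refl J) (leOfHom f) fun x h h' => ?_).symm
    · exact (H _ _ (R.rank_map_le _ x) h h').1
    · rw [R.map_refl]
      exact (H _ _ (R.rank_map_le _ x) h h').2

variable {ι : Type w} [Fintype ι] [LinearOrder ι] (R : RankedSystem Q ι)

/-- The complex of a layer in the homotopy category. -/
abbrev quotientLayer (A : Set ℕ) [A.OrdConnected] :
    HomotopyCategory (Rep.{u} ℤ Q) (ComplexShape.up ℤ) :=
  (HomotopyCategory.quotient _ _).obj (R.layer A).complex

lemma isZero_quotientLayer_of_forall_ne (k : ℕ) (h : ∀ J (x : R.X J), R.rank x ≠ k) :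
    IsZero (R.quotientLayer {k}) := by
  rw [HomotopyCategory.isZero_quotient_obj_iff]
  refine ⟨Homotopy.ofEq (HomologicalComplex.hom_ext _ _ fun i =>
    CoeffSystem.X_hom_ext (M := R.layer {k}) fun I => ?_)⟩
  have : IsEmpty (R.Layer {k} I.1) := ⟨fun x => h _ x.1 x.2⟩
  exact (isZero_ofMulAction (Q := Q) (X := R.Layer {k} I.1)).eq_of_src _ _

/-- Bijections of the bases are isomorphisms of the permutation modules, so the layer is contracted
along a. -/
lemma isZero_quotientLayer_of_bijective (k : ℕ) (a : ι)
    (hk : ∀ {J K : Finset ι} (h : J ≤ K), a ∉ J → K ⊆ insert a J →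
      (∀ x : R.X J, R.rank x = k → R.rank (R.map h x) = k) ∧
      (∀ x y : R.X J, R.rank x = k → R.rank y = k → R.map h x = R.map h y → x = y) ∧
      ∀ z : R.X K, R.rank z = k → ∃ x : R.X J, R.rank x = k ∧ R.map h x = z) :
    IsZero (R.quotientLayer {k}) := by
  refine CoeffSystem.isZero_quotient_complex _ a fun {J K} h haJ hK => ?_
  obtain ⟨h1, h2, h3⟩ := hk h haJ hK
  refine isIso_partialHom (R.step_smul _ _ h) (fun x => ⟨R.map h x.1, h1 x.1 x.2⟩)
    (fun x => R.toLayer_of_mem _) ⟨fun x y e => ?_, fun z => ?_⟩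
  · exact Subtype.ext (h2 _ _ x.2 y.2 (congrArg Subtype.val e))
  · obtain ⟨x, hx, e⟩ := h3 z.1 z.2
    exact ⟨⟨x, hx⟩, Subtype.ext e⟩

omit [Fintype ι] [LinearOrder ι] in
lemma stepHom_eq_zero {A A' : Set ℕ} (hA : Disjoint A A') (J : Finset ι) :
    R.stepHom A A' (le_refl J) = 0 := by
  refine Rep.ofMulAction_hom_ext fun x => ?_
  rw [stepHom, partialHom_single, step, R.map_refl,
    R.toLayer_of_notMem (Set.disjoint_left.1 hA x.2)]
  rfl

omit [Fintype ι] [LinearOrder ι] in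
lemma stepHom_add (k : ℕ) (J : Finset ι) :
    R.stepHom (Set.Ici k) {k} (le_refl J) ≫ R.stepHom {k} (Set.Ici k) (le_refl J) +
      R.stepHom (Set.Ici k) (Set.Ici (k + 1)) (le_refl J) ≫
        R.stepHom (Set.Ici (k + 1)) (Set.Ici k) (le_refl J) = 𝟙 _ := by
  refine Rep.ofMulAction_hom_ext fun x => ?_
  have key : ∀ (A : Set ℕ), (R.stepHom (Set.Ici k) A (le_refl J) ≫
      R.stepHom A (Set.Ici k) (le_refl J)).hom (MonoidAlgebra.single x (1 : ℤ)) =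
      optionSingle (Q := Q) ((R.toLayer A x.1).map fun _ => x) := by
    intro A
    rw [stepHom, stepHom, partialHom_comp_eq _ _ (h := fun x => (R.toLayer A x.1).map fun _ => x),
      partialHom_single]
    · intro q x
      rw [layer_smul_val, toLayer_smul]
      cases R.toLayer A x.1 <;> rfl
    · intro x
      by_cases h : R.rank x.1 ∈ A
      · rw [step, R.map_refl, R.toLayer_of_mem h, Option.bind_some, step, R.map_refl,
          R.toLayer_of_mem x.2]
        rfl
      · rw [step, R.map_refl, R.toLayer_of_notMem h]
        rfl
  rw [Rep.add_hom]
  refine (congrArg₂ (· + ·) (key {k}) (key (Set.Ici (k + 1)))).trans ?_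
  rcases eq_or_lt_of_le (show k ≤ R.rank x.1 from x.2) with h | h
  · rw [R.toLayer_of_mem (show R.rank x.1 ∈ {k} from h.symm), R.toLayer_of_notMem]
    · exact add_zero _
    · exact fun h' : k + 1 ≤ _ => by omega
  · rw [R.toLayer_of_notMem (show R.rank x.1 ∉ ({k} : Set ℕ) from h.ne'), R.toLayer_of_mem
      (show R.rank x.1 ∈ Set.Ici (k + 1) from h)]
    exact zero_add _

/-- Removing the elements of rank `k` from the elements of rank at least `k`. -/
lemma nonempty_iso_succ (k : ℕ) (h : IsZero (R.quotientLayer {k})) :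
    Nonempty (R.quotientLayer (Set.Ici k) ≅ R.quotientLayer (Set.Ici (k + 1))) := by
  -- Ranks never increase, so an element of rank k keeps its rank or becomes zero among the ranks ≥
  -- k. Rank k is thus a subsystem, and the ranks > k form the quotient.
  let φ : R.layer {k} ⟶ R.layer (Set.Ici k) := R.transfer _ _ fun m n h1 h2 h3 => by
    simp only [Set.mem_singleton_iff, Set.mem_Ici] at *
    omega
  let ψ : R.layer (Set.Ici k) ⟶ R.layer (Set.Ici (k + 1)) := R.transfer _ _ fun m n h1 h2 h3 => by
    simp only [Set.mem_Ici] at *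
    omega
  have := CoeffSystem.isIso_quotient_map_of_isZero φ ψ ?_
    (fun J => R.stepHom (Set.Ici k) {k} (le_refl J))
    (fun J => R.stepHom (Set.Ici (k + 1)) (Set.Ici k) (le_refl J)) ?_ ?_ (R.stepHom_add k) h
  · exact ⟨asIso ((HomotopyCategory.quotient _ _).map (CoeffSystem.mapComplex ψ))⟩
  · ext1
    funext J
    refine (R.stepHom_comp _ _ _ (le_refl J) (le_refl J) fun x h1 h2 => ?_).trans
      (R.stepHom_eq_zero ?_ J)
    · rw [R.map_refl] at *
      exact Nat.le_of_succ_le h2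
    · rw [Set.disjoint_left]
      rintro a rfl h
      exact Nat.not_succ_le_self a h
  · intro J
    refine (R.stepHom_comp _ _ _ (le_refl J) (le_refl J) fun x h1 h2 => ?_).trans
      (R.stepHom_refl _)
    rw [R.map_refl] at *
    exact le_of_eq h1.symm
  · intro J
    refine (R.stepHom_comp _ _ _ (le_refl J) (le_refl J) fun x h1 h2 => ?_).trans
      (R.stepHom_refl _)
    rw [R.map_refl] at *
    exact Nat.le_of_succ_le h2

lemma nonempty_iso_of_isZero (k : ℕ) (h : ∀ j < k, IsZero (R.quotientLayer {j})) :
    Nonempty (R.quotientLayer (Set.Ici 0) ≅ R.quotientLayer (Set.Ici k)) := by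
  induction k with
  | zero => exact ⟨Iso.refl _⟩
  | succ k ih =>
    obtain ⟨α⟩ := ih fun j hj => h j (Nat.lt_succ_of_lt hj)
    obtain ⟨β⟩ := R.nonempty_iso_succ k (h k (Nat.lt_succ_self k))
    exact ⟨α ≪≫ β⟩

end RankedSystem

end RankedSystem

/-! ### Permutation modules induced along a homomorphism -/

section Induced

open scoped TensorProduct

universe u

variable {L Q : Type u} [Group L] [Group Q] (φ : L →* Q) {H : Subgroup L}
  {Y : Type u} [MulAction Q Y] {y : Y}

/-- The map `gH ↦ φ(g)y` for an element `y` fixed by `φ(H)`. -/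
def orbitMap (hy : ∀ h ∈ H, φ h • y = y) (x : L ⧸ H) : Y :=
  Quotient.liftOn' x (fun g => φ g • y) fun a b h => by
    have := hy _ (QuotientGroup.leftRel_apply.1 h)
    rw [map_mul, map_inv, mul_smul, inv_smul_eq_iff] at this
    exact this.symm

lemma orbitMap_coe (hy : ∀ h ∈ H, φ h • y = y) (g : L) : orbitMap φ hy (g : L ⧸ H) = φ g • y := rfl

lemma orbitMap_smul (hy : ∀ h ∈ H, φ h • y = y) (g : L) (x : L ⧸ H) :
    orbitMap φ hy (g • x) = φ g • orbitMap φ hy x := by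
  induction x using QuotientGroup.induction_on with
  | H x =>
    change φ (g * x) • y = φ g • φ x • y
    rw [map_mul, mul_smul]

/-- The map from the module induced from `ℤ[L/H]` given by an element fixed by `φ(H)`. -/
def indHom (hy : ∀ h ∈ H, φ h • y = y) :
    Rep.ind φ (Rep.ofMulAction ℤ L (L ⧸ H)) ⟶ Rep.ofMulAction ℤ Q Y :=
  (Rep.indResHomEquiv φ (Rep.ofMulAction ℤ L (L ⧸ H)) (Rep.ofMulAction ℤ Q Y)).symm
    (Rep.ofHom ⟨MonoidAlgebra.mapDomainLinearMap ℤ ℤ (orbitMap φ hy), fun g => by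
      refine MonoidAlgebra.lhom_ext' fun x => LinearMap.ext_ring ?_
      simp [orbitMap_smul]⟩)

/-- The element of the induced module given by an element of `Q` and a basis element. -/
abbrev indSingle (q : Q) (x : L ⧸ H) : Rep.ind φ (Rep.ofMulAction ℤ L (L ⧸ H)) :=
  Representation.IndV.mk φ (Rep.ofMulAction ℤ L (L ⧸ H)).ρ q (MonoidAlgebra.single x (1 : ℤ))

lemma indHom_indSingle (hy : ∀ h ∈ H, φ h • y = y) (q : Q) (x : L ⧸ H) :
    (indHom φ hy).hom (indSingle φ q x) =
      MonoidAlgebra.single (q⁻¹ • orbitMap φ hy x) (1 : ℤ) := by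
  simp [indHom, indSingle]

/-- This is the defining relation of the coinvariants. The symbol with label q corresponds to q⁻¹ ⊗
x, whence the inverses here and in `indHom_indSingle`. -/
lemma indSingle_smul (q : Q) (g : L) (x : L ⧸ H) :
    indSingle φ q (g • x) = indSingle φ (φ g⁻¹ * q) x := by
  have := Representation.Coinvariants.mk_self_apply
    (Representation.tprod ((Representation.leftRegular ℤ Q).comp φ)
      (Rep.ofMulAction ℤ L (L ⧸ H)).ρ) g
    (MonoidAlgebra.single (φ g⁻¹ * q) (1 : ℤ) ⊗ₜ[ℤ] MonoidAlgebra.single x (1 : ℤ))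
  refine Eq.trans ?_ this
  simp [indSingle]

lemma ind_linearMap_ext {A : Type*} [AddCommGroup A]
    {f g : Rep.ind φ (Rep.ofMulAction ℤ L (L ⧸ H)) →ₗ[ℤ] A}
    (h : ∀ q x, f (indSingle φ q x) = g (indSingle φ q x)) : f = g := by
  refine Representation.IndV.hom_ext _ _ fun q => ?_
  exact MonoidAlgebra.lhom_ext' fun x => LinearMap.ext_ring (h q x)

/-- The module induced from ℤ[L/H] is ℤ[Q/φ(H)], and Y is a transitive Q-set with point stabilizer
φ(H). The inverse is built from a choice of elements carrying y to each point. -/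
lemma isIso_indHom (hy : ∀ h ∈ H, φ h • y = y) (h1 : ∀ z : Y, ∃ q : Q, q • y = z)
    (h2 : ∀ q : Q, q • y = y → ∃ h ∈ H, φ h = q) : IsIso (indHom φ hy) := by
  choose σ hσ using h1
  let τ : MonoidAlgebra ℤ Y →ₗ[ℤ] Rep.ind φ (Rep.ofMulAction ℤ L (L ⧸ H)) :=
    Finsupp.lift _ _ _ (fun z => indSingle φ (σ z)⁻¹ ((1 : L) : L ⧸ H)) ∘ₗ
    (MonoidAlgebra.coeffLinearEquiv ℤ).toLinearMap
  have hτ : ∀ z, τ (MonoidAlgebra.single z 1) = indSingle φ (σ z)⁻¹ ((1 : L) : L ⧸ H) := by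
    intro z
    simp [τ]
  have e1 : (indHom φ hy).hom.toLinearMap ∘ₗ τ = LinearMap.id := by
    refine MonoidAlgebra.lhom_ext' fun z => LinearMap.ext_ring ?_
    change (indHom φ hy).hom (τ (MonoidAlgebra.single z 1)) = MonoidAlgebra.single z 1
    rw [hτ, indHom_indSingle, orbitMap_coe, map_one, one_smul, inv_inv, hσ]
  have e2 : τ ∘ₗ (indHom φ hy).hom.toLinearMap = LinearMap.id := by
    refine ind_linearMap_ext φ fun q x => ?_
    change τ ((indHom φ hy).hom (indSingle φ q x)) = indSingle φ q x
    rw [indHom_indSingle, hτ]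
    induction x using QuotientGroup.induction_on with
    | H g =>
      rw [orbitMap_coe]
      set z := q⁻¹ • φ g • y with hz
      -- The chosen σ(z) and q⁻¹φ(g) both send y to z, so they differ by an element φ(h) of the
      -- stabilizer, which the relation of the induced module absorbs.
      obtain ⟨h, hh, e⟩ := h2 ((φ g)⁻¹ * q * σ z) (by
        rw [mul_smul, hσ, hz, mul_smul, smul_inv_smul, inv_smul_smul])
      have : (g : L ⧸ H) = (g * h) • ((1 : L) : L ⧸ H) := by
        rw [MulAction.Quotient.smul_coe, smul_eq_mul, mul_one]
        exact (QuotientGroup.mk_mul_of_mem g hh).symm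
      rw [this, indSingle_smul]
      congr 1
      rw [map_inv, map_mul, e]
      group
  have hb : Function.Bijective (indHom φ hy).hom :=
    ⟨Function.LeftInverse.injective (g := τ) fun v => LinearMap.congr_fun e2 v,
      Function.RightInverse.surjective (g := τ) fun v => LinearMap.congr_fun e1 v⟩
  exact (Rep.mkIso ((indHom φ hy).hom.ofBijective hb)).isIso_hom

lemma indMap_cosetMap_indHom {K : Subgroup L} (hHK : H ≤ K) {Z : Type u} [MulAction Q Z] {z : Z}
    (hy : ∀ h ∈ H, φ h • y = y) (hz : ∀ h ∈ K, φ h • z = z)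
    (F : Rep.ofMulAction ℤ Q Y ⟶ Rep.ofMulAction ℤ Q Z)
    (hF : ∀ q : Q, F.hom (MonoidAlgebra.single (q • y) (1 : ℤ)) =
      MonoidAlgebra.single (q • z) (1 : ℤ)) :
    Rep.indMap φ (cosetMap hHK) ≫ indHom φ hz = indHom φ hy ≫ F := by
  refine Rep.hom_ext (Representation.IntertwiningMap.ext (ind_linearMap_ext φ fun q x => ?_))
  induction x using QuotientGroup.induction_on with
  | H g =>
    have e : (Rep.indMap φ (cosetMap hHK)).hom (indSingle φ q (g : L ⧸ H)) =
        indSingle φ q (g : L ⧸ K) := by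
      exact congrArg (Representation.IndV.mk φ (Rep.ofMulAction ℤ L (L ⧸ K)).ρ q)
        (cosetMap_single hHK g)
    refine (congrArg (indHom φ hz).hom e).trans (Eq.trans ?_
      (congrArg F.hom (indHom_indSingle φ hy q _)).symm)
    rw [indHom_indSingle, orbitMap_coe, orbitMap_coe, ← mul_smul, ← mul_smul, hF]

end Induced

/-! ### Restriction of permutation modules to a subgroup -/

section Restriction

universe u

variable {G : Type u} [Group G] (Q : Subgroup G) (X : Type u) [MulAction G X]

/-- The restriction of a permutation module to a subgroup. -/
def resIso : Rep.res Q.subtype (Rep.ofMulAction ℤ G X) ≅ (Rep.ofMulAction ℤ Q X : Rep.{u} ℤ Q) where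
  hom := Rep.ofHom ⟨LinearMap.id, fun q => by
    refine MonoidAlgebra.lhom_ext' fun x => LinearMap.ext_ring ?_
    simp
    rfl⟩
  inv := Rep.ofHom ⟨LinearMap.id, fun q => by
    refine MonoidAlgebra.lhom_ext' fun x => LinearMap.ext_ring ?_
    simp
    rfl⟩

variable {Q X}

/-- A `Q`-set that is a restriction of a `G`-set gives the restriction of a permutation module. -/
def permResIso {Z : Type u} [MulAction Q Z] (e : Z ≃ X)
    (he : ∀ (q : Q) z, e (q • z) = (q : G) • e z) :
    (Rep.ofMulAction ℤ Q Z : Rep.{u} ℤ Q) ≅ Rep.res Q.subtype (Rep.ofMulAction ℤ G X) :=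
  permIso e he ≪≫ (resIso Q X).symm

lemma permResIso_single {Z : Type u} [MulAction Q Z] (e : Z ≃ X)
    (he : ∀ (q : Q) z, e (q • z) = (q : G) • e z) (z : Z) :
    (permResIso e he).hom.hom (MonoidAlgebra.single z (1 : ℤ)) =
      MonoidAlgebra.single (e z) (1 : ℤ) :=
  partialHom_single (fun z => some (e z)) (fun q z => congrArg some (he q z)) z

end Restriction

/-! ### The rank filtration of St(G) and its top layer -/

section SteinbergRank

universe u w

lemma quotientMapOfLE_self {G : Type*} [Group G] {H : Subgroup G} (x : G ⧸ H) :
    Subgroup.quotientMapOfLE (le_refl H) x = x := by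
  induction x using QuotientGroup.induction_on with
  | H x => rfl

lemma quotientMapOfLE_map {G : Type*} [Group G] {H K L : Subgroup G} (h : H ≤ K) (h' : K ≤ L)
    (x : G ⧸ H) : Subgroup.quotientMapOfLE h' (Subgroup.quotientMapOfLE h x) =
      Subgroup.quotientMapOfLE (h.trans h') x := by
  induction x using QuotientGroup.induction_on with
  | H x => rfl

section CosetSystem

variable {G : Type u} [Group G] {ι : Type w} (Q : Subgroup G) (P : Finset ι → Subgroup G)
  (hP : Monotone P) {f : G → ℕ} (hf : ∀ q ∈ Q, ∀ g, f (q * g) = f g)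

/-- The cosets of an increasing family of subgroups as a ranked system. -/
def cosetSystem : RankedSystem Q ι where
  X J := G ⧸ P J
  action J := MulAction.compHom (G ⧸ P J) Q.subtype
  map h := Subgroup.quotientMapOfLE (hP h)
  rank x := cosetRank f x
  map_smul _ q x := quotientMapOfLE_smul _ (q : G) x
  map_refl x := quotientMapOfLE_self x
  map_map _ _ x := quotientMapOfLE_map _ _ x
  rank_smul q x := cosetRank_smul (q := (q : G)) (hf q q.2) x
  rank_map_le _ x := cosetRank_map_le _ x

/-- A coset in a layer. -/
abbrev layerCoset {A : Set ℕ} {J : Finset ι} (n : G) (h : cosetRank f (n : G ⧸ P J) ∈ A) :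
    (cosetSystem Q P hP hf).Layer A J := ⟨(n : G ⧸ P J), h⟩

lemma smul_layerCoset_eq_iff {A : Set ℕ} {J : Finset ι} {n : G}
    (h : cosetRank f (n : G ⧸ P J) ∈ A) (q : Q) :
    q • layerCoset Q P hP hf n h = layerCoset Q P hP hf n h ↔ n⁻¹ * q * n ∈ P J := by
  rw [Subtype.ext_iff]
  change ((q * n : G) : G ⧸ P J) = (n : G ⧸ P J) ↔ _
  rw [eq_comm, QuotientGroup.eq, mul_assoc]

lemma stepHom_smul_layerCoset {A : Set ℕ} {J K : Finset ι} {n : G}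
    (h : cosetRank f (n : G ⧸ P J) ∈ A) (h' : cosetRank f (n : G ⧸ P K) ∈ A) (hJK : J ≤ K)
    (q : Q) : ((cosetSystem Q P hP hf).stepHom A A hJK).hom
      (MonoidAlgebra.single (q • layerCoset Q P hP hf n h) (1 : ℤ)) =
      MonoidAlgebra.single (q • layerCoset Q P hP hf n h') (1 : ℤ) :=
  (cosetSystem Q P hP hf).stepHom_single _ _ _ _ _ rfl

/-- The elements of nonnegative rank are all cosets. -/
def layerIciZeroIso (J : Finset ι) :
    (Rep.ofMulAction ℤ Q ((cosetSystem Q P hP hf).Layer (Set.Ici 0) J) : Rep.{u} ℤ Q) ≅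
      Rep.res Q.subtype (Rep.ofMulAction ℤ G (G ⧸ P J)) :=
  permResIso (Equiv.subtypeUnivEquiv (α := G ⧸ P J) fun _ => Nat.zero_le _) fun _ _ => rfl

lemma layerIciZeroIso_single (J : Finset ι) (x : (cosetSystem Q P hP hf).Layer (Set.Ici 0) J) :
    (layerIciZeroIso Q P hP hf J).hom.hom (MonoidAlgebra.single x (1 : ℤ)) =
      (MonoidAlgebra.single (M := G ⧸ P J) x.1 (1 : ℤ) : MonoidAlgebra ℤ (G ⧸ P J)) :=
  permResIso_single _ _ x

lemma cosetMap_single_quotient {H K : Subgroup G} (h : H ≤ K) (z : G ⧸ H) :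
    (cosetMap h).hom (MonoidAlgebra.single z (1 : ℤ)) =
      MonoidAlgebra.single (Subgroup.quotientMapOfLE h z) (1 : ℤ) := by
  induction z using QuotientGroup.induction_on with
  | H g => exact cosetMap_single _ g

lemma stepHom_layerIciZeroIso {J K : Finset ι} (h : J ≤ K) :
    (cosetSystem Q P hP hf).stepHom (Set.Ici 0) (Set.Ici 0) h ≫
      (layerIciZeroIso Q P hP hf K).hom = (layerIciZeroIso Q P hP hf J).hom ≫
        (Rep.resFunctor Q.subtype).map (cosetMap (hP h)) := by
  refine Rep.ofMulAction_hom_ext fun x => ?_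
  change (layerIciZeroIso Q P hP hf K).hom.hom
    (((cosetSystem Q P hP hf).stepHom (Set.Ici 0) (Set.Ici 0) h).hom
      (MonoidAlgebra.single x (1 : ℤ))) = (cosetMap (hP h)).hom
    ((layerIciZeroIso Q P hP hf J).hom.hom (MonoidAlgebra.single x (1 : ℤ)))
  rw [(cosetSystem Q P hP hf).stepHom_single (Set.Ici 0) (Set.Ici 0) h x
    ⟨(cosetSystem Q P hP hf).map h x.1, Nat.zero_le _⟩ rfl]
  rw [layerIciZeroIso_single]
  exact ((congrArg (cosetMap (hP h)).hom (layerIciZeroIso_single Q P hP hf J x)).trans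
    (cosetMap_single_quotient (hP h) x.1)).symm

end CosetSystem

namespace BNData.IsBruhat

variable {G : Type u} [Group G] {ι : Type w} {D : BNData G ι}
  {W : Type*} [Group W] {s : ι → W} {δ : G → W} (hδ : D.IsBruhat s δ)
  {I : Finset ι} {f : W → ℕ} (hf : IsRank s (I : Set ι) f)

/-- The cosets of the standard parabolic subgroups as a ranked system of `P_I`-sets. -/
abbrev rankedSystem : RankedSystem (D.P (I : Set ι)) ι :=
  cosetSystem (D.P (I : Set ι)) (fun J : Finset ι => D.P (J : Set ι))
    (fun _ _ h => D.P_mono (Finset.coe_subset.2 h)) (f := fun g => f (δ g))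
    fun _ hq g => hδ.rank_mul hf hq g

section

variable [Fintype ι] [LinearOrder ι]

/-- A value of f below the top is f(y) for a minimal y ≠ w_I w_S, and the layer is contracted along
the ascent of y. Numbers that f does not take give empty layers. -/
lemma isZero_quotientLayer {a b : W} (ha : IsLongestIn s (I : Set ι) a)
    (hb : IsLongestIn s Set.univ b) (k : ℕ) (hk : k < f (a * b)) :
    IsZero ((hδ.rankedSystem hf).quotientLayer {k}) := by
  by_cases h : ∃ v, f v = k
  · obtain ⟨v, rfl⟩ := h
    obtain ⟨u, hu, hy⟩ := hδ.exists_isLeftMin (I : Set ι) v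
    rw [← hf.mul u hu v] at hk ⊢
    generalize u * v = y at hy hk
    obtain ⟨i, hi, hi'⟩ := hδ.exists_ascent ha hb hy fun e => hk.ne (congrArg f e)
    refine RankedSystem.isZero_quotientLayer_of_bijective _ _ i fun {J K} h _ hK => ?_
    have hJK : (J : Set ι) ⊆ K := Finset.coe_subset.2 h
    have hK' : (K : Set ι) ⊆ insert i (J : Set ι) := by
      rw [← Finset.coe_insert]
      exact Finset.coe_subset.2 hK
    refine ⟨fun x hx => hδ.rank_map hf hy hi hJK hK' hx, fun x y hx hx' e =>
      hδ.rank_map_injective hf hy hi hJK hK' hi' hx hx' e, fun z hz => ?_⟩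
    obtain ⟨x, hx, e⟩ := exists_of_rank_map (φ := fun g => f (δ g)) hJK z
    exact ⟨x, hx.trans hz, e⟩
  · refine RankedSystem.isZero_quotientLayer_of_forall_ne _ _ fun J x hx => h ?_
    obtain ⟨g, -, e⟩ := exists_cosetRank (f := fun g => f (δ g)) x
    exact ⟨δ g, e.trans hx⟩

end

/-- The layer of all elements of the ranked system is the restriction of the coefficient system. -/
def layerIso : (hδ.rankedSystem hf).layer (Set.Ici 0) ≅
    CoeffSystem.whisker (Rep.resFunctor (D.P (I : Set ι)).subtype) D.StSystem :=
  NatIso.ofComponents (fun J => layerIciZeroIso (D.P (I : Set ι)) _ _ _ J) fun h =>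
    stepHom_layerIciZeroIso (D.P (I : Set ι)) _ _ _ (leOfHom h)

section Levi

variable {m w : G} (hm : m ∈ D.N) (hw : w ∈ D.N)
  (ha : IsLongestIn s (I : Set ι) (δ m)) (hb : IsLongestIn s Set.univ (δ w))
  {e : {i // i ∈ I} ↪ ι} (he : ∀ i : {i // i ∈ I}, s i * (δ m * δ w) = δ m * δ w * s (e i))

include hδ hf hm hw ha hb he in
lemma rank_mem_Ici (J : Finset {i // i ∈ I}) :
    cosetRank (fun g => f (δ g)) ((m * w : G) : G ⧸ D.P (J.map e : Set ι)) ∈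
      Set.Ici (f (δ m * δ w)) := by
  refine (hδ.rank_longest hf ha hb (e := e) he (hδ.mul_N _ hm _ hw) ?_).ge
  rw [Finset.coe_map]
  exact Set.image_subset_range _ _

/-- The coset of `w_I w_S` in the layer of maximal rank. -/
abbrev base (J : Finset {i // i ∈ I}) :
    (hδ.rankedSystem hf).Layer (Set.Ici (f (δ m * δ w))) (J.map e) :=
  layerCoset (D.P (I : Set ι)) _ _ _ (m * w) (hδ.rank_mem_Ici hf hm hw ha hb he J)

lemma smul_base_eq_iff {J : Finset {i // i ∈ I}} {q : D.P (I : Set ι)} :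
    q • hδ.base hf hm hw ha hb he J = hδ.base hf hm hw ha hb he J ↔
      (m * w)⁻¹ * q * (m * w) ∈ D.P (e '' (J : Set {i // i ∈ I})) := by
  rw [← Finset.coe_map]
  exact smul_layerCoset_eq_iff _ _ _ _ _ q

lemma levi_smul_base {J : Finset {i // i ∈ I}} :
    ∀ h ∈ (D.levi I).P (J : Set {i // i ∈ I}),
      Subgroup.inclusion (D.L_le_P (I : Set ι)) h • hδ.base hf hm hw ha hb he J =
        hδ.base hf hm hw ha hb he J :=
  fun _ hh => (hδ.smul_base_eq_iff hf hm hw ha hb he).2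
    (hδ.conj_mem_P_of_mem_levi_P hm hw ha hb he hh)

lemma exists_smul_base {J : Finset {i // i ∈ I}}
    (z : (hδ.rankedSystem hf).Layer (Set.Ici (f (δ m * δ w))) (J.map e)) :
    ∃ q : D.P (I : Set ι), q • hδ.base hf hm hw ha hb he J = z := by
  obtain ⟨q, hq, h⟩ := hδ.exists_smul_longest hf (hδ.mul_N _ hm _ hw)
    (le_antisymm (hδ.rank_le_longest hf ha hb z.1) z.2)
  exact ⟨⟨q, hq⟩, Subtype.ext h.symm⟩

/-- The top layer at e(J) is one P_I-orbit, and the stabilizer of its base point is the parabolic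
subgroup of L_I of type J. -/
lemma isIso_indHom_base (J : Finset {i // i ∈ I}) :
    IsIso (indHom (Subgroup.inclusion (D.L_le_P (I : Set ι)))
      (hδ.levi_smul_base hf hm hw ha hb he (J := J))) := by
  refine isIso_indHom _ _ (hδ.exists_smul_base hf hm hw ha hb he) fun q hq => ?_
  obtain ⟨h, hh, h'⟩ := hδ.mem_levi_P_of_conj_mem_P hm hw ha hb he q.2
    ((hδ.smul_base_eq_iff hf hm hw ha hb he).1 hq)
  exact ⟨h, hh, Subtype.ext h'⟩

lemma indMap_indHom_base {J K : Finset {i // i ∈ I}} (h : J ≤ K) :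
    Rep.indMap (Subgroup.inclusion (D.L_le_P (I : Set ι)))
      (cosetMap ((D.levi I).P_mono (Finset.coe_subset.2 h))) ≫
      indHom (Subgroup.inclusion (D.L_le_P (I : Set ι)))
        (hδ.levi_smul_base hf hm hw ha hb he (J := K)) =
    indHom (Subgroup.inclusion (D.L_le_P (I : Set ι)))
        (hδ.levi_smul_base hf hm hw ha hb he (J := J)) ≫
      (hδ.rankedSystem hf).stepHom (Set.Ici (f (δ m * δ w))) (Set.Ici (f (δ m * δ w)))
        (Finset.map_subset_map.2 h) := by
  refine indMap_cosetMap_indHom _ _ _ _ _ fun q => ?_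
  exact stepHom_smul_layerCoset (D.P (I : Set ι)) (fun J : Finset ι => D.P (J : Set ι))
    (fun _ _ h => D.P_mono (Finset.coe_subset.2 h)) (fun _ hq g => hδ.rank_mul hf hq g)
    (hδ.rank_mem_Ici hf hm hw ha hb he J) (hδ.rank_mem_Ici hf hm hw ha hb he K)
    (Finset.map_subset_map.2 h) q

variable [Fintype ι] [LinearOrder ι]

/-- The complex of the layer of maximal rank is induced from the Levi subgroup. -/
def layerLongestIso :
    (CoeffSystem.whisker (Rep.indFunctor ℤ (Subgroup.inclusion (D.L_le_P (I : Set ι))))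
      (D.levi I).StSystem).complex ≅
    ((hδ.rankedSystem hf).layer (Set.Ici (f (δ m * δ w)))).complex :=
  CoeffSystem.reindexIso e
    (fun J =>
      @asIso _ _ _ _ (indHom (Subgroup.inclusion (D.L_le_P (I : Set ι)))
        (hδ.levi_smul_base hf hm hw ha hb he (J := J)))
        (hδ.isIso_indHom_base hf hm hw ha hb he J))
    (fun {J K} h => by
      exact hδ.indMap_indHom_base hf hm hw ha hb he h)
    fun J hJ => by
      -- No coset of P_J has top rank unless J lies in the image of e.
      have : IsEmpty ((hδ.rankedSystem hf).Layer (Set.Ici (f (δ m * δ w))) J) := by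
        refine ⟨fun x => ?_⟩
        have h := hδ.subset_range_of_rank hf ha hb (e := e) he
          (le_antisymm (hδ.rank_le_longest hf ha hb x.1) x.2)
        obtain ⟨K, -, hK⟩ := Finset.subset_set_image_iff.1 (Set.image_univ (f := e) ▸ h)
        exact hJ K ((Finset.map_eq_image _ _).trans hK)
      exact isZero_ofMulAction

end Levi

end BNData.IsBruhat

end SteinbergRank

-- The isomorphism in the homotopy category and the Solomon–Tits theorem

universe u w

namespace BNData

variable {G : Type u} [Group G] [Finite G] {ι : Type w} [Fintype ι] [LinearOrder ι]
  {D : BNData G ι} {p : ℕ} {U : Subgroup G}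

/-- In the homotopy category, the restriction of `St(G)` to `P_I` is induced from `St(L_I)`. -/
lemma IsSplit.nonempty_iso (hD : D.IsSplit p U) (I : Finset ι) :
    Nonempty ((HomotopyCategory.quotient _ _).obj
      (((Rep.resFunctor (D.P (I : Set ι)).subtype).mapHomologicalComplex _).obj D.St) ≅
      (HomotopyCategory.quotient _ _).obj
        (((Rep.indFunctor ℤ (Subgroup.inclusion (D.L_le_P (I : Set ι)))).mapHomologicalComplex
          (ComplexShape.up ℤ)).obj (D.levi I).St)) := by
  obtain ⟨W, _, s, δ, hδ⟩ := exists_isBruhat hD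
  have : Finite W := Finite.of_surjective δ fun v => (hδ.surj v).imp fun _ h => h.2
  obtain ⟨f, hf⟩ := hδ.exists_isRank (I : Set ι)
  obtain ⟨a, ha⟩ := exists_isLongestIn s (I : Set ι)
  obtain ⟨b, hb⟩ := exists_isLongestIn s Set.univ
  obtain ⟨m, hm, rfl⟩ := hδ.surj a
  obtain ⟨w, hw, rfl⟩ := hδ.surj b
  choose e he using fun i : {i // i ∈ I} => hδ.gen_mul_longest ha hb (Finset.mem_coe.2 i.2)
  have he' : Function.Injective e := fun i j h => Subtype.ext (hδ.injective
    (mul_right_cancel ((he i).trans ((congrArg _ (congrArg s h)).trans (he j).symm))))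
  obtain ⟨α⟩ := (hδ.rankedSystem hf).nonempty_iso_of_isZero (f (δ m * δ w))
    (hδ.isZero_quotientLayer hf ha hb)
  exact ⟨((HomotopyCategory.quotient _ _).mapIso
    (CoeffSystem.complexIso (hδ.layerIso hf) ≪≫ CoeffSystem.mapComplexIso _ _)).symm ≪≫ α ≪≫
    (HomotopyCategory.quotient _ _).mapIso
    ((hδ.layerLongestIso hf hm hw ha hb (e := ⟨e, he'⟩) he).symm ≪≫
      CoeffSystem.mapComplexIso _ _)⟩

omit [Finite G] [Fintype ι] in
lemma isZero_levi_empty_homology {i : ℤ} (hi : i ≠ 0) :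
    IsZero ((((Rep.indFunctor ℤ (Subgroup.inclusion
      (D.L_le_P ((∅ : Finset ι) : Set ι)))).mapHomologicalComplex
          (ComplexShape.up ℤ)).obj (D.levi ∅).St).homology i) := by
  have : IsEmpty (CoeffSystem.Level {j : ι // j ∈ (∅ : Finset ι)} i) := ⟨fun J => hi (by
    rw [← J.2, Finset.eq_empty_of_isEmpty J.1, Finset.card_empty, Nat.cast_zero])⟩
  refine HomologicalComplex.ExactAt.isZero_homology (ShortComplex.exact_of_isZero_X₂ _ ?_)
  refine Functor.map_isZero (Rep.indFunctor ℤ (Subgroup.inclusion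
    (D.L_le_P ((∅ : Finset ι) : Set ι)))) (X := CoeffSystem.X (D.levi ∅).StSystem i) ?_
  rw [IsZero.iff_id_eq_zero]
  exact CoeffSystem.X_hom_ext fun J => isEmptyElim J

/-- The Solomon–Tits theorem. -/
lemma IsSplit.isZero_homology (hD : D.IsSplit p U) {i : ℤ} (hi : i ≠ 0) :
    IsZero (D.St.homology i) := by
  obtain ⟨α⟩ := hD.nonempty_iso ∅
  have h := (isZero_levi_empty_homology (D := D) hi).of_iso
    ((((HomotopyCategory.homologyFunctorFactors _ (ComplexShape.up ℤ) i).app _).symm ≪≫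
      (HomotopyCategory.homologyFunctor _ (ComplexShape.up ℤ) i).mapIso α ≪≫
      (HomotopyCategory.homologyFunctorFactors _ (ComplexShape.up ℤ) i).app _))
  rw [← HomologicalComplex.exactAt_iff_isZero_homology]
  -- Exactness does not depend on the group action, so it may be tested after restriction to P_∅.
  exact (Rep.res_map_exact _ _).1 ((HomologicalComplex.exactAt_iff_isZero_homology _ i).2 h)

end BNData
end

theorem theorem20 {G : Type*} [Group G] [Finite G] {ι : Type*} [Fintype ι] [LinearOrder ι]
    (p : ℕ) (hp : p.Prime) (D : BNData G ι) (U : Subgroup G) (hD : D.IsSplit p U) :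
    (∀ I : Finset ι, Nonempty (D.resSt I ≅ D.indSt I)) ∧
      (∀ i : ℤ, i ≠ 0 → IsZero (D.St.homology i)) :=
  ⟨fun I => (hD.nonempty_iso I).map fun α => ObjectProperty.isoMk _ α,
    fun _ hi => hD.isZero_homology hi⟩
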